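/- **Theorem (Fréchet near-adaptivity of the ETAC code).** All logarithms are in base $2$. *Redundancy.* For probability distributions on $\mathbb N_+^n$, let $D(P,Q)=\sum_x P(x)\log\frac{P(x)}{Q(x)}\in[0,\infty]$. For a class $\Lambda$ of sources, let $\Lambda_n$ be the set of the laws $\mathbb P_n$ of the first $n$ symbols, $\mathbb P\in\Lambda$. Put $R^+(Q,\Lambda_n)=\sup_{P\in\Lambda_n}D(P,Q)$ and $R^+(\Lambda_n)=\inf_Q R^+(Q,\Lambda_n)$, the infimum being over all probability distributions $Q$ on $\mathbb N_+^n$. *Envelope class.* Let $f:\mathbb N_+\to(0,1]$ with $1<\sum_j f(j)<\infty$ be ultimately non-increasing, and let $\Lambda=\Lambda(f)$ be the class of stationary memoryless (i.i.d.) sources on $\mathbb N_+$ whose marginal $p$ satisfies $p(j)\le f(j)$ for all $j$. The envelope distribution function is $F(k)=1-\sum_{j>k}f(j)$ if $\sum_{j>k}f(j)<1$ and $F(k)=0$ otherwise ($k\in\mathbb N$). A smoothed envelope distribution function, also written $F$, is a distribution function carried by $[0,\infty)$ that coincides with it on $\mathbb N$ and has a continuous derivative on $[0,\infty)$ which is positive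 at all $x$ with $F(\lfloor x\rfloor)\in(0,1)$. Assume that $\Lambda$ is a Fréchet max-stable envelope class: for some smoothed $F$, some $\gamma>0$ and some $A_n>0$, with $U(t)=\inf\{x: F(x)\ge 1-1/t\}$, $$\lim_{n\to\infty}F^n\bigl(A_nx+U(n)\bigr)=\exp\bigl(-(1+\gamma x)^{-1/\gamma}\bigr)\qquad\text{whenever }1+\gamma x>0.$$ For a smoothed $F$, the exact threshold $m_n$ is the unique $x\ge0$ with $1-F(x)=x/n$. *ETAC code.* For a word $x_{1:n}\in\mathbb N_+^n$ and $0\le i\le n$ let $x_{1,i}\ge\dots\ge x_{i,i}$ be the order statistics of $x_{1:i}$, $M_i=\min(\{i\}\cup\{k: 1\le k\le i,\ x_{k,i}\le k\})$ (so $M_0=0$), and $n_i^j$ the number of occurrences of $j$ in $x_{1:i}$ (so $n_i^0=0$). Let $\widetilde x_i=x_i$ if $x_i\le M_{i-1}$ and $\widetilde x_i=0$ otherwise. Put $\widetilde Q_{i+1}(j\mid x_{1:i})=\dfrac{n_i^j+\frac12}{i+\frac{M_i+1}2}$ for $0\le j\le M_i$. Let $\ell(z)=\lfloor\log\max(z,1)\rfloor+1$,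 and let $L(y)=2\ell(\ell(y))+\ell(y)$ be the length of the Elias penultimate code of $y$. The codelength is $$\ell_n(x_{1:n})=-\log\Bigl(\widetilde Q_{n+1}(0\mid x_{1:n})\prod_{i=1}^{n}\widetilde Q_i(\widetilde x_i\mid x_{1:i-1})\Bigr)+L(1)+\sum_{i:\,x_i>M_{i-1}}L(x_i-M_{i-1}+1),$$ which satisfies Kraft's inequality on $\mathbb N_+^n$, and the ETAC coding distribution is $Q_n(x)=2^{-\ell_n(x)}\big/\sum_{y\in\mathbb N_+^n}2^{-\ell_n(y)}$; it does not depend on $f$. *Conclusion.* There are a constant $\kappa_\Lambda>0$ and $o_\Lambda(1)$ sequences tending to $0$ as $n\to\infty$, all depending only on $\Lambda$, such that for all large enough $n$ (not depending on the smoothing), and for every smoothed envelope distribution function of $f$, with its exact threshold $m_n$, $$(\kappa_\Lambda+o_\Lambda(1))\,m_n\le R^+(\Lambda_n)\le R^+(Q_n,\Lambda_n)\le\bigl(\tfrac52+o_\Lambda(1)\bigr)m_n\log n,$$ and, with the same $\kappa_\Lambda$, $$R^+(Q_n,\Lambda_n)\le\Bigl(\tfrac{5}{2\kappa_\Lambda}+o_\Lambda(1)\Bigr)\log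 n\;R^+(\Lambda_n).$$ In particular the ETAC code is asymptotically near-adaptive over Fréchet max-stable envelope classes with ultimately non-increasing envelope. -/

import Mathlib

open Filter Topology MeasureTheory
open scoped ENNReal

noncomputable section

namespace Etac

/-! ### Redundancy (base-2 logarithms throughout) -/

/-- Relative entropy `D(P, Q)` in bits, an element of `[0, ∞]`: the Kullback-Leibler divergence on
the discrete σ-algebra, divided by `ln 2`. -/
def relEntropy {α : Type*} (P Q : PMF α) : ℝ≥0∞ :=
  letI : MeasurableSpace α := ⊤
  InformationTheory.klDiv P.toMeasure Q.toMeasure / ENNReal.ofReal (Real.log 2)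

/-- Maximal redundancy `R⁺(Q, 𝒞)` of the coding distribution `Q` on the class `𝒞`. -/
def maxRedundancy {α : Type*} (Q : PMF α) (C : Set (PMF α)) : ℝ≥0∞ :=
  ⨆ P ∈ C, relEntropy P Q

/-- Minimax redundancy `R⁺(𝒞)`: infimum over all coding distributions. -/
def minimaxRedundancy {α : Type*} (C : Set (PMF α)) : ℝ≥0∞ :=
  ⨅ Q : PMF α, maxRedundancy Q C

/-! ### Envelope classes -/

/-- An envelope function: values in `(0, 1]` and `1 < ∑ f < ∞`. -/
structure IsEnvelope (f : ℕ+ → ℝ) : Prop where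
  pos : ∀ j, 0 < f j
  le_one : ∀ j, f j ≤ 1
  summable : Summable f
  one_lt_tsum : 1 < ∑' j, f j

/-- `Λₙ(f)`: the laws of the first `n` symbols of the stationary memoryless sources whose
marginal `p` is dominated by `f`, that is, the `n`-fold products of such `p`. -/
def envelopeClass (f : ℕ+ → ℝ) (n : ℕ) : Set (PMF (Fin n → ℕ+)) :=
  {P | ∃ p : PMF ℕ+, (∀ j, p j ≤ ENNReal.ofReal (f j)) ∧ ∀ x, P x = ∏ i, p (x i)}

/-- `∑_{j > k} f(j)`. -/
def tailSum (f : ℕ+ → ℝ) (k : ℕ) : ℝ :=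
  ∑' j : ℕ+, if k < (j : ℕ) then f j else 0

/-- The envelope distribution function at integers. -/
def envelopeCDF (f : ℕ+ → ℝ) (k : ℕ) : ℝ :=
  if tailSum f k < 1 then 1 - tailSum f k else 0

/-- `F` is a smoothed envelope distribution function of `f`: a distribution function carried by
`[0, ∞)` which coincides with the envelope distribution function on `ℕ` (hence tends to `1`), and
has a continuous derivative on `[0, ∞)` (one-sided at `0`) that is positive at all `x` such that
the envelope distribution function at `⌊x⌋` is in `(0, 1)`. -/
structure IsSmoothedEnvelope (f : ℕ+ → ℝ) (F : ℝ → ℝ) : Prop where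
  monotone : Monotone F
  eq_zero : ∀ x < 0, F x = 0
  coincide : ∀ k : ℕ, F k = envelopeCDF f k
  contDiffOn : ContDiffOn ℝ 1 F (Set.Ici 0)
  deriv_pos : ∀ x, 0 ≤ x → envelopeCDF f ⌊x⌋₊ ∈ Set.Ioo (0 : ℝ) 1 →
    0 < derivWithin F (Set.Ici 0) x

/-! ### Maximum domains of attraction -/

/-- The `(1 - 1/t)`-quantile `U(t)` of a distribution function. -/
def tailQuantile (F : ℝ → ℝ) (t : ℝ) : ℝ :=
  sInf {x | 1 - 1 / t ≤ F x}

/-- The generalized extreme value distribution function, on `{x | 0 < 1 + γ x}`. -/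
def gev (γ x : ℝ) : ℝ :=
  if γ = 0 then Real.exp (-Real.exp (-x)) else Real.exp (-(1 + γ * x) ^ (-1 / γ))

/-- `F ∈ MDA(γ)`: for some positive scaling sequence `(Aₙ)`, the law of the maximum of `n`
independent variables with distribution function `F`, centred at `U(n)` and scaled by `Aₙ`,
converges to the generalized extreme value distribution of index `γ`. -/
def MDA (γ : ℝ) (F : ℝ → ℝ) : Prop :=
  ∃ A : ℕ → ℝ, (∀ n, 0 < A n) ∧ ∀ x, 0 < 1 + γ * x →
    Tendsto (fun n : ℕ => F (A n * x + tailQuantile F n) ^ n) atTop (𝓝 (gev γ x))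

/-- The envelope class of `f` is a Fréchet max-stable envelope class: a smoothed envelope
distribution function belongs to `MDA(γ)` for some `γ > 0`. -/
def IsFrechetEnvelope (f : ℕ+ → ℝ) : Prop :=
  ∃ γ : ℝ, 0 < γ ∧ ∃ F : ℝ → ℝ, IsSmoothedEnvelope f F ∧ MDA γ F

/-- `f` is ultimately non-increasing. -/
def UltimatelyNonincreasing (f : ℕ+ → ℝ) : Prop :=
  ∃ j₀ : ℕ+, AntitoneOn f (Set.Ici j₀)

/-- The exact threshold `m(t)`: the solution `x ≥ 0` of `1 - F(x) = x / t`. -/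
def exactThreshold (F : ℝ → ℝ) (t : ℝ) : ℝ :=
  sInf {x | 0 ≤ x ∧ 1 - F x = x / t}

/-- For a smoothed envelope distribution function, the exact threshold is well defined. -/
theorem exactThreshold_spec {f : ℕ+ → ℝ} (hf : IsEnvelope f) {F : ℝ → ℝ}
    (hF : IsSmoothedEnvelope f F) {t : ℝ} (ht : 0 < t) :
    {x | 0 ≤ x ∧ 1 - F x = x / t} = {exactThreshold F t} := by
  have h0 : F 0 = 0 := by
    have h := hF.coincide 0
    have h1 : tailSum f 0 = ∑' j, f j := by
      unfold tailSum
      exact tsum_congr fun j => by simp [j.pos]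
    have h2 := hf.one_lt_tsum
    rw [envelopeCDF, if_neg (by rw [h1]; exact not_lt.mpr h2.le)] at h
    exact_mod_cast h
  have hcont : ContinuousOn (fun x => x / t - (1 - F x)) (Set.Icc 0 t) := by
    have h : ContinuousOn F (Set.Icc 0 t) :=
      hF.contDiffOn.continuousOn.mono fun y hy => hy.1
    fun_prop
  obtain ⟨x, hx, hx0⟩ : ∃ x ∈ Set.Icc 0 t, x / t - (1 - F x) = 0 := by
    have h := intermediate_value_Icc ht.le hcont
    refine h ⟨by simp [h0], ?_⟩
    have h1 : F 0 ≤ F t := hF.monotone ht.le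
    simp only [div_self ht.ne']
    linarith
  have huniq : {x | 0 ≤ x ∧ 1 - F x = x / t} = {x} := by
    ext y
    simp only [Set.mem_ofPred_eq, Set.mem_singleton_iff]
    constructor
    · rintro ⟨-, hy⟩
      rcases lt_trichotomy y x with h | h | h
      · have h1 := hF.monotone h.le
        have h2 : y / t < x / t := div_lt_div_of_pos_right h ht
        linarith
      · exact h
      · have h1 := hF.monotone h.le
        have h2 : x / t < y / t := div_lt_div_of_pos_right h ht
        linarith
    · rintro rfl
      exact ⟨hx.1, by linarith⟩
  rw [exactThreshold, huniq, csInf_singleton]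

/-! ### The ETAC code

A past `x₁, …, xᵢ` is a list of (positive) natural numbers. -/

/-- The order statistic `x_{k,i}`, `1 ≤ k ≤ i`: the `k`-th largest entry (`0` for `k > i`). -/
def orderStat (l : List ℕ) (k : ℕ) : ℕ :=
  (l.insertionSort (· ≥ ·)).getD (k - 1) 0

/-- The empirical threshold `Mᵢ = min (i, {k : x_{k,i} ≤ k})`; it is `0` for the empty past. -/
def threshold (l : List ℕ) : ℕ :=
  min l.length (sInf {k | 1 ≤ k ∧ orderStat l k ≤ k})

/-- The censored version of the symbol `a` after the past `l`: symbols larger than the threshold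
are replaced by `0`. -/
def censor (l : List ℕ) (a : ℕ) : ℕ :=
  if a ≤ threshold l then a else 0

/-- The predictive probability of `j ∈ {0, …, Mᵢ}` after the past `l` of length `i`, namely
`(nᵢʲ + 1/2) / (i + (Mᵢ + 1)/2)`. As pasts have positive entries, `nᵢ⁰ = 0`. -/
def predictive (l : List ℕ) (j : ℕ) : ℝ :=
  (l.count j + 1 / 2) / (l.length + (threshold l + 1) / 2)

/-- Length of the binary expansion of `z`: `⌊log₂ (max z 1)⌋ + 1`. -/
def binLength (z : ℕ) : ℕ := Nat.log 2 z + 1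

/-- Length of the Elias penultimate codeword of `y`. -/
def eliasLength (y : ℕ) : ℕ := 2 * binLength (binLength y) + binLength y

/-- The word `x` as a list of natural numbers. -/
def word {n : ℕ} (x : Fin n → ℕ+) : List ℕ := List.ofFn fun k => (x k : ℕ)

/-- The coding probability of the censored word `x̃₁ … x̃ₙ 0`, with the terminating `0`. -/
def mixtureProb {n : ℕ} (x : Fin n → ℕ+) : ℝ :=
  (∏ i : Fin n, predictive ((word x).take i) (censor ((word x).take i) (x i))) *
    predictive (word x) 0

/-- Ideal length of the arithmetic encoding of the censored word. -/
def mixtureLength {n : ℕ} (x : Fin n → ℕ+) : ℝ :=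
  -Real.logb 2 (mixtureProb x)

/-- Length of the Elias encoding of the redacted symbols: every symbol exceeding the current
threshold `M` contributes the codeword of `xᵢ - M + 1`; the terminating `0` contributes that
of `1`. -/
def redactedLength {n : ℕ} (x : Fin n → ℕ+) : ℕ :=
  (∑ i : Fin n, if (x i : ℕ) ≤ threshold ((word x).take i) then 0
    else eliasLength ((x i : ℕ) - threshold ((word x).take i) + 1)) + eliasLength 1

/-- Total codelength of the ETAC code, in bits. -/
def codelength {n : ℕ} (x : Fin n → ℕ+) : ℝ :=
  mixtureLength x + redactedLength x

/-- `2 ^ (-codelength)`. -/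
def codeWeight {n : ℕ} (x : Fin n → ℕ+) : ℝ≥0∞ :=
  ENNReal.ofReal ((2 : ℝ) ^ (-codelength x))

theorem predictive_pos (l : List ℕ) (j : ℕ) : 0 < predictive l j := by
  unfold predictive; positivity

/-- Contribution of the symbol `a` after the past `l` to the weight of a word. -/
def stepWeight (l : List ℕ) (a : ℕ) : ℝ≥0∞ :=
  ENNReal.ofReal (predictive l (censor l a)) *
    if a ≤ threshold l then 1 else (2⁻¹ : ℝ≥0∞) ^ eliasLength (a - threshold l + 1)

theorem codeWeight_eq {n : ℕ} (x : Fin n → ℕ+) :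
    codeWeight x = (∏ i : Fin n, stepWeight ((word x).take i) (x i)) *
      (ENNReal.ofReal (predictive (word x) 0) * (2⁻¹ : ℝ≥0∞) ^ eliasLength 1) := by
  have hpos : 0 < mixtureProb x := by
    unfold mixtureProb
    exact mul_pos (Finset.prod_pos fun i _ => predictive_pos _ _) (predictive_pos _ _)
  have h1 : (2 : ℝ) ^ (-codelength x) = mixtureProb x * (2⁻¹ : ℝ) ^ redactedLength x := by
    rw [codelength, mixtureLength, neg_add, neg_neg, Real.rpow_add two_pos,
      Real.rpow_logb two_pos (by norm_num) hpos, Real.rpow_neg two_pos.le, Real.rpow_natCast,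
      inv_pow]
  have h2 : ENNReal.ofReal ((2⁻¹ : ℝ) ^ redactedLength x) = (2⁻¹ : ℝ≥0∞) ^ redactedLength x := by
    rw [ENNReal.ofReal_pow (by positivity), ENNReal.ofReal_inv_of_pos two_pos,
      ENNReal.ofReal_ofNat]
  rw [codeWeight, h1, ENNReal.ofReal_mul hpos.le, h2, mixtureProb,
    ENNReal.ofReal_mul (Finset.prod_nonneg fun i _ => (predictive_pos _ _).le),
    ENNReal.ofReal_prod_of_nonneg fun i _ => (predictive_pos _ _).le, redactedLength, pow_add,
    ← Finset.prod_pow_eq_pow_sum]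
  simp only [stepWeight, Finset.prod_mul_distrib]
  have h3 : ∀ i : Fin n, (2⁻¹ : ℝ≥0∞) ^ (if (x i : ℕ) ≤ threshold ((word x).take i) then 0
      else eliasLength ((x i : ℕ) - threshold ((word x).take i) + 1)) =
      if (x i : ℕ) ≤ threshold ((word x).take i) then 1
      else (2⁻¹ : ℝ≥0∞) ^ eliasLength (x i - threshold ((word x).take i) + 1) := by
    intro i; split_ifs <;> simp
  simp only [h3]
  ring

theorem tsum_log_two (g : ℕ → ℝ≥0∞) :
    ∑' y : ℕ, g (Nat.log 2 (y + 1)) ≤ ∑' k : ℕ, 2 ^ k * g k := by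
  have key : ∀ K : ℕ, ∑ y ∈ Finset.range (2 ^ K - 1), g (Nat.log 2 (y + 1)) =
      ∑ k ∈ Finset.range K, 2 ^ k * g k := by
    intro K
    induction K with
    | zero => simp
    | succ K ih =>
      have e : 2 ^ (K + 1) - 1 = (2 ^ K - 1) + 2 ^ K := by
        have := Nat.one_le_two_pow (n := K)
        rw [pow_succ]; omega
      rw [e, Finset.sum_range_add, ih, Finset.sum_range_succ]
      congr 1
      have : ∀ z ∈ Finset.range (2 ^ K), g (Nat.log 2 (2 ^ K - 1 + z + 1)) = g K := by
        intro z hz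
        have h1 := Nat.one_le_two_pow (n := K)
        have hz := Finset.mem_range.mp hz
        congr 1
        rw [Nat.log_eq_iff (Or.inr ⟨by norm_num, by omega⟩), pow_succ]
        omega
      rw [Finset.sum_congr rfl this]
      simp
  rw [ENNReal.tsum_eq_iSup_nat]
  refine iSup_le fun N => ?_
  have hN : N ≤ 2 ^ N - 1 := by have := Nat.lt_two_pow_self (n := N); omega
  calc _ ≤ ∑ y ∈ Finset.range (2 ^ N - 1), g (Nat.log 2 (y + 1)) :=
        Finset.sum_le_sum_of_subset (Finset.range_mono hN)
    _ = _ := key N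
    _ ≤ _ := ENNReal.sum_le_tsum _

/-- Kraft inequality for the Elias penultimate code. -/
theorem elias_kraft : ∑' y : ℕ, (2⁻¹ : ℝ≥0∞) ^ eliasLength (y + 1) ≤ 1 := by
  have h2 : (2 : ℝ≥0∞) * 2⁻¹ = 1 := ENNReal.mul_inv_cancel (by norm_num) (by norm_num)
  have hle : (2⁻¹ : ℝ≥0∞) ≤ 1 := by simp
  have hpow : ∀ k m : ℕ, (2 : ℝ≥0∞) ^ k * (2⁻¹ : ℝ≥0∞) ^ (m + k) = (2⁻¹ : ℝ≥0∞) ^ m := by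
    intro k m
    rw [pow_add, mul_comm ((2⁻¹ : ℝ≥0∞) ^ m), ← mul_assoc, ← mul_pow, h2, one_pow, one_mul]
  calc ∑' y : ℕ, (2⁻¹ : ℝ≥0∞) ^ eliasLength (y + 1)
      ≤ ∑' k : ℕ, 2 ^ k * (2⁻¹ : ℝ≥0∞) ^ (2 * binLength (k + 1) + (k + 1)) :=
        tsum_log_two fun k => (2⁻¹ : ℝ≥0∞) ^ (2 * binLength (k + 1) + (k + 1))
    _ ≤ ∑' k : ℕ, (2⁻¹ : ℝ≥0∞) ^ (2 * (Nat.log 2 (k + 1) + 1)) := by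
        refine ENNReal.tsum_le_tsum fun k => ?_
        rw [← add_assoc, add_right_comm, hpow]
        exact pow_le_pow_right_of_le_one' hle (by simp [binLength])
    _ ≤ ∑' k : ℕ, 2 ^ k * (2⁻¹ : ℝ≥0∞) ^ (2 * (k + 1)) :=
        tsum_log_two fun k => (2⁻¹ : ℝ≥0∞) ^ (2 * (k + 1))
    _ ≤ ∑' k : ℕ, (2⁻¹ : ℝ≥0∞) ^ (k + 1) := by
        refine ENNReal.tsum_le_tsum fun k => ?_
        have e : 2 * (k + 1) = (k + 2) + k := by ring
        rw [e, hpow]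
        exact pow_le_pow_right_of_le_one' hle (by omega)
    _ = 1 := by
        simp only [pow_succ]
        rw [ENNReal.tsum_mul_right, ENNReal.tsum_geometric, ENNReal.one_sub_inv_two, inv_inv, h2]

theorem sum_count_le (l : List ℕ) (s : Finset ℕ) : ∑ j ∈ s, l.count j ≤ l.length := by
  induction l with
  | nil => simp
  | cons a l ih =>
    simp only [List.count_cons, Finset.sum_add_distrib, List.length_cons]
    have : ∑ j ∈ s, (if (a == j) = true then 1 else 0) ≤ 1 := by
      simp only [beq_iff_eq, Finset.sum_ite_eq]
      split_ifs <;> simp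
    omega

theorem tsum_stepWeight_le (l : List ℕ) (hl : 0 ∉ l) :
    ∑' a : ℕ+, stepWeight l a ≤ 1 := by
  set M := threshold l with hM
  set D : ℝ := l.length + (M + 1) / 2 with hD
  have hDpos : 0 < D := by positivity
  have hsplit : ∀ a : ℕ+, stepWeight l a =
      (if (a : ℕ) ≤ M then ENNReal.ofReal (predictive l a) else 0) +
      ENNReal.ofReal (predictive l 0) *
        (if (a : ℕ) ≤ M then 0 else (2⁻¹ : ℝ≥0∞) ^ eliasLength (a - M + 1)) := by
    intro a
    unfold stepWeight censor
    rw [← hM]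
    split_ifs <;> simp
  have h1 : ∑' a : ℕ+, (if (a : ℕ) ≤ M then ENNReal.ofReal (predictive l a) else 0) ≤
      ENNReal.ofReal ((l.length + M / 2) / D) := by
    calc _ ≤ ∑' j : ℕ, (if j ∈ Finset.Icc 1 M then ENNReal.ofReal (predictive l j) else 0) := by
          refine le_trans (ENNReal.tsum_le_tsum fun a => ?_)
            (ENNReal.tsum_comp_le_tsum_of_injective PNat.coe_injective _)
          have := a.pos
          simp only [Finset.mem_Icc]
          split_ifs <;> first | rfl | omega
      _ = ∑ j ∈ Finset.Icc 1 M, ENNReal.ofReal (predictive l j) := by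
          rw [tsum_eq_sum (s := Finset.Icc 1 M) (by intro j hj; simp only [hj, if_false])]
          exact Finset.sum_congr rfl fun j hj => by simp only [hj, if_true]
      _ = ENNReal.ofReal (∑ j ∈ Finset.Icc 1 M, predictive l j) :=
          (ENNReal.ofReal_sum_of_nonneg fun j _ => (predictive_pos l j).le).symm
      _ ≤ _ := by
          apply ENNReal.ofReal_le_ofReal
          simp only [predictive]
          rw [← Finset.sum_div]
          apply div_le_div_of_nonneg_right _ hDpos.le
          rw [Finset.sum_add_distrib]
          have := sum_count_le l (Finset.Icc 1 M)
          have h' : (∑ j ∈ Finset.Icc 1 M, (l.count j : ℝ)) ≤ l.length := by exact_mod_cast this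
          simp only [Finset.sum_const, Nat.card_Icc, nsmul_eq_mul]
          simp only [Nat.add_sub_cancel]
          linarith
  have h2 : ∑' a : ℕ+, (if (a : ℕ) ≤ M then 0 else (2⁻¹ : ℝ≥0∞) ^ eliasLength (a - M + 1)) ≤ 1 := by
    calc _ = ∑' a : {a : ℕ+ | M < (a : ℕ)}, (2⁻¹ : ℝ≥0∞) ^ eliasLength (((a : ℕ+) : ℕ) - M + 1) := by
          rw [tsum_subtype {a : ℕ+ | M < (a : ℕ)}
            fun a : ℕ+ => (2⁻¹ : ℝ≥0∞) ^ eliasLength ((a : ℕ) - M + 1)]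
          refine tsum_congr fun a => ?_
          by_cases h : (a : ℕ) ≤ M
          · simp [h]
          · simp [h, not_le.mp h]
      _ ≤ ∑' y : ℕ, (2⁻¹ : ℝ≥0∞) ^ eliasLength (y + 1) :=
          ENNReal.tsum_comp_le_tsum_of_injective
            (f := fun a : {a : ℕ+ | M < (a : ℕ)} => ((a : ℕ+) : ℕ) - M)
            (by
              rintro ⟨a, ha⟩ ⟨b, hb⟩ h
              have ha' : M < (a : ℕ) := ha
              have hb' : M < (b : ℕ) := hb
              have h' : (a : ℕ) - M = (b : ℕ) - M := h
              have e : (a : ℕ) = b := by omega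
              exact Subtype.ext (PNat.coe_injective e))
            (fun y => (2⁻¹ : ℝ≥0∞) ^ eliasLength (y + 1))
      _ ≤ 1 := elias_kraft
  have h0 : predictive l 0 = (1 / 2) / D := by
    simp [predictive, List.count_eq_zero.mpr hl, hD, hM]
  calc ∑' a : ℕ+, stepWeight l a
      ≤ ENNReal.ofReal ((l.length + M / 2) / D) + ENNReal.ofReal ((1 / 2) / D) * 1 := by
        simp only [hsplit]
        rw [ENNReal.tsum_add, ENNReal.tsum_mul_left, h0]
        gcongr
    _ = 1 := by
        rw [mul_one, ← ENNReal.ofReal_add (by positivity) (by positivity), ← add_div, hD]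
        rw [show (l.length : ℝ) + M / 2 + 1 / 2 = l.length + (M + 1) / 2 by ring,
          div_self (by positivity), ENNReal.ofReal_one]

theorem tsum_prod_stepWeight_le (n : ℕ) :
    ∑' x : Fin n → ℕ+, ∏ i : Fin n, stepWeight ((word x).take i) (x i) ≤ 1 := by
  induction n with
  | zero => simp
  | succ n ih =>
    have hw : ∀ (a : ℕ+) (x : Fin n → ℕ+),
        word (Fin.snoc (α := fun _ => ℕ+) x a) = word x ++ [(a : ℕ)] := by
      intro a x
      simp only [word]
      rw [List.ofFn_succ']
      simp [List.concat_eq_append]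
    have hlen : ∀ x : Fin n → ℕ+, (word x).length = n := by intro x; simp [word]
    rw [← (Fin.snocEquiv fun _ : Fin (n + 1) => ℕ+).tsum_eq, ENNReal.tsum_prod',
      ENNReal.tsum_comm]
    refine le_trans (ENNReal.tsum_le_tsum fun x => ?_) ih
    have hterm : ∀ a : ℕ+,
        (∏ i : Fin (n + 1), stepWeight
          ((word ((Fin.snocEquiv fun _ : Fin (n + 1) => ℕ+) (a, x))).take i)
          ((Fin.snocEquiv fun _ : Fin (n + 1) => ℕ+) (a, x) i)) =
        (∏ i : Fin n, stepWeight ((word x).take i) (x i)) * stepWeight (word x) a := by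
      intro a
      have e : (Fin.snocEquiv fun _ : Fin (n + 1) => ℕ+) (a, x) =
          Fin.snoc (α := fun _ => ℕ+) x a := rfl
      rw [e, hw, Fin.prod_univ_castSucc]
      congr 1
      · refine Finset.prod_congr rfl fun i _ => ?_
        rw [Fin.snoc_castSucc, Fin.val_castSucc, List.take_append_of_le_length]
        rw [hlen]; exact i.2.le
      · rw [Fin.snoc_last, Fin.val_last, List.take_append_of_le_length (hlen x).ge,
          List.take_of_length_le (hlen x).le]
    simp only [hterm]
    rw [ENNReal.tsum_mul_left]
    refine mul_le_of_le_one_right' (tsum_stepWeight_le _ ?_)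
    simp [word, List.mem_ofFn]

/-- Kraft inequality for the ETAC code. -/
theorem tsum_codeWeight_le (n : ℕ) : ∑' x : Fin n → ℕ+, codeWeight x ≤ 1 := by
  refine le_trans (ENNReal.tsum_le_tsum fun x => ?_) (tsum_prod_stepWeight_le n)
  rw [codeWeight_eq]
  refine mul_le_of_le_one_right' (mul_le_one' ?_ (pow_le_one' (by simp) _))
  rw [ENNReal.ofReal_le_one]
  have h0 : (word x).count 0 = 0 := by
    rw [List.count_eq_zero]
    simp [word, List.mem_ofFn]
  have h1 : (0 : ℝ) ≤ (word x).length := by positivity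
  have h2 : (0 : ℝ) ≤ threshold (word x) := by positivity
  rw [predictive, h0, div_le_one (by positivity)]
  push_cast
  linarith

theorem tsum_codeWeight_ne_zero (n : ℕ) : ∑' x : Fin n → ℕ+, codeWeight x ≠ 0 := by
  intro h
  have h1 := ENNReal.tsum_eq_zero.mp h (fun _ => 1)
  rw [codeWeight, ENNReal.ofReal_eq_zero] at h1
  have h2 : (0 : ℝ) < 2 ^ (-codelength (fun _ : Fin n => (1 : ℕ+))) := by positivity
  linarith

/-- The ETAC coding distribution `Qₙ` on words of length `n`: proportional to
`2 ^ (-codelength)`. -/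
def codingDist (n : ℕ) : PMF (Fin n → ℕ+) :=
  PMF.normalize codeWeight (tsum_codeWeight_ne_zero n)
    (ne_top_of_le_ne_top ENNReal.one_ne_top (tsum_codeWeight_le n))

end Etac

end

/-!
# Near-adaptivity of the ETAC code over Fréchet envelope classes

Write `T k = ∑_{j > k} f j` and let `K n` be the least `k` with `n T(k) ≤ k`. Every smoothed envelope
distribution function equals `1 - T` at large integers, so its exact threshold lies in
`(K n - 1, K n]` whatever the smoothing (`exactThreshold_bounds`), and it suffices to compare the
redundancies with `K n`.

*Regular variation.* The Fréchet limit forces `T` to be regularly varying of index `-α`,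
`α = 1 / γ`: convergence of types shows that the centring `U(n)` is equivalent to the scaling
(`tendsto_centring_div_scaling`), so that the limit can be read off as `T(t x) / T(x) → t ^ (-α)`.
As `f` is ultimately non-increasing, the monotone density theorem upgrades this to the von Mises
condition `k f(k) / T(k) → α` (`IsFrechetEnvelope.exists_tendsto`). Everything else uses only that
condition: `(1 + α) log (K n) ≤ (1 + o(1)) log n` (`eventually_log_level_le`),
`∑_{i ≤ n} K i / i ≤ (1 + α + o(1)) K n` up to logarithmic terms (`eventually_sum_level_div_le`),
and `f (K n + 1) ≥ c / n` (`eventually_increment_level_ge`).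

*Upper bound.* The relative entropy is at most the expectation of the codelength plus the
log-likelihood. Since the probability of a type class is at most one, the counts in the sequential
estimator cancel against the likelihood, and the pointwise redundancy
(`log_prob_sub_log_mixtureProb_le`, `log_div_codingDist_le`) is at most
`∑ M_i / (2 i) + (M_n / 2) log n` plus `log M_i + log x_i` for each redacted symbol `x_i`, up to
smaller terms. By exchangeability, the `i`-th symbol is redacted with probability at most `M_i / i`
given the multiset of the first `i` symbols (`lintegral_redacted_le`); by Chebyshev's inequality,
`M_i` does not exceed `K i` by more than a quantity of order `√(K i)` (`exists_subThreshold_le`);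
and redacted symbols much larger than `K n` contribute `O(K n)` to `∑ log x_i`, as tails decay
geometrically along dyadic multiples of `K n`. Hence there are about `∑ K i / i ∼ (1 + α) K n`
redacted symbols, each costing `2 log (K n) ∼ 2 (log n) / (1 + α)`, and the total is
`(2 + 1/2 + o(1)) K n log n` (`eventually_redundancyBound_le`).

*Lower bound.* Split the symbols between a constant `j₁` and `K n` into pairs, all having envelope at
least `c / n`, and consider the sources putting mass `c / n` on one symbol of each pair and the rest
of their mass up to `j₁`. Under the uniform prior on these sources, each pair hit by the word reveals
one bit, so the Bayes redundancy is at least the expected number of pairs hit, which is of order `K n`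
(`le_minimaxRedundancy`, `exists_le_minimaxRedundancy`).
-/

noncomputable section

namespace Etac

/-! ### Relative entropy of discrete distributions -/

open InformationTheory in
theorem klDiv_toMeasure_eq_tsum {α : Type*} [Countable α] [MeasurableSpace α]
    [MeasurableSingletonClass α] (P Q : PMF α) (h : ∀ x, Q x = 0 → P x = 0) :
    klDiv P.toMeasure Q.toMeasure =
      ∑' x, ENNReal.ofReal (klFun (P x / Q x).toReal) * Q x := by
  have hdens : P.toMeasure = Q.toMeasure.withDensity (fun x => P x / Q x) := by
    refine Measure.ext_of_singleton fun x => ?_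
    rw [withDensity_apply _ (measurableSet_singleton x), lintegral_singleton,
      PMF.toMeasure_apply_singleton _ _ (measurableSet_singleton x),
      PMF.toMeasure_apply_singleton _ _ (measurableSet_singleton x)]
    by_cases hx : Q x = 0
    · simp [hx, h x hx]
    · rw [ENNReal.div_mul_cancel hx (PMF.apply_ne_top Q x)]
  have hac : P.toMeasure ≪ Q.toMeasure := hdens ▸ withDensity_absolutelyContinuous _ _
  have hrn : P.toMeasure.rnDeriv Q.toMeasure =ᵐ[Q.toMeasure] fun x => P x / Q x := by
    conv_lhs => rw [hdens]
    exact Measure.rnDeriv_withDensity _ (measurable_of_countable _)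
  rw [klDiv_eq_lintegral_klFun_of_ac hac]
  rw [lintegral_congr_ae (g := fun x => ENNReal.ofReal (klFun (P x / Q x).toReal))
    (by filter_upwards [hrn] with x hx; rw [hx])]
  rw [lintegral_countable']
  exact tsum_congr fun x => by
    rw [PMF.toMeasure_apply_singleton _ _ (measurableSet_singleton x)]

/-- A pointwise bound on the log-likelihood ratio bounds the relative entropy. -/
theorem relEntropy_le_of_log_div_le {α : Type*} [Countable α] {P Q : PMF α}
    (hQ : ∀ x, Q x ≠ 0) {g : α → ℝ} (hg : ∀ x, 0 ≤ g x)
    (h : ∀ x, P x ≠ 0 → Real.log ((P x).toReal / (Q x).toReal) ≤ g x) :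
    relEntropy P Q ≤ (∑' x, P x * ENNReal.ofReal (g x)) / ENNReal.ofReal (Real.log 2) := by
  let _ : MeasurableSpace α := ⊤
  unfold relEntropy
  refine ENNReal.div_le_div_right ?_ _
  rw [klDiv_toMeasure_eq_tsum P Q fun x hx => absurd hx (hQ x)]
  have key : ∀ x, ENNReal.ofReal (InformationTheory.klFun (P x / Q x).toReal) * Q x + P x ≤
      P x * ENNReal.ofReal (g x) + Q x := by
    intro x
    obtain ⟨p, hp, hp'⟩ : ∃ p : ℝ, 0 ≤ p ∧ P x = ENNReal.ofReal p :=
      ⟨(P x).toReal, ENNReal.toReal_nonneg, (ENNReal.ofReal_toReal (PMF.apply_ne_top P x)).symm⟩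
    obtain ⟨q, hq, hq'⟩ : ∃ q : ℝ, 0 ≤ q ∧ Q x = ENNReal.ofReal q :=
      ⟨(Q x).toReal, ENNReal.toReal_nonneg, (ENNReal.ofReal_toReal (PMF.apply_ne_top Q x)).symm⟩
    have hq0 : 0 < q := by
      rcases hq.lt_or_eq with h1 | h1
      · exact h1
      · exact absurd (by simp [hq', ← h1]) (hQ x)
    have hx := h x
    rw [hp', hq'] at hx ⊢
    rw [← ENNReal.ofReal_div_of_pos hq0, ENNReal.toReal_ofReal (by positivity),
      ← ENNReal.ofReal_mul (InformationTheory.klFun_nonneg (by positivity)),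
      ← ENNReal.ofReal_mul hp, ← ENNReal.ofReal_add (by
        have := InformationTheory.klFun_nonneg (x := p / q) (by positivity)
        positivity) hp, ← ENNReal.ofReal_add (mul_nonneg hp (hg x)) hq]
    apply ENNReal.ofReal_le_ofReal
    rw [InformationTheory.klFun_apply]
    have e : (p / q * Real.log (p / q) + 1 - p / q) * q = p * Real.log (p / q) + q - p := by
      field_simp
    rw [e]
    rcases hp.lt_or_eq with h1 | h1
    · have h2 := hx (by simpa using h1)
      rw [ENNReal.toReal_ofReal hp, ENNReal.toReal_ofReal hq] at h2
      nlinarith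
    · rw [← h1]; simp
  have h1 := ENNReal.tsum_le_tsum key
  rw [ENNReal.tsum_add, ENNReal.tsum_add, PMF.tsum_coe, PMF.tsum_coe] at h1
  exact (ENNReal.add_le_add_iff_right ENNReal.one_ne_top).mp h1

/-- A Donsker-Varadhan type lower bound on the relative entropy, with a test function equal to
`d · log 2` on the support of `P` and to `-∞` elsewhere. -/
theorem tsum_mul_add_one_le_relEntropy {α : Type*} [Countable α] (P Q : PMF α) (d : α → ℕ) :
    (∑' x, P x * (d x : ℝ≥0∞)) * ENNReal.ofReal (Real.log 2) + 1 ≤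
      relEntropy P Q * ENNReal.ofReal (Real.log 2) +
        ∑' x, (if P x = 0 then 0 else 2 ^ d x * Q x) := by
  let _ : MeasurableSpace α := ⊤
  have hl2 : 0 < Real.log 2 := Real.log_pos one_lt_two
  have hl : ENNReal.ofReal (Real.log 2) ≠ 0 := by simpa using hl2
  have e : relEntropy P Q * ENNReal.ofReal (Real.log 2) =
      InformationTheory.klDiv P.toMeasure Q.toMeasure := by
    unfold relEntropy
    exact ENNReal.div_mul_cancel hl ENNReal.ofReal_ne_top
  rw [e]
  by_cases h : ∀ x, Q x = 0 → P x = 0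
  swap
  · rw [InformationTheory.klDiv_of_not_ac]
    · simp
    intro hac
    push Not at h
    obtain ⟨x, hx, hx'⟩ := h
    have h1 : Q.toMeasure {x} = 0 := by
      rw [PMF.toMeasure_apply_singleton _ _ (measurableSet_singleton x), hx]
    have h2 := hac h1
    rw [PMF.toMeasure_apply_singleton _ _ (measurableSet_singleton x)] at h2
    exact hx' h2
  rw [klDiv_toMeasure_eq_tsum P Q h, ← ENNReal.tsum_mul_right, ← PMF.tsum_coe Q,
    ← ENNReal.tsum_add, ← ENNReal.tsum_add]
  refine ENNReal.tsum_le_tsum fun x => ?_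
  by_cases hQ0 : Q x = 0
  · simp [hQ0, h x hQ0]
  by_cases hP0 : P x = 0
  · simp [hP0, InformationTheory.klFun_zero]
  obtain ⟨p, hp, hp'⟩ : ∃ p : ℝ, 0 ≤ p ∧ P x = ENNReal.ofReal p :=
    ⟨(P x).toReal, ENNReal.toReal_nonneg, (ENNReal.ofReal_toReal (PMF.apply_ne_top P x)).symm⟩
  obtain ⟨q, hq, hq'⟩ : ∃ q : ℝ, 0 ≤ q ∧ Q x = ENNReal.ofReal q :=
    ⟨(Q x).toReal, ENNReal.toReal_nonneg, (ENNReal.ofReal_toReal (PMF.apply_ne_top Q x)).symm⟩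
  rw [if_neg hP0]
  rw [hq'] at hQ0
  rw [hp'] at hP0
  have hq0 : 0 < q := by simpa using hQ0
  have hp0 : 0 < p := by simpa using hP0
  have hd : (d x : ℝ≥0∞) = ENNReal.ofReal (d x) := by simp
  have h2d : (2 : ℝ≥0∞) ^ d x = ENNReal.ofReal (2 ^ d x) := by
    rw [ENNReal.ofReal_pow (by norm_num)]; simp
  rw [hp', hq', hd, h2d, ← ENNReal.ofReal_div_of_pos hq0, ENNReal.toReal_ofReal (by positivity)]
  have hk := InformationTheory.klFun_nonneg (x := p / q) (by positivity)
  rw [← ENNReal.ofReal_mul hp, ← ENNReal.ofReal_mul (by positivity),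
    ← ENNReal.ofReal_add (by positivity) hq, ← ENNReal.ofReal_mul hk,
    ← ENNReal.ofReal_mul (by positivity), ← ENNReal.ofReal_add (by positivity) (by positivity)]
  apply ENNReal.ofReal_le_ofReal
  rw [InformationTheory.klFun_apply]
  have e : (p / q * Real.log (p / q) + 1 - p / q) * q = p * Real.log (p / q) + q - p := by
    field_simp
  rw [e]
  have h3 : Real.log (2 ^ d x * q / p) ≤ 2 ^ d x * q / p - 1 :=
    Real.log_le_sub_one_of_pos (by positivity)
  have h4 : Real.log (2 ^ d x * q / p) = d x * Real.log 2 - Real.log (p / q) := by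
    rw [Real.log_div (by positivity) (by positivity), Real.log_mul (by positivity) (by positivity),
      Real.log_div (by positivity) (by positivity), Real.log_pow]
    ring
  rw [h4] at h3
  have h5 := mul_le_mul_of_nonneg_left h3 hp
  have h6 : p * (2 ^ d x * q / p - 1) = 2 ^ d x * q - p := by field_simp
  rw [h6] at h5
  linarith

section

/-! ### The empirical threshold -/

theorem orderStat_le_iff (l : List ℕ) (k : ℕ) (hk : 1 ≤ k) (m : ℕ) :
    orderStat l k ≤ m ↔ l.countP (m < ·) < k := by
  unfold orderStat
  set s := l.insertionSort (· ≥ ·) with hs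
  have hperm : s.Perm l := List.perm_insertionSort _ l
  have hsort : s.Pairwise (· ≥ ·) := List.pairwise_insertionSort _ l
  rw [← hperm.countP_eq]
  clear_value s
  clear hs hperm
  induction s generalizing k with
  | nil => simp; omega
  | cons a s ih =>
    obtain ⟨h1, h2⟩ := List.pairwise_cons.mp hsort
    obtain ⟨j, rfl⟩ : ∃ j, k = j + 1 := ⟨k - 1, by omega⟩
    rw [Nat.add_sub_cancel]
    cases j with
    | zero =>
      simp only [List.getD_cons_zero]
      constructor
      · intro h
        rw [Nat.lt_one_iff, List.countP_eq_zero]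
        intro b hb
        rcases List.mem_cons.mp hb with rfl | hb
        · simpa using h
        · simpa using (h1 b hb).trans h
      · intro h
        rw [zero_add, Nat.lt_one_iff, List.countP_eq_zero] at h
        simpa using h a (by simp)
    | succ j =>
      have h3 : s.getD j 0 ≤ m ↔ s.countP (m < ·) < j + 1 := ih (j + 1) (by omega) h2
      rw [List.getD_cons_succ, h3, List.countP_cons]
      by_cases ha : m < a
      · simp [ha]
      · have h0 : s.countP (m < ·) = 0 := by
          rw [List.countP_eq_zero]
          intro b hb
          have h3 : b ≤ a := h1 b hb
          simp only [decide_eq_true_eq]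
          omega
        simp [ha, h0]

/-- The threshold is the least `k` which is at least the length of the list, or larger than the
number of entries exceeding `k`. -/
theorem threshold_le_iff (l : List ℕ) (k : ℕ) :
    threshold l ≤ k ↔ l.length ≤ k ∨ l.countP (k < ·) < k := by
  unfold threshold
  rw [min_le_iff]
  refine or_congr Iff.rfl ?_
  have hne : {k | 1 ≤ k ∧ orderStat l k ≤ k}.Nonempty := by
    refine ⟨l.length + 1, by omega, ?_⟩
    rw [orderStat_le_iff _ _ (by omega)]
    exact Nat.lt_succ_of_le List.countP_le_length
  constructor
  · intro h
    obtain ⟨h1, h2⟩ := Nat.sInf_mem hne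
    rw [orderStat_le_iff _ _ h1] at h2
    set j := sInf {k | 1 ≤ k ∧ orderStat l k ≤ k}
    have h3 : l.countP (k < ·) ≤ l.countP (j < ·) :=
      List.countP_mono_left fun x _ hx => by
        simp only [decide_eq_true_eq] at hx ⊢; omega
    omega
  · intro h
    exact Nat.sInf_le ⟨by omega, (orderStat_le_iff l k (by omega) k).mpr h⟩

variable {n : ℕ}

/-- The empirical threshold of the subword of `x` with set of positions `A`. -/
def subThreshold (x : Fin n → ℕ+) (A : Finset (Fin n)) : ℕ :=
  sInf {k | A.card ≤ k ∨ (A.filter fun a => k < (x a : ℕ)).card < k}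

theorem subThreshold_le_iff (x : Fin n → ℕ+) (A : Finset (Fin n)) (k : ℕ) :
    subThreshold x A ≤ k ↔ A.card ≤ k ∨ (A.filter fun a => k < (x a : ℕ)).card < k := by
  unfold subThreshold
  constructor
  · intro h
    have hne : {k | A.card ≤ k ∨ (A.filter fun a => k < (x a : ℕ)).card < k}.Nonempty :=
      ⟨A.card, Or.inl le_rfl⟩
    have h1 := Nat.sInf_mem hne
    set j := sInf {k | A.card ≤ k ∨ (A.filter fun a => k < (x a : ℕ)).card < k}
    rcases h1 with h1 | h1
    · exact Or.inl (h1.trans h)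
    · right
      refine lt_of_le_of_lt (Finset.card_le_card fun a ha => ?_) (h1.trans_le h)
      simp only [Finset.mem_filter] at ha ⊢
      exact ⟨ha.1, by omega⟩
  · exact fun h => Nat.sInf_le h

theorem subThreshold_le_card (x : Fin n → ℕ+) (A : Finset (Fin n)) :
    subThreshold x A ≤ A.card :=
  (subThreshold_le_iff x A _).mpr (Or.inl le_rfl)

theorem card_filter_subThreshold_lt_le (x : Fin n → ℕ+) (A : Finset (Fin n)) :
    (A.filter fun a => subThreshold x A < (x a : ℕ)).card ≤ subThreshold x A := by
  rcases (subThreshold_le_iff x A _).mp le_rfl with h | h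
  · exact (Finset.card_filter_le _ _).trans h
  · exact h.le

theorem subThreshold_mono (x : Fin n → ℕ+) {A B : Finset (Fin n)} (h : A ⊆ B) :
    subThreshold x A ≤ subThreshold x B := by
  rw [subThreshold_le_iff]
  rcases (subThreshold_le_iff x B _).mp le_rfl with h1 | h1
  · exact Or.inl ((Finset.card_le_card h).trans h1)
  · exact Or.inr ((Finset.card_le_card (Finset.filter_subset_filter _ h)).trans_lt h1)

/-- Whatever the word, at most `M` of the positions hold a symbol which would be redacted if it
were the last one to be read, where `M` is the threshold of the full word. -/
theorem card_filter_redacted_le (x : Fin n → ℕ+) (A : Finset (Fin n)) :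
    (A.filter fun a => subThreshold x (A.erase a) < (x a : ℕ)).card ≤ subThreshold x A := by
  set m := subThreshold x A with hm
  by_cases h : ∃ a ∈ A, subThreshold x (A.erase a) < (x a : ℕ) ∧ (x a : ℕ) ≤ m
  · obtain ⟨a, ha, h1, h2⟩ := h
    have hm1 : subThreshold x (A.erase a) ≤ m - 1 := by omega
    have hmpos : 0 < m := by have := (x a).pos; omega
    rcases (subThreshold_le_iff x _ _).mp hm1 with h3 | h3
    · rw [Finset.card_erase_of_mem ha] at h3
      exact (Finset.card_filter_le _ _).trans (by omega)
    · -- at most one more entry of the word than of the erased word reaches `m`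
      have h4 : (A.filter fun b => m - 1 < (x b : ℕ)).card ≤
          ((A.erase a).filter fun b => m - 1 < (x b : ℕ)).card + 1 := by
        rw [Finset.filter_erase]
        exact Nat.le_add_of_sub_le Finset.pred_card_le_card_erase
      have h5 : (A.filter fun b => subThreshold x (A.erase b) < (x b : ℕ)) ⊆
          A.filter fun b => m - 1 < (x b : ℕ) := by
        intro b hb
        simp only [Finset.mem_filter] at hb ⊢
        refine ⟨hb.1, ?_⟩
        by_contra hc
        have h6 : subThreshold x (A.erase b) ≤ m - 2 := by omega
        have h7 : m ≤ subThreshold x (A.erase b) + 1 := by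
          rw [hm, subThreshold_le_iff]
          rcases (subThreshold_le_iff x (A.erase b) _).mp le_rfl with h8 | h8
          · left
            rw [Finset.card_erase_of_mem hb.1] at h8
            omega
          · right
            set j := subThreshold x (A.erase b)
            have h9 : (A.filter fun c => j + 1 < (x c : ℕ)) ⊆
                insert b ((A.erase b).filter fun c => j < (x c : ℕ)) := by
              intro c hc
              simp only [Finset.mem_insert, Finset.mem_filter, Finset.mem_erase] at hc ⊢
              by_cases hcb : c = b
              · exact Or.inl hcb
              · exact Or.inr ⟨⟨hcb, hc.1⟩, by omega⟩
            have := (Finset.card_le_card h9).trans (Finset.card_insert_le _ _)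
            omega
        have := (x b).pos
        omega
      have := Finset.card_le_card h5
      omega
  · push Not at h
    refine le_trans (Finset.card_le_card fun a ha => ?_) (card_filter_subThreshold_lt_le x A)
    simp only [Finset.mem_filter] at ha ⊢
    exact ⟨ha.1, h a ha.1 ha.2⟩

theorem subThreshold_comp_perm (x : Fin n → ℕ+) (σ : Equiv.Perm (Fin n)) (A : Finset (Fin n)) :
    subThreshold (x ∘ σ) A = subThreshold x (A.map σ.toEmbedding) := by
  have h : ∀ k, (A.filter fun a => k < ((x ∘ σ) a : ℕ)).card =
      ((A.map σ.toEmbedding).filter fun a => k < (x a : ℕ)).card := by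
    intro k
    rw [Finset.filter_map, Finset.card_map]
    rfl
  unfold subThreshold
  simp only [h, Finset.card_map]

/-- The threshold is controlled by the number of entries exceeding any fixed level. -/
theorem subThreshold_le_max (x : Fin n → ℕ+) (A : Finset (Fin n)) (m : ℕ) :
    subThreshold x A ≤ max m ((A.filter fun a => m < (x a : ℕ)).card + 1) := by
  rw [subThreshold_le_iff]
  right
  refine lt_of_le_of_lt (Finset.card_le_card ?_)
    (lt_of_lt_of_le (Nat.lt_succ_self _) (le_max_right m _))
  intro a ha
  simp only [Finset.mem_filter] at ha ⊢
  exact ⟨ha.1, lt_of_le_of_lt (le_max_left _ _) ha.2⟩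

/-- The positions before the `i`-th one. -/
def before (n i : ℕ) : Finset (Fin n) := Finset.univ.filter fun k => (k : ℕ) < i

theorem mem_before {i : ℕ} {k : Fin n} : k ∈ before n i ↔ (k : ℕ) < i := by simp [before]

theorem card_before {i : ℕ} (hi : i ≤ n) : (before n i).card = i := by
  unfold before
  rw [Fin.card_filter_val_lt]
  exact min_eq_right hi

theorem countP_take_word (x : Fin n → ℕ+) (q : ℕ → Prop) [DecidablePred q] (i : ℕ) :
    ((word x).take i).countP (fun a => q a) =
      ((before n i).filter fun a => q (x a : ℕ)).card := by
  induction i with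
  | zero => simp [before]
  | succ i ih =>
    by_cases hi : i < n
    · have hlen : i < (word x).length := by simpa [word] using hi
      have e : before n (i + 1) = insert ⟨i, hi⟩ (before n i) := by
        ext k
        simp only [mem_before, Finset.mem_insert, Fin.ext_iff]
        omega
      rw [List.take_succ_eq_append_getElem hlen, List.countP_append, ih, e,
        Finset.filter_insert]
      have hg : (word x)[i] = (x ⟨i, hi⟩ : ℕ) := by simp [word]
      rw [hg]
      split_ifs with hq
      · rw [Finset.card_insert_of_notMem (by simp [mem_before])]
        simp [hq]
      · simp [hq]
    · have hlen : (word x).length = n := by simp [word]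
      have e : before n (i + 1) = before n i := by
        ext k
        have := k.2
        simp only [mem_before]
        omega
      rw [e, ← ih, List.take_of_length_le (by omega), List.take_of_length_le (by omega)]

theorem threshold_take_word (x : Fin n → ℕ+) {i : ℕ} (hi : i ≤ n) :
    threshold ((word x).take i) = subThreshold x (before n i) := by
  have h : ∀ k, threshold ((word x).take i) ≤ k ↔ subThreshold x (before n i) ≤ k := by
    intro k
    rw [threshold_le_iff, subThreshold_le_iff, countP_take_word x (fun a => k < a) i,
      card_before hi]
    simp [word, hi]
  exact le_antisymm ((h _).mpr le_rfl) ((h _).mp le_rfl)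

end

section

/-! ### Pointwise bound on the length of the mixture code -/

variable {n : ℕ}

/-- The number of earlier occurrences of the symbol read at position `i`. -/
def earlier (x : Fin n → ℕ+) (i : Fin n) : ℕ :=
  ((before n i).filter fun a => x a = x i).card

theorem sum_card_filter_lt {β : Type*} [AddCommMonoid β] (φ : ℕ → β) (B : Finset (Fin n)) :
    ∑ i ∈ B, φ (B.filter (· < i)).card = ∑ t ∈ Finset.range B.card, φ t := by
  induction B using Finset.induction_on_max with
  | empty => simp
  | insert a s ha ih =>
    have has : a ∉ s := fun h => lt_irrefl _ (ha a h)
    rw [Finset.sum_insert has, Finset.card_insert_of_notMem has, Finset.sum_range_succ, ← ih,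
      add_comm]
    congr 1
    · refine Finset.sum_congr rfl fun i hi => ?_
      rw [Finset.filter_insert, if_neg (ha i hi).le.not_gt]
    · rw [Finset.filter_insert, if_neg (lt_irrefl _), Finset.filter_true_of_mem ha]

/-- The set of positions of the symbol `j`. -/
def fiber (x : Fin n → ℕ+) (j : ℕ+) : Finset (Fin n) := Finset.univ.filter fun i => x i = j

theorem sum_fiber_earlier {β : Type*} [AddCommMonoid β] (φ : ℕ → β) (x : Fin n → ℕ+) (j : ℕ+) :
    ∑ i ∈ fiber x j, φ (earlier x i) = ∑ t ∈ Finset.range (fiber x j).card, φ t := by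
  rw [← sum_card_filter_lt]
  refine Finset.sum_congr rfl fun i hi => ?_
  have hi' : x i = j := by simpa [fiber] using hi
  unfold earlier fiber before
  rw [hi', Finset.filter_filter, Finset.filter_filter]
  congr 2
  ext a
  simp only [Fin.val_fin_lt, and_comm]

theorem sum_earlier {β : Type*} [AddCommMonoid β] (φ : ℕ → β) (x : Fin n → ℕ+) :
    ∑ i, φ (earlier x i) =
      ∑ j ∈ Finset.univ.image x, ∑ t ∈ Finset.range (fiber x j).card, φ t := by
  rw [← Finset.sum_fiberwise_of_maps_to (t := Finset.univ.image x) (g := x) (by simp)]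
  exact Finset.sum_congr rfl fun j _ => sum_fiber_earlier φ x j

/-- The probability of a word, times the number of its rearrangements, is at most one. -/
theorem log_factorial_add_log_prob_le {p : ℕ+ → ℝ} (hp0 : ∀ j, 0 ≤ p j)
    (hp : ∀ s : Finset ℕ+, ∑ j ∈ s, p j ≤ 1) (x : Fin n → ℕ+) (hx : ∀ i, 0 < p (x i)) :
    Real.log n.factorial + Real.log (∏ i, p (x i)) ≤ ∑ i, Real.log (earlier x i + 1) := by
  have h1 : ∑ i, Real.log (earlier x i + 1) =
      Real.log (∏ j ∈ Finset.univ.image x, ((fiber x j).card.factorial : ℝ)) := by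
    rw [sum_earlier (fun t => Real.log (t + 1)) x, Real.log_prod (by
      intro j _; exact_mod_cast Nat.factorial_ne_zero _)]
    refine Finset.sum_congr rfl fun j _ => ?_
    rw [← Finset.prod_range_add_one_eq_factorial]
    push_cast
    rw [Real.log_prod (by intro t _; positivity)]
  have h2 : ∏ i, p (x i) = ∏ j ∈ Finset.univ.image x, p j ^ (fiber x j).card := by
    rw [← Finset.prod_fiberwise_of_maps_to (t := Finset.univ.image x) (g := x) (by simp)]
    refine Finset.prod_congr rfl fun j _ => ?_
    rw [Finset.prod_congr rfl (g := fun _ => p j)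
      (by intro i hi; rw [(Finset.mem_filter.mp hi).2])]
    simp [fiber]
  have hn : ∑ j ∈ Finset.univ.image x, (fiber x j).card = n := by
    have := sum_earlier (fun _ => 1) x
    simpa using this.symm
  set s := Finset.univ.image x with hs
  have h3 : (Nat.multinomial s fun j => (fiber x j).card : ℝ) * ∏ j ∈ s, p j ^ (fiber x j).card
      ≤ 1 := by
    have h4 := Finset.sum_pow_eq_sum_piAntidiag s p n
    have h5 : (∑ j ∈ s, p j) ^ n ≤ 1 := pow_le_one₀ (Finset.sum_nonneg fun j _ => hp0 j) (hp s)
    rw [h4] at h5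
    refine le_trans ?_ h5
    refine Finset.single_le_sum (f := fun k : ℕ+ → ℕ => (Nat.multinomial s k : ℝ) *
      ∏ j ∈ s, p j ^ k j) (fun k _ => ?_) ?_
    · exact mul_nonneg (Nat.cast_nonneg _) (Finset.prod_nonneg fun j _ => pow_nonneg (hp0 j) _)
    · rw [Finset.mem_piAntidiag]
      refine ⟨hn, fun j hj => ?_⟩
      obtain ⟨i, hi⟩ := Finset.card_pos.mp (Nat.pos_of_ne_zero hj)
      have : x i = j := by simpa [fiber] using hi
      rw [hs, ← this]
      simp
  have h6 := Nat.multinomial_spec s fun j => (fiber x j).card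
  rw [hn] at h6
  have h7 : (n.factorial : ℝ) = (∏ j ∈ s, ((fiber x j).card.factorial : ℝ)) *
      (Nat.multinomial s fun j => (fiber x j).card) := by
    rw [← h6]; push_cast; ring
  have hpos : 0 < ∏ i, p (x i) := Finset.prod_pos fun i _ => hx i
  have hfpos : 0 < ∏ j ∈ s, ((fiber x j).card.factorial : ℝ) :=
    Finset.prod_pos fun j _ => by exact_mod_cast Nat.factorial_pos _
  rw [h1, ← Real.log_mul (by exact_mod_cast Nat.factorial_ne_zero n) hpos.ne']
  refine Real.log_le_log (mul_pos (by exact_mod_cast Nat.factorial_pos n) hpos) ?_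
  rw [h7, h2, mul_assoc]
  exact mul_le_of_le_one_right hfpos.le h3

/-- The loss incurred by estimating a count `t + 1` by `t + 1/2`. -/
def ktLoss (t : ℕ) : ℝ := Real.log (t + 1) - Real.log (t + 1 / 2)

theorem ktLoss_nonneg (t : ℕ) : 0 ≤ ktLoss t := by
  unfold ktLoss
  exact sub_nonneg.mpr (Real.log_le_log (by positivity) (by linarith))

/-- The losses of the first `m` occurrences of a symbol add up to at most `log 2 + (log m) / 2`:
this is where the factor `1/2` of the mixture redundancy comes from. -/
theorem sum_ktLoss_le {m : ℕ} (hm : 1 ≤ m) :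
    ∑ t ∈ Finset.range m, ktLoss t ≤ Real.log 2 + Real.log m / 2 := by
  induction m, hm using Nat.le_induction with
  | base =>
    simp only [Finset.sum_range_one, ktLoss]
    rw [one_div, CharP.cast_eq_zero, zero_add, zero_add, Real.log_inv]
    simp
  | succ m hm ih =>
    rw [Finset.sum_range_succ]
    have hm' : (1 : ℝ) ≤ m := by exact_mod_cast hm
    have h : 2 * Real.log ((m : ℝ) + 1) + Real.log m ≤
        2 * Real.log ((m : ℝ) + 1 / 2) + Real.log (m + 1) := by
      have h1 : Real.log (m * (m + 1)) ≤ Real.log (((m : ℝ) + 1 / 2) ^ 2) :=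
        Real.log_le_log (by positivity) (by nlinarith)
      rw [Real.log_mul (by positivity) (by positivity), Real.log_pow] at h1
      push_cast at h1
      linarith
    unfold ktLoss at ih ⊢
    push_cast
    linarith

theorem count_take_word (x : Fin n → ℕ+) (i : ℕ) (j : ℕ+) :
    ((word x).take i).count (j : ℕ) = ((before n i).filter fun a => x a = j).card := by
  rw [List.count, show (fun a : ℕ => a == (j : ℕ)) = fun a => decide (a = (j : ℕ)) by
    ext a; simp [beq_eq_decide], countP_take_word x (fun a => a = (j : ℕ)) i]
  congr 2
  ext a
  rw [PNat.coe_inj]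

theorem count_zero_take_word (x : Fin n → ℕ+) (i : ℕ) : ((word x).take i).count 0 = 0 := by
  rw [List.count_eq_zero]
  intro h
  have h' := List.mem_of_mem_take h
  simp [word, List.mem_ofFn] at h'

theorem log_predictive_take (x : Fin n → ℕ+) (i : Fin n) :
    Real.log (predictive ((word x).take i) (censor ((word x).take i) (x i))) =
      (if subThreshold x (before n i) < (x i : ℕ) then -Real.log 2
        else Real.log (earlier x i + 1 / 2)) -
      Real.log (i + ((subThreshold x (before n i) : ℝ) + 1) / 2) := by
  have hlen : ((word x).take i).length = i := by simp [word, i.2.le]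
  unfold predictive censor
  rw [threshold_take_word x i.2.le, hlen]
  by_cases h : subThreshold x (before n i) < (x i : ℕ)
  · rw [if_neg (not_le.mpr h), if_pos h, count_zero_take_word,
      Real.log_div (by simp) (by positivity)]
    simp [Real.log_inv]
  · rw [if_pos (not_lt.mp h), if_neg h, count_take_word,
      Real.log_div (by positivity) (by positivity)]
    rfl

theorem log_mixtureProb (x : Fin n → ℕ+) :
    Real.log (mixtureProb x) =
      (∑ i : Fin n, if subThreshold x (before n i) < (x i : ℕ) then -Real.log 2
        else Real.log (earlier x i + 1 / 2)) - Real.log 2 -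
      ∑ i ∈ Finset.range (n + 1), Real.log (i + ((subThreshold x (before n i) : ℝ) + 1) / 2) := by
  have h0 : predictive (word x) 0 = (1 / 2) / (n + ((subThreshold x (before n n) : ℝ) + 1) / 2) := by
    have h1 := threshold_take_word x (le_refl n)
    have h2 := count_zero_take_word x n
    have hlen : (word x).length = n := by simp [word]
    rw [List.take_of_length_le hlen.le] at h1 h2
    rw [predictive, h1, h2, hlen]
    simp
  unfold mixtureProb
  rw [Real.log_mul (Finset.prod_ne_zero_iff.mpr fun i _ => (predictive_pos _ _).ne')
    (predictive_pos _ _).ne', Real.log_prod fun i _ => (predictive_pos _ _).ne',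
    Finset.sum_congr rfl fun i _ => log_predictive_take x i, Finset.sum_sub_distrib,
    Finset.sum_range_succ, ← Fin.sum_univ_eq_sum_range
      (fun i => Real.log (i + ((subThreshold x (before n i) : ℝ) + 1) / 2)), h0,
    Real.log_div (by norm_num) (by positivity)]
  simp only [one_div, Real.log_inv]
  ring

theorem sum_log_denominator_le (x : Fin n → ℕ+) :
    ∑ i ∈ Finset.range (n + 1), Real.log (i + ((subThreshold x (before n i) : ℝ) + 1) / 2) ≤
      Real.log n.factorial - Real.log 2 +
        ∑ i ∈ Finset.range n, ((subThreshold x (before n (i + 1)) : ℝ) + 1) / (2 * (i + 1)) := by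
  rw [Finset.sum_range_succ']
  have h0 : subThreshold x (before n 0) = 0 := by
    have := subThreshold_le_card x (before n 0)
    rw [card_before (Nat.zero_le n)] at this
    omega
  rw [h0]
  have h1 : Real.log (((0 : ℕ) : ℝ) + (((0 : ℕ) : ℝ) + 1) / 2) = -Real.log 2 := by
    simp [Real.log_inv]
  have h2 : Real.log n.factorial = ∑ i ∈ Finset.range n, Real.log (i + 1) := by
    rw [← Finset.prod_range_add_one_eq_factorial]
    push_cast
    rw [Real.log_prod (by intro t _; positivity)]
  rw [h1, h2]
  have h3 : ∀ i ∈ Finset.range n,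
      Real.log (((i + 1 : ℕ) : ℝ) + ((subThreshold x (before n (i + 1)) : ℝ) + 1) / 2) ≤
      Real.log (i + 1) + ((subThreshold x (before n (i + 1)) : ℝ) + 1) / (2 * (i + 1)) := by
    intro i _
    set m : ℝ := (subThreshold x (before n (i + 1)) : ℝ)
    have hm : 0 ≤ m := Nat.cast_nonneg _
    have e : ((i + 1 : ℕ) : ℝ) + (m + 1) / 2 = (i + 1) * (1 + (m + 1) / (2 * (i + 1))) := by
      push_cast; field_simp
    rw [e, Real.log_mul (by positivity) (by positivity)]
    have := Real.log_le_sub_one_of_pos (x := 1 + (m + 1) / (2 * (i + 1))) (by positivity)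
    linarith
  have := Finset.sum_le_sum h3
  rw [Finset.sum_add_distrib] at this
  linarith

theorem earlier_le_subThreshold (x : Fin n → ℕ+) (i : Fin n)
    (h : subThreshold x (before n i) < (x i : ℕ)) : earlier x i ≤ subThreshold x (before n i) := by
  refine le_trans (Finset.card_le_card ?_) (card_filter_subThreshold_lt_le x (before n i))
  intro a ha
  simp only [Finset.mem_filter] at ha ⊢
  exact ⟨ha.1, by rw [ha.2]; exact h⟩

theorem before_mono {i j : ℕ} (h : i ≤ j) : before n i ⊆ before n j := fun a ha => by
  rw [mem_before] at ha ⊢; omega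

/-- The total loss on the symbols which are not redacted. -/
theorem sum_ktLoss_earlier_le (x : Fin n → ℕ+) :
    ∑ i : Fin n, (if subThreshold x (before n i) < (x i : ℕ) then 0 else ktLoss (earlier x i)) ≤
      subThreshold x (before n n) * (Real.log 2 + Real.log n / 2) := by
  set M := subThreshold x (before n n) with hM
  have h1 : ∀ i : Fin n, (if subThreshold x (before n i) < (x i : ℕ) then 0
      else ktLoss (earlier x i)) ≤ if (x i : ℕ) ≤ M then ktLoss (earlier x i) else 0 := by
    intro i
    have := subThreshold_mono x (before_mono (n := n) i.2.le)
    have := ktLoss_nonneg (earlier x i)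
    split_ifs <;> first | omega | linarith
  refine (Finset.sum_le_sum fun i _ => h1 i).trans ?_
  rw [← Finset.sum_filter, ← Finset.sum_fiberwise_of_maps_to (t := (Finset.univ.image x).filter
    fun j : ℕ+ => (j : ℕ) ≤ M) (g := x) (by simp)]
  have h2 : ∀ j ∈ (Finset.univ.image x).filter (fun j : ℕ+ => (j : ℕ) ≤ M),
      ∑ i ∈ (Finset.univ.filter fun i => (x i : ℕ) ≤ M) with x i = j, ktLoss (earlier x i) ≤
        Real.log 2 + Real.log n / 2 := by
    intro j hj
    obtain ⟨hj1, hj2⟩ := Finset.mem_filter.mp hj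
    obtain ⟨i, -, hi⟩ := Finset.mem_image.mp hj1
    have e : (Finset.univ.filter fun i => (x i : ℕ) ≤ M).filter (fun i => x i = j) = fiber x j := by
      ext a
      simp only [fiber, Finset.mem_filter, Finset.mem_univ, true_and]
      exact ⟨fun h => h.2, fun h => ⟨by rw [h]; exact hj2, h⟩⟩
    have hpos : 1 ≤ (fiber x j).card := Finset.card_pos.mpr ⟨i, by simp [fiber, hi]⟩
    rw [e, sum_fiber_earlier]
    refine (sum_ktLoss_le hpos).trans ?_
    have : (fiber x j).card ≤ n := by simpa using Finset.card_le_univ (fiber x j)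
    have : Real.log (fiber x j).card ≤ Real.log n :=
      Real.log_le_log (by exact_mod_cast hpos) (by exact_mod_cast this)
    linarith
  refine (Finset.sum_le_sum h2).trans ?_
  rw [Finset.sum_const, nsmul_eq_mul]
  have h3 : ((Finset.univ.image x).filter fun j : ℕ+ => (j : ℕ) ≤ M).card ≤ M := by
    have h4 : ((Finset.univ.image x).filter fun j : ℕ+ => (j : ℕ) ≤ M).card ≤
        (Finset.Icc 1 M).card := by
      refine Finset.card_le_card_of_injOn (fun j : ℕ+ => (j : ℕ)) (fun j hj => ?_)
        (fun a _ b _ h => PNat.coe_injective h)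
      have := j.pos
      simp only [Finset.coe_filter, Set.mem_ofPred_eq] at hj
      simp only [Finset.coe_Icc, Set.mem_Icc]
      omega
    simpa using h4
  have h5 : 0 ≤ Real.log n := Real.log_natCast_nonneg n
  have h6 : 0 ≤ Real.log 2 := Real.log_nonneg one_le_two
  exact mul_le_mul_of_nonneg_right (by exact_mod_cast h3) (by positivity)

/-- Pointwise redundancy of the mixture code, in nats. -/
theorem log_prob_sub_log_mixtureProb_le {p : ℕ+ → ℝ} (hp0 : ∀ j, 0 ≤ p j)
    (hp : ∀ s : Finset ℕ+, ∑ j ∈ s, p j ≤ 1) (x : Fin n → ℕ+) (hx : ∀ i, 0 < p (x i)) :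
    Real.log (∏ i, p (x i)) - Real.log (mixtureProb x) ≤
      ∑ i ∈ Finset.range n, ((subThreshold x (before n (i + 1)) : ℝ) + 1) / (2 * (i + 1)) +
      subThreshold x (before n n) * (Real.log 2 + Real.log n / 2) +
      ∑ i : Fin n, if subThreshold x (before n i) < (x i : ℕ) then
        Real.log 2 + Real.log ((subThreshold x (before n i) : ℝ) + 1) else 0 := by
  have h1 := log_factorial_add_log_prob_le hp0 hp x hx
  have h2 := sum_log_denominator_le x
  have h3 := sum_ktLoss_earlier_le x
  rw [log_mixtureProb]
  have h4 : ∀ i : Fin n, Real.log (earlier x i + 1) ≤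
      (if subThreshold x (before n i) < (x i : ℕ) then -Real.log 2
        else Real.log (earlier x i + 1 / 2)) +
      ((if subThreshold x (before n i) < (x i : ℕ) then 0 else ktLoss (earlier x i)) +
      (if subThreshold x (before n i) < (x i : ℕ) then
        Real.log 2 + Real.log ((subThreshold x (before n i) : ℝ) + 1) else 0)) := by
    intro i
    split_ifs with h
    · have h5 : (earlier x i : ℝ) ≤ subThreshold x (before n i) := by
        exact_mod_cast earlier_le_subThreshold x i h
      have := Real.log_le_log (x := (earlier x i : ℝ) + 1) (by positivity)
        (add_le_add_left h5 1)
      linarith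
    · unfold ktLoss; linarith
  have h5 := Finset.sum_le_sum fun i (_ : i ∈ Finset.univ) => h4 i
  rw [Finset.sum_add_distrib, Finset.sum_add_distrib] at h5
  linarith

end

section

/-! ### Expectations over memoryless words -/

variable {n : ℕ}

instance instMeasurableSpacePNat : MeasurableSpace ℕ+ := ⊤

instance instDiscreteMeasurableSpacePNat : DiscreteMeasurableSpace ℕ+ := ⟨fun _ => trivial⟩

/-- The law of `n` independent symbols with distribution `p`, as a measure. -/
def wordMeasure (p : PMF ℕ+) (n : ℕ) : Measure (Fin n → ℕ+) :=
  Measure.pi fun _ => p.toMeasure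

instance instIsProbabilityMeasureWordMeasure (p : PMF ℕ+) (n : ℕ) :
    IsProbabilityMeasure (wordMeasure p n) := by
  unfold wordMeasure; infer_instance

theorem lintegral_wordMeasure (p : PMF ℕ+) (h : (Fin n → ℕ+) → ℝ≥0∞) :
    ∫⁻ x, h x ∂(wordMeasure p n) = ∑' x, (∏ i, p (x i)) * h x := by
  rw [lintegral_countable']
  refine tsum_congr fun x => ?_
  rw [wordMeasure, Measure.pi_singleton, mul_comm]
  congr 1
  exact Finset.prod_congr rfl fun i _ =>
    PMF.toMeasure_apply_singleton _ _ (measurableSet_singleton _)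

theorem lintegral_wordMeasure_comp_perm (p : PMF ℕ+) (σ : Equiv.Perm (Fin n))
    (h : (Fin n → ℕ+) → ℝ≥0∞) :
    ∫⁻ x, h (x ∘ σ) ∂(wordMeasure p n) = ∫⁻ x, h x ∂(wordMeasure p n) := by
  rw [lintegral_wordMeasure, lintegral_wordMeasure,
    ← (Equiv.arrowCongr σ (Equiv.refl ℕ+)).symm.tsum_eq (fun x => (∏ i, p (x i)) * h x)]
  refine tsum_congr fun x => ?_
  have e : (Equiv.arrowCongr σ (Equiv.refl ℕ+)).symm x = x ∘ σ := by
    ext i; simp [Equiv.arrowCongr]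
  rw [e]
  congr 1
  exact (Equiv.prod_comp σ fun i => p (x i)).symm

theorem lintegral_wordMeasure_eval (p : PMF ℕ+) (i : Fin n) (h : ℕ+ → ℝ≥0∞) :
    ∫⁻ x, h (x i) ∂(wordMeasure p n) = ∫⁻ j, h j ∂p.toMeasure :=
  (measurePreserving_eval (fun _ : Fin n => p.toMeasure) i).lintegral_comp (measurable_of_countable h)

/-- By exchangeability, given the multiset of the first `i + 1` symbols, the last of them is
redacted with probability at most `M / (i + 1)`, where `M` is the threshold. -/
theorem lintegral_redacted_le (p : PMF ℕ+) (i : Fin n) (φ : ℕ → ℝ≥0∞) :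
    (i + 1 : ℝ≥0∞) * ∫⁻ x, (if subThreshold x (before n i) < (x i : ℕ) then
        φ (subThreshold x (before n (i + 1))) else 0) ∂(wordMeasure p n) ≤
      ∫⁻ x, subThreshold x (before n (i + 1)) * φ (subThreshold x (before n (i + 1)))
        ∂(wordMeasure p n) := by
  set A := before n (i + 1) with hA
  have hiA : i ∈ A := by rw [hA, mem_before]; omega
  have hcard : A.card = i + 1 := card_before i.2
  have herase : before n i = A.erase i := by
    ext a
    rw [hA, Finset.mem_erase, mem_before, mem_before, Ne, Fin.ext_iff]
    omega
  have hex : ∀ a ∈ A, ∫⁻ x, (if subThreshold x (A.erase a) < (x a : ℕ) then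
        φ (subThreshold x A) else 0) ∂(wordMeasure p n) =
      ∫⁻ x, (if subThreshold x (A.erase i) < (x i : ℕ) then
        φ (subThreshold x A) else 0) ∂(wordMeasure p n) := by
    intro a ha
    rw [← lintegral_wordMeasure_comp_perm p (Equiv.swap i a) fun x =>
      (if subThreshold x (A.erase i) < (x i : ℕ) then φ (subThreshold x A) else 0)]
    have e1 : A.map (Equiv.swap i a).toEmbedding = A := by
      refine Finset.eq_of_subset_of_card_le (fun b hb => ?_) (by rw [Finset.card_map])
      obtain ⟨c, hc, rfl⟩ := Finset.mem_map.mp hb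
      simp only [Equiv.coe_toEmbedding]
      by_cases h1 : c = i
      · rw [h1, Equiv.swap_apply_left]; exact ha
      · by_cases h2 : c = a
        · rw [h2, Equiv.swap_apply_right]; exact hiA
        · rw [Equiv.swap_apply_of_ne_of_ne h1 h2]; exact hc
    have e2 : (A.erase i).map (Equiv.swap i a).toEmbedding = A.erase a := by
      rw [Finset.map_erase, e1]; simp
    simp only [subThreshold_comp_perm, e1, e2, Function.comp_apply, Equiv.swap_apply_left]
  have hsum : (i + 1 : ℝ≥0∞) * ∫⁻ x, (if subThreshold x (before n i) < (x i : ℕ) then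
        φ (subThreshold x A) else 0) ∂(wordMeasure p n) =
      ∑ a ∈ A, ∫⁻ x, (if subThreshold x (A.erase a) < (x a : ℕ) then
        φ (subThreshold x A) else 0) ∂(wordMeasure p n) := by
    rw [Finset.sum_congr rfl hex, Finset.sum_const, hcard, nsmul_eq_mul, herase]
    push_cast
    rfl
  rw [hsum, ← lintegral_finsetSum _ fun a _ => measurable_of_countable _]
  refine lintegral_mono fun x => ?_
  rw [← Finset.sum_filter, Finset.sum_const, nsmul_eq_mul]
  gcongr
  exact card_filter_redacted_le x A

/-- `P(X > k)` for a symbol `X` of law `p`. -/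
def tailProb (p : PMF ℕ+) (k : ℕ) : ℝ := p.toMeasure.real {j | k < (j : ℕ)}

open ProbabilityTheory in
/-- The threshold after `i` symbols exceeds `k + 1` by a quantity of second moment at most `k`, as
soon as the expected number of symbols larger than `k` is at most `k`. -/
theorem exists_subThreshold_le (p : PMF ℕ+) {i : ℕ} (hi : i ≤ n) {k : ℕ}
    (hk : i * tailProb p k ≤ k) :
    ∃ D : (Fin n → ℕ+) → ℝ, (∀ x, 0 ≤ D x) ∧
      (∀ x, (subThreshold x (before n i) : ℝ) ≤ k + 1 + D x) ∧
      ∫⁻ x, ENNReal.ofReal (D x ^ 2) ∂(wordMeasure p n) ≤ ENNReal.ofReal k := by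
  classical
  let X : Fin n → ℕ+ → ℝ := fun a j => if (a : ℕ) < i ∧ k < (j : ℕ) then 1 else 0
  have hX01 : ∀ a j, 0 ≤ X a j ∧ X a j ≤ 1 ∧ X a j ^ 2 = X a j := by
    intro a j
    simp only [X]
    split_ifs <;> norm_num
  have hmem : ∀ a, MemLp (X a) 2 p.toMeasure := fun a =>
    MemLp.of_bound (Measurable.of_discrete).aestronglyMeasurable 1
      (Eventually.of_forall fun j => by
        rw [Real.norm_of_nonneg (hX01 a j).1]; exact (hX01 a j).2.1)
  have hint : ∀ a, Integrable (X a) p.toMeasure := fun a => (hmem a).integrable one_le_two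
  have hEX : ∀ a : Fin n, ∫ j, X a j ∂p.toMeasure = if (a : ℕ) < i then tailProb p k else 0 := by
    intro a
    by_cases ha : (a : ℕ) < i
    · rw [if_pos ha]
      have : X a = Set.indicator {j : ℕ+ | k < (j : ℕ)} 1 := by
        ext j
        simp [X, ha, Set.indicator]
      rw [this, integral_indicator_one MeasurableSet.of_discrete]
      rfl
    · simp [X, ha]
  have hsumE : ∑ a, ∫ j, X a j ∂p.toMeasure = i * tailProb p k := by
    rw [Finset.sum_congr rfl fun a _ => hEX a, ← Finset.sum_filter, Finset.sum_const,
      nsmul_eq_mul]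
    congr 2
    exact card_before hi
  let N : (Fin n → ℕ+) → ℝ := ∑ a, fun x => X a (x a)
  have hNx : ∀ x, N x = ((before n i).filter fun a => k < (x a : ℕ)).card := by
    intro x
    simp only [N, X, Finset.sum_apply]
    rw [← Finset.sum_filter]
    simp only [Finset.sum_const, nsmul_eq_mul, mul_one, before, Finset.filter_filter]
  have hNmem : MemLp N 2 (wordMeasure p n) :=
    memLp_finsetSum' _ fun a _ =>
      (hmem a).comp_measurePreserving (measurePreserving_eval (fun _ : Fin n => p.toMeasure) a)
  have hNint : ∫ x, N x ∂(wordMeasure p n) = i * tailProb p k := by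
    simp only [N, Finset.sum_apply]
    rw [integral_finsetSum]
    · rw [← hsumE]
      exact Finset.sum_congr rfl fun a _ => integral_comp_eval (hmem a).aestronglyMeasurable
    · exact fun a _ => ((hmem a).comp_measurePreserving
        (measurePreserving_eval (fun _ : Fin n => p.toMeasure) a)).integrable one_le_two
  have hvar : Var[N; wordMeasure p n] ≤ k := by
    refine le_trans ?_ hk
    rw [← hsumE]
    have := variance_sum_pi (μ := fun _ : Fin n => p.toMeasure) hmem
    refine this.le.trans (Finset.sum_le_sum fun a _ => ?_)
    refine (variance_le_expectation_sq (hmem a).aestronglyMeasurable).trans ?_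
    refine (integral_congr_ae (Eventually.of_forall fun j => ?_)).le
    exact (hX01 a j).2.2
  refine ⟨fun x => |N x - i * tailProb p k|, fun x => abs_nonneg _, fun x => ?_, ?_⟩
  · have h1 := subThreshold_le_max x (before n i) k
    have h2 : (subThreshold x (before n i) : ℝ) ≤ max (k : ℝ) (N x + 1) := by
      rw [hNx]
      exact_mod_cast h1
    refine h2.trans (max_le ?_ ?_)
    · have := abs_nonneg (N x - i * tailProb p k)
      linarith
    · have := le_abs_self (N x - i * tailProb p k)
      linarith
  · have h1 := ofReal_variance hNmem
    rw [evariance_eq_lintegral_ofReal, hNint] at h1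
    simp only [sq_abs]
    rw [← h1]
    exact ENNReal.ofReal_le_ofReal hvar

theorem tailProb_le_tailSum {f : ℕ+ → ℝ} (hf : IsEnvelope f) {p : PMF ℕ+}
    (hp : ∀ j, p j ≤ ENNReal.ofReal (f j)) (k : ℕ) :
    p.toMeasure {j | k < (j : ℕ)} ≤ ENNReal.ofReal (tailSum f k) := by
  rw [PMF.toMeasure_apply _ MeasurableSet.of_discrete, tailSum, ENNReal.ofReal_tsum_of_nonneg]
  · refine ENNReal.tsum_le_tsum fun j => ?_
    by_cases h : k < (j : ℕ)
    · simpa [Set.indicator, h] using hp j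
    · simp [h]
  · intro j
    have := (hf.pos j).le
    split_ifs <;> simp [this]
  · refine Summable.of_nonneg_of_le (fun j => ?_) (fun j => ?_) hf.summable
    · have := (hf.pos j).le
      split_ifs <;> simp [this]
    · have := (hf.pos j).le
      split_ifs <;> simp [this]

end

section

/-! ### Expected redundancy of the ETAC code -/

variable {n : ℕ}

theorem binLength_le_logb (y : ℕ) : (binLength y : ℝ) ≤ Real.logb 2 y + 1 := by
  have h : ((Nat.log 2 y : ℕ) : ℝ) ≤ Real.logb 2 y := by
    have := Real.natLog_le_logb y 2
    exact_mod_cast this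
  unfold binLength
  push_cast
  linarith

theorem exists_eliasLength_le {ε : ℝ} (hε : 0 < ε) :
    ∃ C : ℝ, 0 ≤ C ∧ ∀ x M : ℕ, 1 ≤ x →
      (eliasLength (x - M + 1) : ℝ) ≤ (1 + ε) * Real.logb 2 x + C := by
  have hl2 : 0 < Real.log 2 := Real.log_pos one_lt_two
  set δ := ε * Real.log 2 / 2 with hδ
  have hδpos : 0 < δ := by positivity
  refine ⟨|2 - 2 * (1 + Real.log δ) / Real.log 2| + 2 * (1 + ε), by positivity, fun x M hx => ?_⟩
  set b := binLength (x - M + 1) with hb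
  have hb1 : 1 ≤ b := by rw [hb]; unfold binLength; omega
  have hb1' : (1 : ℝ) ≤ b := by exact_mod_cast hb1
  have h1 : (b : ℝ) ≤ Real.logb 2 x + 2 := by
    have h2 := binLength_le_logb (x - M + 1)
    have h3 : Real.logb 2 ((x - M + 1 : ℕ) : ℝ) ≤ Real.logb 2 (2 * x) := by
      refine Real.logb_le_logb_of_le one_lt_two (by positivity) ?_
      have : x - M + 1 ≤ 2 * x := by omega
      exact_mod_cast this
    rw [Real.logb_mul (by norm_num) (by positivity),
      Real.logb_self_eq_one one_lt_two] at h3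
    linarith
  have h4 : (eliasLength (x - M + 1) : ℝ) = 2 * binLength b + b := by
    unfold eliasLength; push_cast; rw [← hb]
  have h5 := binLength_le_logb b
  -- the concave function `log` is below its tangent lines
  have h6 : Real.logb 2 b ≤ (δ * b - 1 - Real.log δ) / Real.log 2 := by
    have h7 := Real.log_le_sub_one_of_pos (x := δ * b) (by positivity)
    rw [Real.log_mul hδpos.ne' (by positivity)] at h7
    unfold Real.logb
    gcongr
    linarith
  have h8 : 2 * ((δ * b - 1 - Real.log δ) / Real.log 2) =
      ε * b - 2 * (1 + Real.log δ) / Real.log 2 := by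
    rw [hδ]; field_simp; ring
  have h9 := le_abs_self (2 - 2 * (1 + Real.log δ) / Real.log 2)
  rw [h4]
  have h10 : (1 + ε) * (b : ℝ) ≤ (1 + ε) * (Real.logb 2 x + 2) := by gcongr
  linarith

/-- The number of dyadic multiples of `k` below `j`. -/
def dyadicCount (k j : ℕ) : ℕ := ((Finset.range j).filter fun r => 2 ^ r * k < j).card

theorem log_le_log_add_dyadicCount {k j : ℕ} (hk : 1 ≤ k) (hj : 1 ≤ j) :
    Real.log j ≤ Real.log k + Real.log 2 * dyadicCount k j := by
  have hk' : (0 : ℝ) < k := by exact_mod_cast hk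
  have hj' : (0 : ℝ) < j := by exact_mod_cast hj
  have h1 : j ≤ 2 ^ dyadicCount k j * k := by
    by_contra h
    push Not at h
    set R := dyadicCount k j with hR
    have h2 : Finset.range (R + 1) ⊆ (Finset.range j).filter fun r => 2 ^ r * k < j := by
      intro r hr
      have hr' : r ≤ R := Nat.lt_succ_iff.mp (Finset.mem_range.mp hr)
      have h3 : 2 ^ r * k < j := lt_of_le_of_lt
        (Nat.mul_le_mul_right _ (Nat.pow_le_pow_right (by norm_num) hr')) h
      have h4 : r < 2 ^ r := Nat.lt_two_pow_self
      have h5 : 2 ^ r * 1 ≤ 2 ^ r * k := Nat.mul_le_mul_left _ hk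
      simp only [Finset.mem_filter, Finset.mem_range]
      exact ⟨by omega, h3⟩
    have := Finset.card_le_card h2
    rw [Finset.card_range] at this
    have h6 : R = ((Finset.range j).filter fun r => 2 ^ r * k < j).card := hR
    omega
  have h2 : (j : ℝ) ≤ 2 ^ dyadicCount k j * k := by exact_mod_cast h1
  have := Real.log_le_log hj' h2
  rw [Real.log_mul (by positivity) hk'.ne', Real.log_pow] at this
  linarith

theorem lintegral_dyadicCount_le {f : ℕ+ → ℝ} (hf : IsEnvelope f) {p : PMF ℕ+}
    (hp : ∀ j, p j ≤ ENNReal.ofReal (f j)) (k : ℕ) :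
    ∫⁻ j, (dyadicCount k (j : ℕ) : ℝ≥0∞) ∂p.toMeasure ≤
      ∑' r : ℕ, ENNReal.ofReal (tailSum f (2 ^ r * k)) := by
  calc ∫⁻ j, (dyadicCount k (j : ℕ) : ℝ≥0∞) ∂p.toMeasure
      ≤ ∫⁻ j, ∑' r : ℕ, Set.indicator {j : ℕ+ | 2 ^ r * k < (j : ℕ)} 1 j ∂p.toMeasure := by
        refine lintegral_mono fun j => ?_
        unfold dyadicCount
        refine le_trans (le_of_eq ?_) (ENNReal.sum_le_tsum (Finset.range (j : ℕ)))
        rw [Finset.card_filter]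
        push_cast
        exact Finset.sum_congr rfl fun r _ => by simp [Set.indicator]
    _ = ∑' r : ℕ, p.toMeasure {j : ℕ+ | 2 ^ r * k < (j : ℕ)} := by
        rw [lintegral_tsum fun r => (measurable_of_countable _).aemeasurable]
        exact tsum_congr fun r => lintegral_indicator_one MeasurableSet.of_discrete
    _ ≤ _ := ENNReal.tsum_le_tsum fun r => tailProb_le_tailSum hf hp _

/-- Moments of the threshold after `i` symbols, in terms of a level `k` such that the envelope
allows for at most `k` symbols larger than `k` on average. -/
theorem lintegral_subThreshold_le (p : PMF ℕ+) {i : ℕ} (hi : i ≤ n) {k : ℕ}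
    (hk : i * tailProb p k ≤ k) {η : ℝ} (hη : 0 < η) :
    ∫⁻ x, (subThreshold x (before n i) : ℝ≥0∞) ∂(wordMeasure p n) ≤
      ENNReal.ofReal ((1 + η) * k + (1 + 1 / (4 * η))) := by
  obtain ⟨D, hD0, hD, hD2⟩ := exists_subThreshold_le p hi hk
  have h1 : ∀ x, (subThreshold x (before n i) : ℝ≥0∞) ≤
      ENNReal.ofReal (k + (1 + 1 / (4 * η))) + ENNReal.ofReal η * ENNReal.ofReal (D x ^ 2) := by
    intro x
    rw [← ENNReal.ofReal_mul hη.le, ← ENNReal.ofReal_add (by positivity) (by positivity),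
      ← ENNReal.ofReal_natCast]
    apply ENNReal.ofReal_le_ofReal
    refine (hD x).trans ?_
    have h2 : D x ≤ η * D x ^ 2 + 1 / (4 * η) := by
      have h3 : 0 ≤ (2 * η * D x - 1) ^ 2 / (4 * η) := by positivity
      have h4 : (2 * η * D x - 1) ^ 2 / (4 * η) = η * D x ^ 2 - D x + 1 / (4 * η) := by
        field_simp; ring
      linarith
    linarith
  refine (lintegral_mono h1).trans ?_
  rw [lintegral_add_left measurable_const, lintegral_const_mul _ (measurable_of_countable _),
    lintegral_const, measure_univ, mul_one]
  refine (add_le_add_right (mul_le_mul_right hD2 _) _).trans ?_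
  rw [← ENNReal.ofReal_mul hη.le, ← ENNReal.ofReal_add (by positivity) (by positivity)]
  exact ENNReal.ofReal_le_ofReal (by linarith)

theorem lintegral_subThreshold_mul_log_le (p : PMF ℕ+) {i : ℕ} (hi : i ≤ n) {k : ℕ}
    (hk : i * tailProb p k ≤ k) {η : ℝ} (hη : 0 < η) {κ : ℕ} (hκ : k ≤ κ) {a : ℝ} (ha : 0 ≤ a) :
    ∫⁻ x, (subThreshold x (before n i) : ℝ≥0∞) *
        ENNReal.ofReal (Real.log ((subThreshold x (before n i) : ℝ) + 1) + a)
        ∂(wordMeasure p n) ≤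
      ENNReal.ofReal (((1 + η) * k + (1 + 1 / (4 * η))) * (Real.log (κ + 2) + a) + 1 + 2 * k) := by
  obtain ⟨D, hD0, hD, hD2⟩ := exists_subThreshold_le p hi hk
  set b : ℝ := Real.log (κ + 2) + a with hb
  have hlog : 0 ≤ Real.log ((κ : ℝ) + 2) := Real.log_nonneg (by
    have : (0 : ℝ) ≤ κ := Nat.cast_nonneg _
    linarith)
  have hb0 : 0 ≤ b := by positivity
  have h1 : ∀ x, (subThreshold x (before n i) : ℝ≥0∞) *
        ENNReal.ofReal (Real.log ((subThreshold x (before n i) : ℝ) + 1) + a) ≤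
      ENNReal.ofReal ((k + (1 + 1 / (4 * η))) * b + 1) +
        ENNReal.ofReal (η * b + 2) * ENNReal.ofReal (D x ^ 2) := by
    intro x
    set M : ℝ := (subThreshold x (before n i) : ℝ) with hM
    have hM0 : 0 ≤ M := Nat.cast_nonneg _
    have hlogM : 0 ≤ Real.log (M + 1) := Real.log_nonneg (by linarith)
    rw [← ENNReal.ofReal_mul (by positivity), ← ENNReal.ofReal_add (by positivity) (by positivity),
      ← ENNReal.ofReal_natCast, ← hM, ← ENNReal.ofReal_mul hM0]
    apply ENNReal.ofReal_le_ofReal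
    have hDx := hD x
    have hD0x := hD0 x
    have hκ' : (k : ℝ) ≤ κ := by exact_mod_cast hκ
    have hκ0 : (0 : ℝ) ≤ k := Nat.cast_nonneg _
    have h2 : D x ≤ η * D x ^ 2 + 1 / (4 * η) := by
      have h3 : 0 ≤ (2 * η * D x - 1) ^ 2 / (4 * η) := by positivity
      have h4 : (2 * η * D x - 1) ^ 2 / (4 * η) = η * D x ^ 2 - D x + 1 / (4 * η) := by
        field_simp; ring
      linarith
    have h3 : Real.log (M + 1) ≤ Real.log (κ + 2) + D x / (κ + 2) := by
      have h4 : M + 1 ≤ (κ + 2) * (1 + D x / (κ + 2)) := by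
        have : ((κ : ℝ) + 2) * (1 + D x / (κ + 2)) = κ + 2 + D x := by field_simp
        rw [this]; linarith
      have h5 := Real.log_le_log (by positivity) h4
      rw [Real.log_mul (by positivity) (by positivity)] at h5
      have h6 := Real.log_le_sub_one_of_pos (x := 1 + D x / (κ + 2)) (by positivity)
      linarith
    have h4 : M * (D x / (κ + 2)) ≤ 1 + 2 * D x ^ 2 := by
      have h5 : M * (D x / (κ + 2)) ≤ (k + 1 + D x) * (D x / (κ + 2)) := by gcongr
      have h6 : (k + 1 + D x) * (D x / (κ + 2)) ≤ D x + D x ^ 2 := by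
        rw [← mul_div_assoc, div_le_iff₀ (by positivity)]
        nlinarith [sq_nonneg (D x)]
      nlinarith [sq_nonneg (D x - 1)]
    have h7 : M * b ≤ (k + 1 + (η * D x ^ 2 + 1 / (4 * η))) * b :=
      mul_le_mul_of_nonneg_right (by linarith) hb0
    calc M * (Real.log (M + 1) + a) ≤ M * (b + D x / (κ + 2)) :=
          mul_le_mul_of_nonneg_left (by linarith) hM0
      _ = M * b + M * (D x / (κ + 2)) := by ring
      _ ≤ (k + 1 + (η * D x ^ 2 + 1 / (4 * η))) * b + (1 + 2 * D x ^ 2) := add_le_add h7 h4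
      _ = _ := by ring
  refine (lintegral_mono h1).trans ?_
  rw [lintegral_add_left measurable_const, lintegral_const_mul _ (measurable_of_countable _),
    lintegral_const, measure_univ, mul_one]
  refine (add_le_add_right (mul_le_mul_right hD2 _) _).trans ?_
  rw [← ENNReal.ofReal_mul (by positivity), ← ENNReal.ofReal_add (by positivity) (by positivity)]
  exact ENNReal.ofReal_le_ofReal (by linarith)

end

theorem codingDist_toReal_ge (n : ℕ) (x : Fin n → ℕ+) :
    (2 : ℝ) ^ (-codelength x) ≤ (codingDist n x).toReal := by
  have h1 : codeWeight x ≤ codingDist n x := by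
    unfold codingDist
    rw [PMF.normalize_apply]
    exact le_mul_of_one_le_right' (ENNReal.one_le_inv.mpr (tsum_codeWeight_le n))
  have h2 := ENNReal.toReal_mono (PMF.apply_ne_top _ _) h1
  rwa [codeWeight, ENNReal.toReal_ofReal (by positivity)] at h2

theorem codelength_mul_log_two {n : ℕ} (x : Fin n → ℕ+) :
    Real.log 2 * codelength x = -Real.log (mixtureProb x) +
      Real.log 2 * ((∑ i : Fin n, if subThreshold x (before n i) < (x i : ℕ) then
        (eliasLength ((x i : ℕ) - subThreshold x (before n i) + 1) : ℝ) else 0) + 3) := by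
  have hl2 : 0 < Real.log 2 := Real.log_pos one_lt_two
  have h1 : (redactedLength x : ℝ) = (∑ i : Fin n, if subThreshold x (before n i) < (x i : ℕ) then
        (eliasLength ((x i : ℕ) - subThreshold x (before n i) + 1) : ℝ) else 0) + 3 := by
    have h3 : eliasLength 1 = 3 := by simp [eliasLength, binLength]
    unfold redactedLength
    rw [h3]
    push_cast
    congr 1
    refine Finset.sum_congr rfl fun i _ => ?_
    rw [threshold_take_word x i.2.le]
    by_cases h : subThreshold x (before n i) < (x i : ℕ)
    · rw [if_pos h, if_neg (not_le.mpr h)]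
    · rw [if_neg h, if_pos (not_lt.mp h)]
  rw [codelength, mixtureLength, h1, Real.logb]
  field_simp

/-- Pointwise redundancy of the ETAC code, in nats; here `c` and `C` are such that the Elias code
of `y` has length at most `c log₂ y + C`. -/
theorem log_div_codingDist_le {n : ℕ} {p : ℕ+ → ℝ} (hp0 : ∀ j, 0 ≤ p j)
    (hp : ∀ s : Finset ℕ+, ∑ j ∈ s, p j ≤ 1) {c C : ℝ} (hc : 0 ≤ c) (hC : 0 ≤ C)
    (helias : ∀ x M : ℕ, 1 ≤ x → (eliasLength (x - M + 1) : ℝ) ≤ c * Real.logb 2 x + C)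
    {κ : ℕ} (hκ : 1 ≤ κ) (x : Fin n → ℕ+) (hx : ∀ i, 0 < p (x i)) :
    Real.log ((∏ i, p (x i)) / (codingDist n x).toReal) ≤
      ∑ i : Fin n, ((subThreshold x (before n (i + 1)) : ℝ) + 1) / (2 * (i + 1)) +
      subThreshold x (before n n) * (Real.log 2 + Real.log n / 2) +
      ∑ i : Fin n, (if subThreshold x (before n i) < (x i : ℕ) then
        Real.log ((subThreshold x (before n (i + 1)) : ℝ) + 1) +
          (Real.log 2 + c * Real.log κ + C) else 0) +
      c * ∑ i : Fin n, (dyadicCount κ (x i) : ℝ) + 3 := by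
  have hl2 : 0 < Real.log 2 := Real.log_pos one_lt_two
  have hl2' : Real.log 2 ≤ 1 := by
    have := Real.log_le_sub_one_of_pos (zero_lt_two' ℝ); linarith
  have hprod : 0 < ∏ i, p (x i) := Finset.prod_pos fun i _ => hx i
  have hQ := codingDist_toReal_ge n x
  have hQpos : (0 : ℝ) < 2 ^ (-codelength x) := by positivity
  rw [Real.log_div hprod.ne' (hQpos.trans_le hQ).ne']
  have h1 := Real.log_le_log hQpos hQ
  rw [Real.log_rpow two_pos] at h1
  have h2 := codelength_mul_log_two x
  have h3 := log_prob_sub_log_mixtureProb_le hp0 hp x hx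
  rw [← Fin.sum_univ_eq_sum_range
    (fun i => ((subThreshold x (before n (i + 1)) : ℝ) + 1) / (2 * (i + 1)))] at h3
  have h4 : ∀ i : Fin n, (if subThreshold x (before n i) < (x i : ℕ) then
        Real.log 2 + Real.log ((subThreshold x (before n i) : ℝ) + 1) else 0) +
      Real.log 2 * (if subThreshold x (before n i) < (x i : ℕ) then
        (eliasLength ((x i : ℕ) - subThreshold x (before n i) + 1) : ℝ) else 0) ≤
      (if subThreshold x (before n i) < (x i : ℕ) then
        Real.log ((subThreshold x (before n (i + 1)) : ℝ) + 1) +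
          (Real.log 2 + c * Real.log κ + C) else 0) + c * (dyadicCount κ (x i) : ℝ) := by
    intro i
    have hR : (0 : ℝ) ≤ dyadicCount κ (x i) := Nat.cast_nonneg _
    split_ifs with h
    · have h5 := helias (x i) (subThreshold x (before n i)) (x i).pos
      have h6 := log_le_log_add_dyadicCount hκ (j := (x i : ℕ)) (x i).pos
      have h7 : (subThreshold x (before n i) : ℝ) ≤ subThreshold x (before n (i + 1)) := by
        exact_mod_cast subThreshold_mono x (before_mono (Nat.le_succ _))
      have h8 := Real.log_le_log (x := (subThreshold x (before n i) : ℝ) + 1) (by positivity)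
        (add_le_add_left h7 1)
      have h9 : Real.log 2 * (eliasLength ((x i : ℕ) - subThreshold x (before n i) + 1) : ℝ) ≤
          c * Real.log (x i : ℕ) + C := by
        have h10 : Real.log 2 * (c * Real.logb 2 (x i : ℕ) + C) =
            c * Real.log (x i : ℕ) + Real.log 2 * C := by
          rw [Real.logb]; field_simp
        have h11 := mul_le_mul_of_nonneg_left h5 hl2.le
        rw [h10] at h11
        have h12 : Real.log 2 * C ≤ 1 * C := by gcongr
        linarith
      have h13 := mul_le_mul_of_nonneg_left h6 hc
      have h14 : Real.log 2 * (dyadicCount κ (x i) : ℝ) ≤ 1 * dyadicCount κ (x i) := by gcongr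
      have h15 := mul_le_mul_of_nonneg_left h14 hc
      linarith
    · have := mul_nonneg hc hR
      linarith
  have h5 := Finset.sum_le_sum fun i (_ : i ∈ Finset.univ) => h4 i
  rw [Finset.sum_add_distrib, Finset.sum_add_distrib, ← Finset.mul_sum, ← Finset.mul_sum] at h5
  linarith

/-- The bound on the redundancy of the ETAC code in nats, in terms of levels `K i` at which the
envelope allows for at most `K i` among `i` symbols, on average. -/
def redundancyBound (n : ℕ) (K : ℕ → ℕ) (η c C V : ℝ) : ℝ :=
  ∑ i ∈ Finset.range n, (((1 + η) * K (i + 1) + (1 + 1 / (4 * η))) + 1) / (2 * (i + 1)) +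
  ((1 + η) * K n + (1 + 1 / (4 * η))) * (Real.log 2 + Real.log n / 2) +
  ∑ i ∈ Finset.range n, (((1 + η) * K (i + 1) + (1 + 1 / (4 * η))) *
    (Real.log (K n + 2) + (Real.log 2 + c * Real.log (K n) + C)) + 1 + 2 * K (i + 1)) / (i + 1) +
  c * V + 3

theorem maxRedundancy_codingDist_le {f : ℕ+ → ℝ} (hf : IsEnvelope f) {n : ℕ} {K : ℕ → ℕ}
    (hmono : Monotone K) (hK : ∀ i, 1 ≤ i → i * tailSum f (K i) ≤ K i) (hn : 1 ≤ n)
    (hKn : 1 ≤ K n) {η c C V : ℝ} (hη : 0 < η) (hc : 0 ≤ c) (hC : 0 ≤ C)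
    (helias : ∀ x M : ℕ, 1 ≤ x → (eliasLength (x - M + 1) : ℝ) ≤ c * Real.logb 2 x + C)
    (hV : n * ∑' r : ℕ, ENNReal.ofReal (tailSum f (2 ^ r * K n)) ≤ ENNReal.ofReal V)
    (hV0 : 0 ≤ V) :
    maxRedundancy (codingDist n) (envelopeClass f n) ≤
      ENNReal.ofReal (redundancyBound n K η c C V / Real.log 2) := by
  have hl2 : 0 < Real.log 2 := Real.log_pos one_lt_two
  refine iSup₂_le ?_
  rintro P ⟨p, hpf, hP⟩
  set p' : ℕ+ → ℝ := fun j => (p j).toReal with hp'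
  have hp0 : ∀ j, 0 ≤ p' j := fun j => ENNReal.toReal_nonneg
  have hp1 : ∀ s : Finset ℕ+, ∑ j ∈ s, p' j ≤ 1 := by
    intro s
    rw [hp', ← ENNReal.toReal_sum fun j _ => PMF.apply_ne_top p j]
    exact ENNReal.toReal_le_of_le_ofReal zero_le_one (by
      rw [ENNReal.ofReal_one, ← PMF.tsum_coe p]; exact ENNReal.sum_le_tsum s)
  have hκ1 : (1 : ℝ) ≤ K n := by exact_mod_cast hKn
  set a : ℝ := Real.log 2 + c * Real.log (K n) + C with ha
  have ha0 : 0 ≤ a := by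
    have := Real.log_nonneg hκ1
    positivity
  set L : ℝ := Real.log 2 + Real.log n / 2 with hL
  have hL0 : 0 ≤ L := by
    have := Real.log_natCast_nonneg n
    positivity
  let M : ℕ → (Fin n → ℕ+) → ℕ := fun i x => subThreshold x (before n i)
  have hlogM : ∀ i x, 0 ≤ Real.log ((M i x : ℝ) + 1) := fun i x =>
    Real.log_nonneg (by have : (0 : ℝ) ≤ M i x := Nat.cast_nonneg _
                        linarith)
  let g : (Fin n → ℕ+) → ℝ := fun x =>
    ∑ i : Fin n, ((M (i + 1) x : ℝ) + 1) / (2 * (i + 1)) + M n x * L +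
      ∑ i : Fin n, (if M i x < (x i : ℕ) then Real.log ((M (i + 1) x : ℝ) + 1) + a else 0) +
      c * ∑ i : Fin n, (dyadicCount (K n) (x i) : ℝ) + 3
  have hterm3 : ∀ x (i : Fin n), 0 ≤ (if M i x < (x i : ℕ) then
      Real.log ((M (i + 1) x : ℝ) + 1) + a else 0) := by
    intro x i
    have := hlogM (i + 1) x
    split_ifs <;> positivity
  have hg : ∀ x, 0 ≤ g x := by
    intro x
    have h1 := Finset.sum_nonneg fun i (_ : i ∈ Finset.univ) => hterm3 x i
    have h2 : 0 ≤ ∑ i : Fin n, ((M (i + 1) x : ℝ) + 1) / (2 * (i + 1)) :=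
      Finset.sum_nonneg fun i _ => by positivity
    positivity
  have hQ : ∀ x, codingDist n x ≠ 0 := by
    intro x h
    have h1 := codingDist_toReal_ge n x
    rw [h] at h1
    have h2 : (0 : ℝ) < 2 ^ (-codelength x) := by positivity
    simp at h1
    linarith
  have hmain : ∀ x, P x ≠ 0 → Real.log ((P x).toReal / (codingDist n x).toReal) ≤ g x := by
    intro x hx
    rw [hP, Finset.prod_ne_zero_iff] at hx
    have hx' : ∀ i, 0 < p' (x i) := fun i =>
      ENNReal.toReal_pos (hx i (Finset.mem_univ i)) (PMF.apply_ne_top _ _)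
    rw [hP, ENNReal.toReal_prod]
    exact log_div_codingDist_le hp0 hp1 hc hC helias hKn x hx'
  refine (relEntropy_le_of_log_div_le hQ hg hmain).trans ?_
  rw [ENNReal.ofReal_div_of_pos hl2]
  refine ENNReal.div_le_div_right ?_ _
  have hE : ∑' x, P x * ENNReal.ofReal (g x) = ∫⁻ x, ENNReal.ofReal (g x) ∂(wordMeasure p n) := by
    rw [lintegral_wordMeasure]
    exact tsum_congr fun x => by rw [hP]
  rw [hE]
  have htail : ∀ i : ℕ, 1 ≤ i → (i : ℝ) * tailProb p (K i) ≤ K i := by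
    intro i hi
    refine le_trans (mul_le_mul_of_nonneg_left ?_ (Nat.cast_nonneg i)) (hK i hi)
    refine ENNReal.toReal_le_of_le_ofReal ?_ (tailProb_le_tailSum hf hpf (K i))
    exact tsum_nonneg fun j => by
      have := (hf.pos j).le
      split_ifs <;> simp [this]
  have hM1 : ∀ i, 1 ≤ i → i ≤ n → ∫⁻ x, (M i x : ℝ≥0∞) ∂(wordMeasure p n) ≤
      ENNReal.ofReal ((1 + η) * K i + (1 + 1 / (4 * η))) := fun i h1 h2 =>
    lintegral_subThreshold_le p h2 (htail i h1) hη
  have hpt : ∀ x, ENNReal.ofReal (g x) ≤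
      ∑ i : Fin n, ((M (i + 1) x : ℝ≥0∞) + 1) * ENNReal.ofReal (1 / (2 * (i + 1))) +
      M n x * ENNReal.ofReal L +
      ∑ i : Fin n, (if M i x < (x i : ℕ) then
        ENNReal.ofReal (Real.log ((M (i + 1) x : ℝ) + 1) + a) else 0) +
      ENNReal.ofReal c * ∑ i : Fin n, (dyadicCount (K n) (x i) : ℝ≥0∞) + ENNReal.ofReal 3 := by
    intro x
    refine (ENNReal.ofReal_add_le).trans (add_le_add_left ?_ _)
    refine (ENNReal.ofReal_add_le).trans (add_le_add ?_ ?_)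
    · refine (ENNReal.ofReal_add_le).trans (add_le_add ?_ ?_)
      · refine (ENNReal.ofReal_add_le).trans (add_le_add ?_ ?_)
        · rw [ENNReal.ofReal_sum_of_nonneg fun i _ => by positivity]
          refine Finset.sum_le_sum fun i _ => le_of_eq ?_
          rw [div_eq_mul_one_div, ENNReal.ofReal_mul (by positivity),
            ENNReal.ofReal_add (by positivity) zero_le_one, ENNReal.ofReal_one,
            ENNReal.ofReal_natCast]
        · rw [ENNReal.ofReal_mul (Nat.cast_nonneg _), ENNReal.ofReal_natCast]
      · rw [ENNReal.ofReal_sum_of_nonneg fun i _ => hterm3 x i]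
        refine Finset.sum_le_sum fun i _ => le_of_eq ?_
        split_ifs <;> simp
    · rw [ENNReal.ofReal_mul hc, ENNReal.ofReal_sum_of_nonneg fun i _ => Nat.cast_nonneg _]
      simp only [ENNReal.ofReal_natCast]
      exact le_rfl
  refine (lintegral_mono hpt).trans ?_
  have hmeas : ∀ h : (Fin n → ℕ+) → ℝ≥0∞, Measurable h := fun h => measurable_of_countable h
  rw [lintegral_add_left (hmeas _), lintegral_add_left (hmeas _), lintegral_add_left (hmeas _),
    lintegral_add_left (hmeas _), lintegral_finsetSum _ fun i _ => hmeas _,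
    lintegral_finsetSum _ fun i _ => hmeas _, lintegral_mul_const _ (hmeas _),
    lintegral_const_mul _ (hmeas _), lintegral_finsetSum _ fun i _ => hmeas _, lintegral_const,
    measure_univ, mul_one]
  have hC0 : ∀ i, 0 ≤ (1 + η) * (K i : ℝ) + (1 + 1 / (4 * η)) := fun i => by positivity
  have hlogK : 0 ≤ Real.log ((K n : ℝ) + 2) := Real.log_nonneg (by linarith)
  have ha2 : 0 ≤ Real.log ((K n : ℝ) + 2) + a := by positivity
  -- the expectation of the five terms
  have b1 : ∑ i : Fin n, ∫⁻ x, ((M (i + 1) x : ℝ≥0∞) + 1) * ENNReal.ofReal (1 / (2 * (i + 1)))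
      ∂(wordMeasure p n) ≤ ENNReal.ofReal (∑ i ∈ Finset.range n,
        (((1 + η) * K (i + 1) + (1 + 1 / (4 * η))) + 1) / (2 * (i + 1))) := by
    rw [← Fin.sum_univ_eq_sum_range
      (fun i => (((1 + η) * K (i + 1) + (1 + 1 / (4 * η))) + 1) / (2 * ((i : ℝ) + 1))),
      ENNReal.ofReal_sum_of_nonneg fun i _ => by have := hC0 (i + 1); positivity]
    refine Finset.sum_le_sum fun i _ => ?_
    rw [lintegral_mul_const _ (hmeas _), lintegral_add_left (hmeas _), lintegral_const,
      measure_univ, mul_one, div_eq_mul_one_div (((1 + η) * (K (i + 1) : ℝ) + (1 + 1 / (4 * η))) + 1),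
      ENNReal.ofReal_mul (by have := hC0 (i + 1); positivity),
      ENNReal.ofReal_add (hC0 _) zero_le_one, ENNReal.ofReal_one]
    gcongr
    exact hM1 (i + 1) (by omega) i.2
  have b2 : (∫⁻ x, (M n x : ℝ≥0∞) ∂(wordMeasure p n)) * ENNReal.ofReal L ≤
      ENNReal.ofReal (((1 + η) * K n + (1 + 1 / (4 * η))) * L) := by
    rw [ENNReal.ofReal_mul (hC0 _)]
    gcongr
    exact hM1 n hn le_rfl
  have b3 : ∑ i : Fin n, ∫⁻ x, (if M i x < (x i : ℕ) then
        ENNReal.ofReal (Real.log ((M (i + 1) x : ℝ) + 1) + a) else 0) ∂(wordMeasure p n) ≤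
      ENNReal.ofReal (∑ i ∈ Finset.range n, (((1 + η) * K (i + 1) + (1 + 1 / (4 * η))) *
        (Real.log (K n + 2) + a) + 1 + 2 * K (i + 1)) / (i + 1)) := by
    rw [← Fin.sum_univ_eq_sum_range
      (fun i => (((1 + η) * K (i + 1) + (1 + 1 / (4 * η))) *
        (Real.log (K n + 2) + a) + 1 + 2 * K (i + 1)) / ((i : ℝ) + 1)),
      ENNReal.ofReal_sum_of_nonneg fun i _ => by have := hC0 (i + 1); positivity]
    refine Finset.sum_le_sum fun i _ => ?_
    rw [ENNReal.ofReal_div_of_pos (by positivity),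
      ENNReal.le_div_iff_mul_le (Or.inl (by simp; positivity)) (Or.inl ENNReal.ofReal_ne_top),
      mul_comm]
    have e : ENNReal.ofReal ((i : ℝ) + 1) = (i : ℝ≥0∞) + 1 := by
      rw [ENNReal.ofReal_add (by positivity) zero_le_one]; simp
    rw [e]
    refine (lintegral_redacted_le p i
      (fun m => ENNReal.ofReal (Real.log ((m : ℝ) + 1) + a))).trans ?_
    exact lintegral_subThreshold_mul_log_le p i.2 (htail (i + 1) (by omega)) hη
      (hmono i.2) ha0
  have b4 : ENNReal.ofReal c * ∑ i : Fin n, ∫⁻ x, (dyadicCount (K n) (x i) : ℝ≥0∞)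
      ∂(wordMeasure p n) ≤ ENNReal.ofReal (c * V) := by
    rw [ENNReal.ofReal_mul hc]
    refine mul_le_mul_right (le_trans ?_ hV) _
    rw [Finset.sum_congr rfl fun i _ => lintegral_wordMeasure_eval p i
      (fun j => (dyadicCount (K n) (j : ℕ) : ℝ≥0∞))]
    rw [Finset.sum_const, Finset.card_univ, Fintype.card_fin, nsmul_eq_mul]
    exact mul_le_mul_right (lintegral_dyadicCount_le hf hpf (K n)) _
  refine (add_le_add_left (add_le_add (add_le_add (add_le_add b1 b2) b3) b4) _).trans ?_
  have s1 : 0 ≤ ∑ i ∈ Finset.range n,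
      (((1 + η) * (K (i + 1) : ℝ) + (1 + 1 / (4 * η))) + 1) / (2 * ((i : ℝ) + 1)) :=
    Finset.sum_nonneg fun i _ => by have := hC0 (i + 1); positivity
  have s2 := mul_nonneg (hC0 n) hL0
  have s3 : 0 ≤ ∑ i ∈ Finset.range n, (((1 + η) * (K (i + 1) : ℝ) + (1 + 1 / (4 * η))) *
        (Real.log (K n + 2) + a) + 1 + 2 * K (i + 1)) / ((i : ℝ) + 1) :=
    Finset.sum_nonneg fun i _ => by have := hC0 (i + 1); positivity
  have s4 := mul_nonneg hc hV0
  rw [← ENNReal.ofReal_add s1 s2, ← ENNReal.ofReal_add (add_nonneg s1 s2) s3,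
    ← ENNReal.ofReal_add (add_nonneg (add_nonneg s1 s2) s3) s4,
    ← ENNReal.ofReal_add (add_nonneg (add_nonneg (add_nonneg s1 s2) s3) s4) (by norm_num)]
  exact le_rfl

/-! ### Regular variation of the envelope tail -/

/-- If `tₙ ^ n` tends to `exp (-c)` then `n (1 - tₙ)` tends to `c`. -/
theorem tendsto_mul_one_sub_of_tendsto_pow {t : ℕ → ℝ} (h0 : ∀ n, 0 ≤ t n) {c : ℝ}
    (h : Tendsto (fun n => t n ^ n) atTop (𝓝 (Real.exp (-c)))) :
    Tendsto (fun n : ℕ => n * (1 - t n)) atTop (𝓝 c) := by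
  have hpos : ∀ᶠ n in atTop, 0 < t n := by
    filter_upwards [h.eventually (lt_mem_nhds (Real.exp_pos (-c))), eventually_ge_atTop 1]
      with n hn hn1
    rcases (h0 n).lt_or_eq with h1 | h1
    · exact h1
    · rw [← h1, zero_pow (by omega)] at hn
      exact absurd hn (lt_irrefl _)
  have hL : Tendsto (fun n : ℕ => n * (-Real.log (t n))) atTop (𝓝 c) := by
    have h1 := (Real.continuousAt_log (Real.exp_pos (-c)).ne').tendsto.comp h
    rw [Real.log_exp] at h1
    have h2 := h1.neg
    rw [neg_neg] at h2
    refine h2.congr fun n => ?_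
    simp only [Function.comp_apply, Real.log_pow]
    ring
  have ht1 : Tendsto t atTop (𝓝 1) := by
    have h1 : Tendsto (fun n : ℕ => -((n : ℝ) * (-Real.log (t n)) * (n : ℝ)⁻¹)) atTop
        (𝓝 (-(c * 0))) := (hL.mul tendsto_inv_atTop_nhds_zero_nat).neg
    have h2 := (Real.continuous_exp.tendsto _).comp h1
    simp only [mul_zero, neg_zero, Real.exp_zero] at h2
    refine h2.congr' ?_
    filter_upwards [hpos, eventually_ge_atTop 1] with n hn hn1
    have hn' : (n : ℝ) ≠ 0 := by positivity
    simp only [Function.comp_apply]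
    rw [mul_right_comm, mul_inv_cancel₀ hn', one_mul, neg_neg, Real.exp_log hn]
  refine tendsto_of_tendsto_of_tendsto_of_le_of_le' (by simpa using ht1.mul hL) hL ?_ ?_
  · filter_upwards [hpos] with n hn
    have h1 := Real.one_sub_inv_le_log_of_pos hn
    have h2 : t n * (-Real.log (t n)) ≤ 1 - t n := by
      have := mul_le_mul_of_nonneg_left h1 hn.le
      rw [mul_sub, mul_one, mul_inv_cancel₀ hn.ne'] at this
      linarith
    have := mul_le_mul_of_nonneg_left h2 (Nat.cast_nonneg (α := ℝ) n)
    linarith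
  · filter_upwards [hpos] with n hn
    have h1 := Real.log_le_sub_one_of_pos hn
    exact mul_le_mul_of_nonneg_left (by linarith) (Nat.cast_nonneg n)

/-- A nonnegative sequence which contracts, up to vanishing errors, from `n / 2` to `n` tends to
zero. -/
theorem tendsto_zero_of_le_half {v e : ℕ → ℝ} {θ : ℝ} (hθ0 : 0 ≤ θ) (hθ1 : θ < 1)
    (hv : ∀ n, 0 ≤ v n) (he : Tendsto e atTop (𝓝 0))
    (h : ∀ᶠ n in atTop, v n ≤ θ * v (n / 2) + e n) : Tendsto v atTop (𝓝 0) := by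
  rw [Metric.tendsto_atTop]
  intro ε hε
  have hε2 : 0 < (1 - θ) * (ε / 2) := mul_pos (by linarith) (by linarith)
  obtain ⟨n₀, hn₀⟩ := eventually_atTop.mp
    ((h.and (he.eventually (gt_mem_nhds hε2))).and (eventually_ge_atTop 1))
  have hn₀1 : 1 ≤ n₀ := (hn₀ n₀ le_rfl).2
  set x : ℕ → ℝ := fun n => max (v n - ε / 2) 0 with hx
  have hx0 : ∀ n, 0 ≤ x n := fun n => le_max_right _ _
  have hxstep : ∀ n, n₀ ≤ n → x n ≤ θ * x (n / 2) := by
    intro n hn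
    obtain ⟨⟨h1, h2⟩, -⟩ := hn₀ n hn
    refine max_le ?_ (mul_nonneg hθ0 (hx0 _))
    have h3 : v (n / 2) - ε / 2 ≤ x (n / 2) := le_max_left _ _
    have := mul_le_mul_of_nonneg_left h3 hθ0
    linarith
  obtain ⟨B, hB⟩ : ∃ B : ℝ, ∀ n < n₀, x n ≤ B :=
    ⟨∑ n ∈ Finset.range n₀, x n, fun n hn =>
      Finset.single_le_sum (fun i _ => hx0 i) (Finset.mem_range.mpr hn)⟩
  have hB0 : 0 ≤ B := (hx0 0).trans (hB 0 (by omega))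
  have hall : ∀ n, x n ≤ B := by
    intro n
    induction n using Nat.strong_induction_on with
    | _ n ih =>
      by_cases hn : n < n₀
      · exact hB n hn
      · have h1 := hxstep n (by omega)
        have h2 := ih (n / 2) (by omega)
        have h3 := mul_le_mul_of_nonneg_left h2 hθ0
        nlinarith
  have hgeom : ∀ j n, 2 ^ j * n₀ ≤ n → x n ≤ θ ^ j * B := by
    intro j
    induction j with
    | zero => intro n _; simpa using hall n
    | succ j ih =>
      intro n hn
      have h2j : 1 ≤ 2 ^ j := Nat.one_le_two_pow
      have h0 : n₀ ≤ n := by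
        rw [pow_succ] at hn; nlinarith
      have h1 := ih (n / 2) (by
        rw [pow_succ, mul_right_comm] at hn
        exact (Nat.le_div_iff_mul_le two_pos).mpr hn)
      refine (hxstep n h0).trans ?_
      rw [pow_succ']
      have := mul_le_mul_of_nonneg_left h1 hθ0
      linarith
  have hlim : Tendsto (fun j : ℕ => θ ^ j * B) atTop (𝓝 0) := by
    simpa using (tendsto_pow_atTop_nhds_zero_of_lt_one hθ0 hθ1).mul_const B
  obtain ⟨j, hj⟩ := (hlim.eventually (gt_mem_nhds (half_pos hε))).exists
  refine ⟨2 ^ j * n₀, fun n hn => ?_⟩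
  have h1 := hgeom j n hn
  have h2 : v n - ε / 2 ≤ x n := le_max_left _ _
  rw [Real.dist_eq, sub_zero, abs_of_nonneg (hv n)]
  linarith

section Extremes

variable {G : ℝ → ℝ} {a u : ℕ → ℝ} {α : ℝ}

theorem tendsto_div_of_tendsto_mul_tail (hG : Antitone G) (ha : ∀ n, 0 < a n) (hα : 0 < α)
    (hlim : ∀ y : ℝ, 0 < y →
      Tendsto (fun n : ℕ => n * G (a n * (y - 1) + u n)) atTop (𝓝 (y ^ (-α))))
    {ι : Type*} {l : Filter ι} {m : ι → ℕ} (hm : Tendsto m l atTop) {z : ι → ℝ} {c : ℝ}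
    (hc : 0 < c) (hz : Tendsto (fun i => m i * G (z i)) l (𝓝 (c ^ (-α)))) :
    Tendsto (fun i => (z i - u (m i)) / a (m i)) l (𝓝 (c - 1)) := by
  refine tendsto_order.mpr ⟨fun b hb => ?_, fun b hb => ?_⟩
  · set c' := max (c / 2) ((b + 1 + c) / 2) with hc'
    have hc'0 : 0 < c' := lt_max_of_lt_left (by linarith)
    have hc'c : c' < c := max_lt (by linarith) (by linarith)
    have hbc : b < c' - 1 := by
      have : (b + 1 + c) / 2 ≤ c' := le_max_right _ _
      linarith
    have h1 : c ^ (-α) < c' ^ (-α) := Real.rpow_lt_rpow_of_neg hc'0 hc'c (by linarith)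
    filter_upwards [hz.eventually_lt ((hlim c' hc'0).comp hm) h1] with i hi
    simp only [Function.comp_apply] at hi
    have h2 : a (m i) * (c' - 1) + u (m i) ≤ z i := by
      by_contra h
      push Not at h
      have := mul_le_mul_of_nonneg_left (hG h.le) (Nat.cast_nonneg (α := ℝ) (m i))
      linarith
    refine hbc.trans_le ?_
    rw [le_div_iff₀ (ha _)]
    linarith
  · set c' := (b + 1 + c) / 2 with hc'
    have hcc' : c < c' := by rw [hc']; linarith
    have hbc : c' - 1 < b := by rw [hc']; linarith
    have h1 : c' ^ (-α) < c ^ (-α) := Real.rpow_lt_rpow_of_neg hc hcc' (by linarith)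
    filter_upwards [((hlim c' (hc.trans hcc')).comp hm).eventually_lt hz h1] with i hi
    simp only [Function.comp_apply] at hi
    have h2 : z i ≤ a (m i) * (c' - 1) + u (m i) := by
      by_contra h
      push Not at h
      have := mul_le_mul_of_nonneg_left (hG h.le) (Nat.cast_nonneg (α := ℝ) (m i))
      linarith
    refine lt_of_le_of_lt ?_ hbc
    rw [div_le_iff₀ (ha _)]
    linarith

theorem tendsto_mul_tail_of_tendsto_div (hG : Antitone G) (ha : ∀ n, 0 < a n)
    (hlim : ∀ y : ℝ, 0 < y →
      Tendsto (fun n : ℕ => n * G (a n * (y - 1) + u n)) atTop (𝓝 (y ^ (-α))))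
    {ι : Type*} {l : Filter ι} {m : ι → ℕ} (hm : Tendsto m l atTop) {z : ι → ℝ} {c : ℝ}
    (hc : 0 < c) (hz : Tendsto (fun i => (z i - u (m i)) / a (m i)) l (𝓝 (c - 1))) :
    Tendsto (fun i => m i * G (z i)) l (𝓝 (c ^ (-α))) := by
  have hcont : ContinuousAt (fun y : ℝ => y ^ (-α)) c :=
    Real.continuousAt_rpow_const _ _ (Or.inl hc.ne')
  refine tendsto_order.mpr ⟨fun b hb => ?_, fun b hb => ?_⟩
  · have h1 := hcont.eventually (lt_mem_nhds hb)
    obtain ⟨c', hc', h2⟩ := (h1.filter_mono nhdsWithin_le_nhds).and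
      (self_mem_nhdsWithin (s := Set.Ioi c) (a := c)) |>.exists
    have h2' : c < c' := h2
    filter_upwards [((hlim c' (hc.trans h2')).comp hm).eventually (lt_mem_nhds hc'),
      hz.eventually (gt_mem_nhds (show c - 1 < c' - 1 by linarith))] with i h3 h4
    rw [div_lt_iff₀ (ha _)] at h4
    simp only [Function.comp_apply] at h3
    refine h3.trans_le (mul_le_mul_of_nonneg_left (hG ?_) (Nat.cast_nonneg _))
    linarith
  · have h1 := (hcont.eventually (gt_mem_nhds hb)).and (lt_mem_nhds hc)
    obtain ⟨c', ⟨hc', hc'0⟩, h2⟩ := (h1.filter_mono nhdsWithin_le_nhds).and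
      (self_mem_nhdsWithin (s := Set.Iio c) (a := c)) |>.exists
    have h2' : c' < c := h2
    filter_upwards [((hlim c' hc'0).comp hm).eventually (gt_mem_nhds hc'),
      hz.eventually (lt_mem_nhds (show c' - 1 < c - 1 by linarith))] with i h3 h4
    rw [lt_div_iff₀ (ha _)] at h4
    simp only [Function.comp_apply] at h3
    refine lt_of_le_of_lt (mul_le_mul_of_nonneg_left (hG ?_) (Nat.cast_nonneg _)) h3
    linarith

/-- The centring sequence of a Fréchet limit is equivalent to the scaling sequence (in the
normalization of the limit `y ^ (-α)`), hence can be dispensed with. -/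
theorem tendsto_centring_div_scaling (hG : Antitone G) (ha : ∀ n, 0 < a n) (hα : 0 < α)
    (hlim : ∀ y : ℝ, 0 < y →
      Tendsto (fun n : ℕ => n * G (a n * (y - 1) + u n)) atTop (𝓝 (y ^ (-α)))) :
    Tendsto (fun n => u n / a n) atTop (𝓝 1) := by
  set r : ℝ := 2 ^ (1 / α) with hr
  have hr1 : 1 < r := Real.one_lt_rpow one_lt_two (by positivity)
  have hr0 : 0 < r := by linarith
  have hrα : r ^ (-α) = 1 / 2 := by
    rw [hr, ← Real.rpow_mul two_pos.le, show 1 / α * -α = -1 by field_simp, Real.rpow_neg_one]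
    norm_num
  have hrpow : ∀ k : ℕ, (r ^ k) ^ (-α) = (1 / 2) ^ k := by
    intro k
    rw [← Real.rpow_natCast, ← Real.rpow_mul hr0.le, mul_comm, Real.rpow_mul hr0.le, hrα,
      Real.rpow_natCast]
  have hu : Tendsto (fun n : ℕ => n * G (u n)) atTop (𝓝 1) := by
    have := hlim 1 one_pos
    simpa using this
  have hhalf : Tendsto (fun n : ℕ => n / 2) atTop atTop :=
    tendsto_atTop_mono' _ (Eventually.of_forall fun n => le_rfl)
      (Nat.tendsto_div_const_atTop two_ne_zero)
  have hratio : Tendsto (fun n : ℕ => ((n / 2 : ℕ) : ℝ) / n) atTop (𝓝 (1 / 2)) := by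
    have h1 : Tendsto (fun n : ℕ => 1 / 2 - (n : ℝ)⁻¹) atTop (𝓝 (1 / 2 - 0)) :=
      tendsto_const_nhds.sub tendsto_inv_atTop_nhds_zero_nat
    rw [sub_zero] at h1
    refine tendsto_of_tendsto_of_tendsto_of_le_of_le' h1 tendsto_const_nhds ?_ ?_
    · filter_upwards [eventually_ge_atTop 1] with n hn
      have hn' : (0 : ℝ) < n := by exact_mod_cast hn
      rw [le_div_iff₀ hn', sub_mul, inv_mul_cancel₀ hn'.ne']
      have : n ≤ 2 * (n / 2) + 1 := by omega
      have h2 : (n : ℝ) ≤ 2 * ((n / 2 : ℕ) : ℝ) + 1 := by exact_mod_cast this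
      linarith
    · filter_upwards [eventually_ge_atTop 1] with n hn
      have hn' : (0 : ℝ) < n := by exact_mod_cast hn
      rw [div_le_iff₀ hn']
      have : 2 * (n / 2) ≤ n := by omega
      have h2 : 2 * ((n / 2 : ℕ) : ℝ) ≤ n := by exact_mod_cast this
      linarith
  -- `u n`, `u (4 n)` in the normalization of index `n / 2`, and `u (4 n)` in that of index `n`
  have h1 : Tendsto (fun n : ℕ => (u n - u (n / 2)) / a (n / 2)) atTop (𝓝 (r - 1)) := by
    refine tendsto_div_of_tendsto_mul_tail hG ha hα hlim hhalf hr0 ?_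
    rw [hrα]
    have h2 := hratio.mul hu
    rw [mul_one] at h2
    refine h2.congr' ?_
    filter_upwards [eventually_ge_atTop 1] with n hn
    have hn' : (n : ℝ) ≠ 0 := by positivity
    field_simp
  have hfour : Tendsto (fun n : ℕ => 4 * n) atTop atTop :=
    tendsto_atTop_mono (fun n => by simp only [id]; omega) tendsto_id
  have hu4 : Tendsto (fun n : ℕ => (n : ℝ) * G (u (4 * n))) atTop (𝓝 (1 / 4)) := by
    have h2 := (hu.comp hfour).const_mul (1 / 4)
    rw [mul_one] at h2
    refine h2.congr fun n => ?_
    simp only [Function.comp_apply]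
    push_cast
    ring
  have h2 : Tendsto (fun n : ℕ => (u (4 * n) - u n) / a n) atTop (𝓝 (r ^ 2 - 1)) := by
    refine tendsto_div_of_tendsto_mul_tail (m := id) hG ha hα hlim tendsto_id (by positivity) ?_
    rw [hrpow]
    norm_num at hu4 ⊢
    exact hu4
  have h3 : Tendsto (fun n : ℕ => (u (4 * n) - u (n / 2)) / a (n / 2)) atTop (𝓝 (r ^ 3 - 1)) := by
    refine tendsto_div_of_tendsto_mul_tail hG ha hα hlim hhalf (by positivity) ?_
    rw [hrpow]
    have h4 := hratio.mul hu4
    rw [show (1 / 2 : ℝ) * (1 / 4) = (1 / 2) ^ 3 by norm_num] at h4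
    refine h4.congr' ?_
    filter_upwards [eventually_ge_atTop 1] with n hn
    have hn' : (n : ℝ) ≠ 0 := by positivity
    field_simp
  have h4 : Tendsto (fun n : ℕ => a n / a (n / 2)) atTop (𝓝 r) := by
    have h5 := (h3.sub h1).div h2 (by nlinarith)
    have e : (r ^ 3 - 1 - (r - 1)) / (r ^ 2 - 1) = r := by
      rw [div_eq_iff (by nlinarith)]; ring
    rw [e] at h5
    refine h5.congr' ?_
    filter_upwards [h2.eventually_ne (show r ^ 2 - 1 ≠ 0 by nlinarith)] with n hn
    have ha1 := (ha n).ne'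
    have ha2 := (ha (n / 2)).ne'
    have hne : u (4 * n) - u n ≠ 0 := fun h => hn (by rw [h, zero_div])
    simp only [Pi.div_apply]
    rw [← sub_div, sub_sub_sub_cancel_right]
    field_simp
  set s : ℕ → ℝ := fun n => (u n - u (n / 2)) / a (n / 2)
  set ρ : ℕ → ℝ := fun n => a n / a (n / 2)
  set θ : ℝ := 2 / (1 + r) with hθ
  have hθ0 : 0 < θ := by positivity
  have hθ1 : θ < 1 := by rw [hθ, div_lt_one (by linarith)]; linarith
  have hv : Tendsto (fun n => |u n / a n - 1|) atTop (𝓝 0) := by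
    refine tendsto_zero_of_le_half (θ := θ) (e := fun n => θ * |1 + s n - ρ n|) hθ0.le hθ1
      (fun n => abs_nonneg _) ?_ ?_
    · have h5 : Tendsto (fun n => 1 + s n - ρ n) atTop (𝓝 (1 + (r - 1) - r)) :=
        (h1.const_add 1).sub h4
      have h6 := h5.abs.const_mul θ
      simpa using h6
    · filter_upwards [h4.eventually (lt_mem_nhds (show (1 + r) / 2 < r by linarith))] with n hn
      have hρ : 0 < ρ n := by linarith
      have ha1 := (ha n).ne'
      have ha2 := (ha (n / 2)).ne'
      have e : u n / a n - 1 = ((u (n / 2) / a (n / 2) - 1) + (1 + s n - ρ n)) / ρ n := by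
        simp only [s, ρ]
        field_simp
        ring
      have hinv : 1 / ρ n ≤ θ := by
        rw [hθ, div_le_div_iff₀ hρ (by linarith)]
        linarith
      rw [e, abs_div, abs_of_pos hρ, ← mul_add, div_eq_mul_one_div, mul_comm]
      exact mul_le_mul hinv (abs_add_le _ _) (abs_nonneg _) hθ0.le
  have := tendsto_zero_iff_abs_tendsto_zero _ |>.mpr hv
  have h5 := this.add_const 1
  simpa using h5

/-- The tail of a distribution function in the Fréchet domain of attraction is regularly
varying. -/
theorem tendsto_tail_ratio (hG : Antitone G) (hGpos : ∀ x, 0 < G x)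
    (hG0 : Tendsto G atTop (𝓝 0)) (ha : ∀ n, 0 < a n) (hα : 0 < α)
    (hlim : ∀ y : ℝ, 0 < y →
      Tendsto (fun n : ℕ => n * G (a n * (y - 1) + u n)) atTop (𝓝 (y ^ (-α))))
    {t : ℝ} (ht : 0 < t) : Tendsto (fun x => G (t * x) / G x) atTop (𝓝 (t ^ (-α))) := by
  have hw := tendsto_centring_div_scaling hG ha hα hlim
  set m : ℝ → ℕ := fun x => ⌊(G x)⁻¹⌋₊ with hm
  have hinv : Tendsto (fun x => (G x)⁻¹) atTop atTop :=
    tendsto_inv_nhdsGT_zero.comp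
      (tendsto_nhdsWithin_iff.mpr ⟨hG0, Eventually.of_forall fun x => hGpos x⟩)
  have hmt : Tendsto m atTop atTop := tendsto_nat_floor_atTop.comp hinv
  have hmG : Tendsto (fun x => m x * G x) atTop (𝓝 1) := by
    have h1 : Tendsto (fun x => 1 - G x) atTop (𝓝 (1 - 0)) := tendsto_const_nhds.sub hG0
    rw [sub_zero] at h1
    refine tendsto_of_tendsto_of_tendsto_of_le_of_le h1 tendsto_const_nhds (fun x => ?_)
      (fun x => ?_)
    · have h2 := Nat.lt_floor_add_one (G x)⁻¹
      have h3 := mul_lt_mul_of_pos_right h2 (hGpos x)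
      rw [inv_mul_cancel₀ (hGpos x).ne'] at h3
      simp only [m]
      linarith
    · have h2 := Nat.floor_le (inv_pos.mpr (hGpos x)).le
      have h3 := mul_le_mul_of_nonneg_right h2 (hGpos x).le
      rw [inv_mul_cancel₀ (hGpos x).ne'] at h3
      exact h3
  have h1 := tendsto_div_of_tendsto_mul_tail hG ha hα hlim hmt (z := fun x => x) one_pos
    (by simpa using hmG)
  rw [sub_self] at h1
  have hwm := hw.comp hmt
  have h2 : Tendsto (fun x => (t * x - u (m x)) / a (m x)) atTop (𝓝 (t - 1)) := by
    have h3 := ((h1.add hwm).const_mul t).sub hwm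
    simp only [zero_add, mul_one] at h3
    refine h3.congr fun x => ?_
    simp only [Function.comp_apply]
    rw [← add_div, sub_add_cancel, sub_div, mul_div_assoc]
  have h3 := tendsto_mul_tail_of_tendsto_div hG ha hlim hmt ht h2
  have h4 := h3.div hmG one_ne_zero
  rw [div_one] at h4
  refine h4.congr' ?_
  filter_upwards [hmt.eventually_ge_atTop 1] with x hx
  have hx' : (m x : ℝ) ≠ 0 := by
    have : 0 < m x := hx
    positivity
  simp only [Pi.div_apply]
  exact mul_div_mul_left _ _ hx'

end Extremes

/-! ### The von Mises condition -/

theorem tendsto_chord_slope (α : ℝ) :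
    Tendsto (fun t : ℝ => (1 - t ^ (-α)) / (t - 1)) (𝓝[≠] 1) (𝓝 α) := by
  have h1 : HasDerivAt (fun t : ℝ => t ^ (-α)) (-α * 1 ^ (-α - 1)) 1 :=
    Real.hasDerivAt_rpow_const (Or.inl one_ne_zero)
  rw [Real.one_rpow, mul_one] at h1
  have h2 := (hasDerivAt_iff_tendsto_slope.mp h1).neg
  rw [neg_neg] at h2
  refine h2.congr fun t => ?_
  rw [slope_def_field, Real.one_rpow, ← neg_div, neg_sub]

theorem sub_le_mul_of_antitoneOn {T : ℕ → ℝ} {k₀ : ℕ}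
    (hd : AntitoneOn (fun k => T k - T (k + 1)) (Set.Ici k₀)) {k m : ℕ} (hk : k₀ ≤ k)
    (hm : k₀ ≤ m) : T k - T m ≤ ((m : ℝ) - k) * (T k - T (k + 1)) := by
  rcases le_total k m with h | h
  · induction m, h using Nat.le_induction with
    | base => simp
    | succ m h ih =>
      have h1 := ih (hk.trans h)
      have h2 : T m - T (m + 1) ≤ T k - T (k + 1) := hd hk (hk.trans h) h
      push_cast
      linarith
  · revert hm
    induction h using Nat.decreasingInduction with
    | self => simp
    | of_succ m h ih =>
      intro hm
      have h1 := ih (by omega)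
      have h2 : T k - T (k + 1) ≤ T m - T (m + 1) := hd hm hk (by show m ≤ k; omega)
      push_cast at h1
      linarith

/-- The monotone density theorem: if the tail `T` is regularly varying of index `-α` and has
ultimately non-increasing increments, then `k (T k - T (k + 1)) / T k` tends to `α`. -/
theorem tendsto_mul_increment_div {T : ℕ → ℝ} {G : ℝ → ℝ} {α : ℝ} (hG : Antitone G)
    (hTpos : ∀ k, 0 < T k) (hGT : ∀ᶠ k : ℕ in atTop, G k = T k)
    {k₀ : ℕ} (hd : AntitoneOn (fun k => T k - T (k + 1)) (Set.Ici k₀))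
    (hRV : ∀ t : ℝ, 0 < t → Tendsto (fun x => G (t * x) / G x) atTop (𝓝 (t ^ (-α)))) :
    Tendsto (fun k : ℕ => k * ((T k - T (k + 1)) / T k)) atTop (𝓝 α) := by
  have hceil : ∀ t : ℝ, 0 < t → Tendsto (fun k : ℕ => ⌈t * k⌉₊) atTop atTop := fun t ht =>
    tendsto_nat_ceil_atTop.comp (tendsto_natCast_atTop_atTop.const_mul_atTop ht)
  have hceil' : ∀ t : ℝ, 0 < t →
      Tendsto (fun k : ℕ => ((⌈t * k⌉₊ : ℝ) - k) / k) atTop (𝓝 (t - 1)) := by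
    intro t ht
    have h1 : Tendsto (fun k : ℕ => t - 1 + (k : ℝ)⁻¹) atTop (𝓝 (t - 1 + 0)) :=
      tendsto_const_nhds.add tendsto_inv_atTop_nhds_zero_nat
    rw [add_zero] at h1
    refine tendsto_of_tendsto_of_tendsto_of_le_of_le' tendsto_const_nhds h1 ?_ ?_
    · filter_upwards [eventually_ge_atTop 1] with k hk
      have hk' : (0 : ℝ) < k := by exact_mod_cast hk
      rw [le_div_iff₀ hk']
      have := Nat.le_ceil (t * (k : ℝ))
      linarith
    · filter_upwards [eventually_ge_atTop 1] with k hk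
      have hk' : (0 : ℝ) < k := by exact_mod_cast hk
      rw [div_le_iff₀ hk', add_mul, inv_mul_cancel₀ hk'.ne']
      have := (Nat.ceil_lt_add_one (by positivity : 0 ≤ t * (k : ℝ))).le
      linarith
  -- the tangent-chord inequality for the (ultimately) convex sequence `T`
  have key : ∀ t : ℝ, 0 < t → ∀ᶠ k : ℕ in atTop,
      1 - G (t * k) / G k ≤ (((⌈t * k⌉₊ : ℝ) - k) / k) * (k * ((T k - T (k + 1)) / T k)) := by
    intro t ht
    filter_upwards [hGT, (hceil t ht).eventually hGT, (hceil t ht).eventually_ge_atTop k₀,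
      eventually_ge_atTop k₀, eventually_ge_atTop 1] with k h1 h2 h3 h4 h5
    have hk' : (0 : ℝ) < k := by exact_mod_cast h5
    have h6 := sub_le_mul_of_antitoneOn hd h4 h3
    have h7 : T ⌈t * k⌉₊ ≤ G (t * k) := by rw [← h2]; exact hG (Nat.le_ceil _)
    have hT := hTpos k
    have e : (((⌈t * k⌉₊ : ℝ) - k) / k) * (k * ((T k - T (k + 1)) / T k)) =
        (((⌈t * k⌉₊ : ℝ) - k) * (T k - T (k + 1))) / T k := by
      field_simp
    rw [e, h1, one_sub_div hT.ne']
    gcongr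
    linarith
  have hRVn : ∀ t : ℝ, 0 < t →
      Tendsto (fun k : ℕ => 1 - G (t * k) / G k) atTop (𝓝 (1 - t ^ (-α))) := fun t ht =>
    tendsto_const_nhds.sub ((hRV t ht).comp tendsto_natCast_atTop_atTop)
  refine tendsto_order.mpr ⟨fun b hb => ?_, fun b hb => ?_⟩
  · have h1 := (tendsto_chord_slope α).eventually (lt_mem_nhds hb)
    obtain ⟨t, h2, h3⟩ := ((h1.filter_mono (nhdsWithin_mono 1
      (show Set.Ioi (1 : ℝ) ⊆ {1}ᶜ from fun x hx => ne_of_gt hx))).and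
      (self_mem_nhdsWithin (s := Set.Ioi (1 : ℝ)) (a := 1))).exists
    have ht : 1 < t := h3
    have ht0 : 0 < t := by linarith
    have h4 := (hRVn t ht0).div (hceil' t ht0) (by linarith)
    filter_upwards [h4.eventually (lt_mem_nhds h2), key t ht0,
      (hceil' t ht0).eventually (lt_mem_nhds (show 0 < t - 1 by linarith))] with k h5 h6 h7
    refine h5.trans_le ?_
    simp only [Pi.div_apply]
    rw [div_le_iff₀ h7]
    exact h6.trans (mul_comm _ _).le
  · have h1 := (tendsto_chord_slope α).eventually (gt_mem_nhds hb)
    obtain ⟨t, ⟨h2, ht0⟩, h3⟩ :=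
      (((h1.filter_mono (nhdsWithin_mono 1
      (show Set.Iio (1 : ℝ) ⊆ {1}ᶜ from fun x hx => ne_of_lt hx))).and
      ((lt_mem_nhds (zero_lt_one' ℝ)).filter_mono nhdsWithin_le_nhds)).and
      (self_mem_nhdsWithin (s := Set.Iio (1 : ℝ)) (a := 1))).exists
    have ht : t < 1 := h3
    have h4 := (hRVn t ht0).div (hceil' t ht0) (by linarith)
    filter_upwards [h4.eventually (gt_mem_nhds h2), key t ht0,
      (hceil' t ht0).eventually (gt_mem_nhds (show t - 1 < 0 by linarith))] with k h5 h6 h7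
    refine lt_of_le_of_lt ?_ h5
    simp only [Pi.div_apply]
    rw [le_div_iff_of_neg h7]
    exact h6.trans (mul_comm _ _).le

theorem tendsto_mul_log_decrement {T : ℕ → ℝ} {α : ℝ} (hTpos : ∀ k, 0 < T k)
    (hanti : Antitone T)
    (h : Tendsto (fun k : ℕ => k * ((T k - T (k + 1)) / T k)) atTop (𝓝 α)) :
    Tendsto (fun k : ℕ => ((k : ℝ) + 1) * (Real.log (T k) - Real.log (T (k + 1)))) atTop
      (𝓝 α) := by
  set q : ℕ → ℝ := fun k => (T k - T (k + 1)) / T k with hq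
  have hq1 : ∀ k, 1 - q k = T (k + 1) / T k := fun k => by
    simp only [hq]
    have := (hTpos k).ne'
    field_simp
    ring
  have hq0 : ∀ k, 0 ≤ q k := fun k =>
    div_nonneg (sub_nonneg.mpr (hanti (Nat.le_succ k))) (hTpos k).le
  have hqlim : Tendsto q atTop (𝓝 0) := by
    have h1 := h.mul tendsto_inv_atTop_nhds_zero_nat
    rw [mul_zero] at h1
    refine h1.congr' ?_
    filter_upwards [eventually_ge_atTop 1] with k hk
    have hk' : (k : ℝ) ≠ 0 := by positivity
    rw [mul_right_comm, mul_inv_cancel₀ hk', one_mul]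
  have h1 : Tendsto (fun k : ℕ => ((k : ℝ) + 1) * q k) atTop (𝓝 α) := by
    have := h.add hqlim
    rw [add_zero] at this
    exact this.congr fun k => by ring
  have h2 : Tendsto (fun k : ℕ => ((k : ℝ) + 1) * q k / (1 - q k)) atTop (𝓝 α) := by
    have h3 : Tendsto (fun k => 1 - q k) atTop (𝓝 (1 - 0)) := tendsto_const_nhds.sub hqlim
    rw [sub_zero] at h3
    have := h1.div h3 one_ne_zero
    rwa [div_one] at this
  refine tendsto_of_tendsto_of_tendsto_of_le_of_le h1 h2 (fun k => ?_) (fun k => ?_)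
  · have h3 := Real.log_le_sub_one_of_pos (div_pos (hTpos (k + 1)) (hTpos k))
    rw [Real.log_div (hTpos _).ne' (hTpos _).ne', ← hq1] at h3
    exact mul_le_mul_of_nonneg_left (by linarith) (by positivity)
  · have h3 := Real.log_le_sub_one_of_pos (div_pos (hTpos k) (hTpos (k + 1)))
    rw [Real.log_div (hTpos _).ne' (hTpos _).ne'] at h3
    simp only
    rw [mul_div_assoc]
    refine mul_le_mul_of_nonneg_left (h3.trans (le_of_eq ?_)) (by positivity)
    rw [hq1]
    have h4 := (hTpos k).ne'
    have h5 := (hTpos (k + 1)).ne'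
    simp only [hq]
    field_simp

/-! ### Tails of Fréchet envelopes -/

theorem summable_tail {f : ℕ+ → ℝ} (hf : IsEnvelope f) (k : ℕ) :
    Summable fun j : ℕ+ => if k < (j : ℕ) then f j else 0 := by
  refine Summable.of_nonneg_of_le (fun j => ?_) (fun j => ?_) hf.summable
  · have := (hf.pos j).le
    split_ifs <;> simp [this]
  · have := (hf.pos j).le
    split_ifs <;> simp [this]

theorem tailSum_sub_tailSum {f : ℕ+ → ℝ} (hf : IsEnvelope f) (k : ℕ) :
    tailSum f k - tailSum f (k + 1) = f k.succPNat := by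
  unfold tailSum
  rw [← (summable_tail hf k).tsum_sub (summable_tail hf (k + 1)),
    tsum_eq_single k.succPNat]
  · simp
  · intro j hj
    have hj' : (j : ℕ) ≠ k + 1 := fun h => hj (PNat.coe_injective (by simpa using h))
    by_cases h : k < (j : ℕ)
    · rw [if_pos h, if_pos (by omega), sub_self]
    · rw [if_neg h, if_neg (by omega), sub_self]

theorem tailSum_pos {f : ℕ+ → ℝ} (hf : IsEnvelope f) (k : ℕ) : 0 < tailSum f k := by
  refine (summable_tail hf k).tsum_pos (fun j => ?_) k.succPNat ?_
  · have := (hf.pos j).le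
    split_ifs <;> simp [this]
  · simpa using hf.pos k.succPNat

theorem tailSum_antitone {f : ℕ+ → ℝ} (hf : IsEnvelope f) : Antitone (tailSum f) :=
  antitone_nat_of_succ_le fun k => by
    have := tailSum_sub_tailSum hf k
    have := hf.pos k.succPNat
    linarith

theorem tendsto_tailSum {f : ℕ+ → ℝ} (hf : IsEnvelope f) : Tendsto (tailSum f) atTop (𝓝 0) := by
  have h := tendsto_tsum_of_dominated_convergence (𝓕 := atTop)
    (f := fun (k : ℕ) (j : ℕ+) => if k < (j : ℕ) then f j else 0) (g := fun _ => 0)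
    hf.summable (fun j => ?_) (Eventually.of_forall fun k j => ?_)
  · rw [tsum_zero] at h
    exact h
  · refine tendsto_const_nhds.congr' ?_
    filter_upwards [eventually_ge_atTop (j : ℕ)] with k hk
    rw [if_neg (by omega)]
  · have := (hf.pos j).le
    split_ifs <;> simp [this, abs_of_nonneg]

theorem gev_of_pos {γ x : ℝ} (hγ : 0 < γ) :
    gev γ x = Real.exp (-(1 + γ * x) ^ (-(1 / γ))) := by
  rw [gev, if_neg hγ.ne', neg_div]

/-- For a Fréchet envelope with ultimately non-increasing `f`, the von Mises condition holds. -/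
theorem IsFrechetEnvelope.exists_tendsto {f : ℕ+ → ℝ} (hf : IsEnvelope f)
    (hmono : UltimatelyNonincreasing f) (hfr : IsFrechetEnvelope f) :
    ∃ α : ℝ, 0 < α ∧
      Tendsto (fun k : ℕ => k * ((tailSum f k - tailSum f (k + 1)) / tailSum f k)) atTop
        (𝓝 α) := by
  obtain ⟨γ, hγ, F, hF, A, hA, hlim⟩ := hfr
  obtain ⟨j₀, hj₀⟩ := hmono
  refine ⟨1 / γ, by positivity, ?_⟩
  have hTpos := tailSum_pos hf
  have hFT : ∀ᶠ k : ℕ in atTop, 1 - F k = tailSum f k := by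
    filter_upwards [(tendsto_tailSum hf).eventually (gt_mem_nhds zero_lt_one)] with k hk
    rw [hF.coincide, envelopeCDF, if_pos hk, sub_sub_cancel]
  have hGanti : Antitone fun x => 1 - F x := fun x y h => sub_le_sub_left (hF.monotone h) 1
  have hGpos : ∀ x, 0 < 1 - F x := by
    intro x
    obtain ⟨k, hk, hk'⟩ := (hFT.and (tendsto_natCast_atTop_atTop.eventually_ge_atTop x)).exists
    have h1 := hGanti hk'
    simp only at h1
    have := hTpos k
    linarith
  have hF0 : ∀ x, 0 ≤ F x := by
    intro x
    rcases lt_or_ge x 0 with h | h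
    · exact (hF.eq_zero x h).ge
    · exact (hF.eq_zero (-1) (by norm_num)).ge.trans (hF.monotone (by linarith))
  have hG0 : Tendsto (fun x => 1 - F x) atTop (𝓝 0) := by
    refine tendsto_order.mpr ⟨fun b hb => Eventually.of_forall fun x => hb.trans (hGpos x),
      fun b hb => ?_⟩
    obtain ⟨k, hk, hk'⟩ := (hFT.and ((tendsto_tailSum hf).eventually (gt_mem_nhds hb))).exists
    filter_upwards [eventually_ge_atTop (k : ℝ)] with x hx
    have h1 := hGanti hx
    simp only at h1
    linarith
  refine tendsto_mul_increment_div (G := fun x => 1 - F x) (k₀ := (j₀ : ℕ)) hGanti hTpos hFT ?_ ?_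
  · intro a ha b hb hab
    simp only [tailSum_sub_tailSum hf]
    refine hj₀ ?_ ?_ ?_
    · rw [Set.mem_Ici, ← PNat.coe_le_coe, Nat.succPNat_coe]
      exact Nat.le_succ_of_le ha
    · rw [Set.mem_Ici, ← PNat.coe_le_coe, Nat.succPNat_coe]
      exact Nat.le_succ_of_le hb
    · rw [← PNat.coe_le_coe, Nat.succPNat_coe, Nat.succPNat_coe]
      exact Nat.succ_le_succ hab
  · intro t ht
    refine tendsto_tail_ratio (a := fun n => A n / γ) (u := fun n : ℕ => tailQuantile F n)
      hGanti hGpos hG0 (fun n => div_pos (hA n) hγ) (by positivity) (fun y hy => ?_) ht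
    have h1 := hlim ((y - 1) / γ) (by rw [mul_div_cancel₀ _ hγ.ne']; linarith)
    rw [gev_of_pos hγ, mul_div_cancel₀ _ hγ.ne', add_sub_cancel] at h1
    have h2 := tendsto_mul_one_sub_of_tendsto_pow (fun n => hF0 _) h1
    refine h2.congr fun n => ?_
    rw [show A n * ((y - 1) / γ) = A n / γ * (y - 1) by ring]

/-! ### The discrete threshold of the envelope -/

/-- The discrete threshold of a tail `T`: the least `k` with `n T(k) ≤ k`. -/
def level (T : ℕ → ℝ) (n : ℕ) : ℕ := sInf {k : ℕ | n * T k ≤ k}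

section Level

variable {T : ℕ → ℝ} {α : ℝ}

theorem lt_level_iff (hanti : Antitone T) (k n : ℕ) : k < level T n ↔ (k : ℝ) < n * T k := by
  have hne : {k : ℕ | n * T k ≤ k}.Nonempty := by
    obtain ⟨k, hk⟩ := exists_nat_ge ((n : ℝ) * T 0)
    exact ⟨k, (mul_le_mul_of_nonneg_left (hanti (Nat.zero_le k)) (Nat.cast_nonneg n)).trans hk⟩
  constructor
  · intro h
    by_contra hc
    exact absurd (Nat.sInf_le (show k ∈ {k : ℕ | n * T k ≤ k} from not_lt.mp hc)) (not_le.mpr h)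
  · intro h
    by_contra hc
    push Not at hc
    have h1 : n * T (level T n) ≤ level T n := Nat.sInf_mem hne
    have h2 := mul_le_mul_of_nonneg_left (hanti hc) (Nat.cast_nonneg (α := ℝ) n)
    have h3 : (level T n : ℝ) ≤ k := by exact_mod_cast hc
    linarith

theorem mul_tail_level_le (hanti : Antitone T) (n : ℕ) : n * T (level T n) ≤ level T n :=
  not_lt.mp fun h => lt_irrefl _ ((lt_level_iff hanti _ _).mpr h)

theorem level_mono (hanti : Antitone T) (hpos : ∀ k, 0 < T k) : Monotone (level T) := by
  intro m n hmn
  by_contra h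
  push Not at h
  rw [lt_level_iff hanti] at h
  have h1 : (m : ℝ) * T (level T n) ≤ n * T (level T n) :=
    mul_le_mul_of_nonneg_right (by exact_mod_cast hmn) (hpos _).le
  have := mul_tail_level_le hanti n
  linarith

theorem tendsto_level (hanti : Antitone T) (hpos : ∀ k, 0 < T k) :
    Tendsto (level T) atTop atTop := by
  refine tendsto_atTop.mpr fun k => ?_
  obtain ⟨n, hn⟩ := exists_nat_gt ((k : ℝ) / T k)
  filter_upwards [eventually_ge_atTop n] with m hm
  refine ((lt_level_iff hanti k m).mpr ?_).le
  rw [div_lt_iff₀ (hpos k)] at hn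
  exact hn.trans_le (mul_le_mul_of_nonneg_right (by exact_mod_cast hm) (hpos k).le)

theorem eventually_level_le (hanti : Antitone T) (hlim : Tendsto T atTop (𝓝 0)) :
    ∀ᶠ n in atTop, level T n ≤ n := by
  filter_upwards [hlim.eventually (gt_mem_nhds zero_lt_one)] with n hn
  by_contra h
  push Not at h
  rw [lt_level_iff hanti] at h
  have := mul_le_mul_of_nonneg_left hn.le (Nat.cast_nonneg (α := ℝ) n)
  linarith

/-- The logarithmic decrements of the tail. -/
def logDecrement (T : ℕ → ℝ) (k : ℕ) : ℝ := Real.log (T k) - Real.log (T (k + 1))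

theorem exists_tail_two_mul_le (hpos : ∀ k, 0 < T k) (hα : 0 < α)
    (hu : Tendsto (fun k : ℕ => ((k : ℝ) + 1) * logDecrement T k) atTop (𝓝 α)) :
    ∃ θ : ℝ, 0 < θ ∧ θ < 1 ∧ ∀ᶠ k in atTop, T (2 * k) ≤ θ * T k := by
  refine ⟨Real.exp (-(α / 4)), Real.exp_pos _, by rw [Real.exp_lt_one_iff]; linarith, ?_⟩
  obtain ⟨k₀, hk₀⟩ := eventually_atTop.mp (hu.eventually (lt_mem_nhds (half_lt_self hα)))
  filter_upwards [eventually_ge_atTop k₀, eventually_ge_atTop 1] with k hk hk1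
  have hk' : (0 : ℝ) < k := by exact_mod_cast hk1
  have h1 : ∀ j, j ≤ k → Real.log (T (k + j)) ≤ Real.log (T k) - j * (α / (4 * k)) := by
    intro j
    induction j with
    | zero => simp
    | succ j ih =>
      intro hj
      have h2 := ih (by omega)
      have h3 := hk₀ (k + j) (by omega)
      have h4 : α / (4 * k) ≤ logDecrement T (k + j) := by
        rw [div_le_iff₀ (by positivity)]
        push_cast at h3
        have h5 : (j : ℝ) + 1 ≤ k := by exact_mod_cast hj
        have h6 : 0 ≤ logDecrement T (k + j) := by
          by_contra hc
          push Not at hc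
          have : ((k : ℝ) + j + 1) * logDecrement T (k + j) < 0 :=
            mul_neg_of_pos_of_neg (by positivity) hc
          linarith
        nlinarith
      unfold logDecrement at h4
      rw [← add_assoc]
      push_cast
      linarith
  have h2 := h1 k le_rfl
  have h3 : (k : ℝ) * (α / (4 * k)) = α / 4 := by field_simp
  rw [h3, ← two_mul] at h2
  have h4 := Real.exp_le_exp.mpr h2
  rwa [Real.exp_log (hpos _), sub_eq_neg_add, Real.exp_add, Real.exp_log (hpos _)] at h4

theorem tsum_tail_dyadic_le (hpos : ∀ k, 0 < T k) {θ : ℝ} (hθ0 : 0 < θ) (hθ1 : θ < 1) {k₀ : ℕ}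
    (h : ∀ k, k₀ ≤ k → T (2 * k) ≤ θ * T k) {k : ℕ} (hk : k₀ ≤ k) :
    ∑' r : ℕ, ENNReal.ofReal (T (2 ^ r * k)) ≤ ENNReal.ofReal (T k / (1 - θ)) := by
  have h1 : ∀ r : ℕ, T (2 ^ r * k) ≤ θ ^ r * T k := by
    intro r
    induction r with
    | zero => simp
    | succ r ih =>
      rw [pow_succ', mul_assoc]
      refine (h (2 ^ r * k) (hk.trans (Nat.le_mul_of_pos_left k (by positivity)))).trans ?_
      rw [pow_succ', mul_assoc]
      exact mul_le_mul_of_nonneg_left ih hθ0.le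
  refine (ENNReal.tsum_le_tsum fun r => ENNReal.ofReal_le_ofReal (h1 r)).trans ?_
  rw [← ENNReal.ofReal_tsum_of_nonneg
    (fun r => mul_nonneg (pow_nonneg hθ0.le r) (hpos k).le)
    ((summable_geometric_of_lt_one hθ0.le hθ1).mul_right _), tsum_mul_right,
    tsum_geometric_of_lt_one hθ0.le hθ1, inv_mul_eq_div]

/-- The discrete threshold has growth exponent at most `1 / (1 + α)`. -/
theorem eventually_log_level_le (hpos : ∀ k, 0 < T k) (hanti : Antitone T)
    (hlim : Tendsto T atTop (𝓝 0))
    (hu : Tendsto (fun k : ℕ => ((k : ℝ) + 1) * logDecrement T k) atTop (𝓝 α))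
    {ε : ℝ} (hε : 0 < ε) (hεα : ε < α) :
    ∀ᶠ n : ℕ in atTop, (1 + α) * Real.log (level T n) ≤ (1 + ε) * Real.log n := by
  have hε2 : α - ε / 2 < α := by linarith
  obtain ⟨k₀, hk₀⟩ := eventually_atTop.mp (hu.eventually (lt_mem_nhds hε2))
  have h1 : ∀ k, k₀ ≤ k → Real.log (T k) + (α - ε / 2) * Real.log (k + 1) ≤
      Real.log (T k₀) + (α - ε / 2) * Real.log (k₀ + 1) := by
    intro k hk
    induction k, hk using Nat.le_induction with
    | base => exact le_rfl
    | succ k hk ih =>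
      refine le_trans ?_ ih
      have h2 := hk₀ k hk
      have h3 : Real.log (((k + 1 : ℕ) : ℝ) + 1) - Real.log ((k : ℝ) + 1) ≤ 1 / ((k : ℝ) + 1) := by
        have h4 := Real.log_le_sub_one_of_pos (x := (((k + 1 : ℕ) : ℝ) + 1) / ((k : ℝ) + 1))
          (by positivity)
        rw [Real.log_div (by positivity) (by positivity)] at h4
        refine h4.trans (le_of_eq ?_)
        push_cast
        field_simp
        ring
      have h4 : (α - ε / 2) * (1 / ((k : ℝ) + 1)) ≤ logDecrement T k := by
        rw [mul_one_div, div_le_iff₀ (by positivity)]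
        linarith
      have h5 := mul_le_mul_of_nonneg_left h3 (show 0 ≤ α - ε / 2 by linarith)
      unfold logDecrement at h4
      linarith
  set C := Real.log (T k₀) + (α - ε / 2) * Real.log (k₀ + 1) with hC
  have hlogn : Tendsto (fun n : ℕ => Real.log n) atTop atTop :=
    Real.tendsto_log_atTop.comp tendsto_natCast_atTop_atTop
  filter_upwards [(tendsto_level hanti hpos).eventually_ge_atTop (k₀ + 2),
    eventually_level_le hanti hlim, hlogn.eventually_ge_atTop ((C + Real.log 2) / (ε / 2)),
    eventually_ge_atTop 1] with n h2 h3 h4 h5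
  have hn : (0 : ℝ) < n := by exact_mod_cast h5
  obtain ⟨k, hk⟩ : ∃ k, level T n = k + 1 := ⟨level T n - 1, by omega⟩
  have h6 := (lt_level_iff hanti k n).mp (by omega)
  have h7 := h1 k (by omega)
  have hk1 : (1 : ℝ) ≤ k := by exact_mod_cast (show 1 ≤ k by omega)
  have h8 := Real.log_le_log (by linarith) h6.le
  rw [Real.log_mul hn.ne' (hpos k).ne'] at h8
  have h9 : Real.log ((k : ℝ) + 1) ≤ Real.log 2 + Real.log k := by
    rw [← Real.log_mul two_ne_zero (by positivity)]
    exact Real.log_le_log (by positivity) (by linarith)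
  rw [hk] at h3 ⊢
  have h10 : Real.log ((k : ℝ) + 1) ≤ Real.log n :=
    Real.log_le_log (by positivity) (by exact_mod_cast h3)
  have h11 := mul_le_mul_of_nonneg_left h10 hε.le
  rw [div_le_iff₀ (by positivity)] at h4
  push_cast
  linarith

theorem sum_inv_filter_le {z : ℝ} (hz : 0 < z) (n : ℕ) :
    ∑ i ∈ Finset.range n, (if z < (i : ℝ) + 1 then 1 / ((i : ℝ) + 1) else 0) ≤
      if z < n then 1 / z + Real.log (n / z) else 0 := by
  induction n with
  | zero => simp [not_lt.mpr hz.le]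
  | succ n ih =>
    rw [Finset.sum_range_succ]
    push_cast
    by_cases h1 : z < n
    · rw [if_pos h1] at ih
      have h2 : z < (n : ℝ) + 1 := by linarith
      rw [if_pos h2, if_pos h2]
      have hn : (0 : ℝ) < n := hz.trans h1
      have h3 := Real.one_sub_inv_le_log_of_pos (x := ((n : ℝ) + 1) / n) (by positivity)
      rw [Real.log_div (by positivity) hn.ne'] at h3
      rw [Real.log_div hn.ne' hz.ne'] at ih
      rw [Real.log_div (by positivity) hz.ne']
      have h4 : 1 - (((n : ℝ) + 1) / n)⁻¹ = 1 / ((n : ℝ) + 1) := by field_simp; ring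
      linarith
    · rw [if_neg h1] at ih
      by_cases h2 : z < (n : ℝ) + 1
      · rw [if_pos h2, if_pos h2]
        have h3 : 1 / ((n : ℝ) + 1) ≤ 1 / z := one_div_le_one_div_of_le hz h2.le
        have h4 : 0 ≤ Real.log (((n : ℝ) + 1) / z) :=
          Real.log_nonneg (by rw [le_div_iff₀ hz]; linarith)
        linarith
      · rw [if_neg h2, if_neg h2]
        linarith

theorem sum_log_tail_sub (K : ℕ) :
    ∑ k ∈ Finset.range K, (Real.log (T k) - Real.log (T K)) =
      ∑ j ∈ Finset.range K, ((j : ℝ) + 1) * logDecrement T j := by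
  induction K with
  | zero => simp
  | succ K ih =>
    rw [Finset.sum_range_succ _ K, Finset.sum_range_succ _ K, ← ih]
    simp only [Finset.sum_sub_distrib, Finset.sum_const, Finset.card_range, nsmul_eq_mul,
      logDecrement]
    ring

theorem sum_log_sub_log_le (K : ℕ) :
    ∑ k ∈ Finset.range K, (Real.log K - Real.log (k + 1)) ≤ K := by
  have h1 : ∑ k ∈ Finset.range K, Real.log ((k : ℝ) + 1) = Real.log K.factorial := by
    rw [← Finset.prod_range_add_one_eq_factorial]
    push_cast
    rw [Real.log_prod (by intro t _; positivity)]
  rw [Finset.sum_sub_distrib, h1, Finset.sum_const, Finset.card_range, nsmul_eq_mul]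
  rcases Nat.eq_zero_or_pos K with rfl | hK
  · simp
  have hK' : (0 : ℝ) < K := by exact_mod_cast hK
  have h2 := Real.pow_div_factorial_le_exp (K : ℝ) hK'.le K
  have h3 := Real.log_le_log (by positivity) h2
  rwa [Real.log_exp, Real.log_div (by positivity) (by positivity), Real.log_pow] at h3

theorem sum_one_div_le (n : ℕ) :
    ∑ i ∈ Finset.range n, 1 / ((i : ℝ) + 1) ≤ 1 + Real.log n := by
  have h := harmonic_le_one_add_log n
  unfold harmonic at h
  push_cast at h
  simpa [one_div] using h

/-- The average of `K_i / i`, with `K_i` the discrete threshold, is controlled by the threshold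
itself: this rests on counting, for each `k`, the indices `i` with `k < K_i`. -/
theorem sum_level_div_le (hpos : ∀ k, 0 < T k) (hanti : Antitone T) {n : ℕ} (hn : 1 ≤ n)
    (hK1 : 1 ≤ level T n) (hKn : level T n ≤ n) :
    ∑ i ∈ Finset.range n, (level T (i + 1) : ℝ) / (i + 1) ≤
      level T n + ∑ j ∈ Finset.range (level T n), ((j : ℝ) + 1) * logDecrement T j +
        (1 + T 0) * (1 + Real.log n) := by
  set K := level T n with hK
  have hn' : (0 : ℝ) < n := by exact_mod_cast hn
  have hK0 : (0 : ℝ) < K := by exact_mod_cast hK1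
  -- exchange of the sums over `i` and over `k < K_i`
  have h1 : ∑ i ∈ Finset.range n, (level T (i + 1) : ℝ) / (i + 1) =
      ∑ k ∈ Finset.range K, ∑ i ∈ Finset.range n,
        (if (k : ℝ) / T k < (i : ℝ) + 1 then 1 / ((i : ℝ) + 1) else 0) := by
    rw [Finset.sum_comm]
    refine Finset.sum_congr rfl fun i hi => ?_
    have hi' : i + 1 ≤ n := Finset.mem_range.mp hi
    have h2 : level T (i + 1) ≤ K := level_mono hanti hpos hi'
    have h3 : (Finset.range K).filter (fun k : ℕ => (k : ℝ) / T k < (i : ℝ) + 1) =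
        Finset.range (level T (i + 1)) := by
      ext k
      simp only [Finset.mem_filter, Finset.mem_range, div_lt_iff₀ (hpos k)]
      rw [lt_level_iff hanti k (i + 1)]
      push_cast
      refine ⟨fun h => h.2, fun h => ⟨?_, h⟩⟩
      refine lt_of_lt_of_le ((lt_level_iff hanti k (i + 1)).mpr ?_) h2
      push_cast
      exact h
    rw [← Finset.sum_filter, h3, Finset.sum_const, Finset.card_range, nsmul_eq_mul, mul_one_div]
  rw [h1]
  obtain ⟨L, hL⟩ : ∃ L, K = L + 1 := ⟨K - 1, by omega⟩
  have hterm : ∀ k ∈ Finset.range L, ∑ i ∈ Finset.range n,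
      (if ((k + 1 : ℕ) : ℝ) / T (k + 1) < (i : ℝ) + 1 then 1 / ((i : ℝ) + 1) else 0) ≤
      T 0 * (1 / ((k : ℝ) + 1)) + (Real.log (T (k + 1)) - Real.log (T K)) +
        (Real.log K - Real.log ((k : ℝ) + 1)) := by
    intro k hk
    have hkL : k < L := Finset.mem_range.mp hk
    have hTk := hpos (k + 1)
    have h2 := (lt_level_iff hanti (k + 1) n).mp (by omega)
    have hz : 0 < ((k + 1 : ℕ) : ℝ) / T (k + 1) := by positivity
    have h3 := sum_inv_filter_le hz n
    rw [if_pos (by rwa [div_lt_iff₀ hTk])] at h3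
    have h4 : Real.log n + Real.log (T K) ≤ Real.log K := by
      rw [← Real.log_mul hn'.ne' (hpos K).ne']
      exact Real.log_le_log (mul_pos hn' (hpos K)) (mul_tail_level_le hanti n)
    have h5 : Real.log (n / (((k + 1 : ℕ) : ℝ) / T (k + 1))) =
        Real.log n - (Real.log ((k : ℝ) + 1) - Real.log (T (k + 1))) := by
      rw [Real.log_div hn'.ne' hz.ne', Real.log_div (by positivity) hTk.ne']
      push_cast
      rfl
    have h6 : 1 / (((k + 1 : ℕ) : ℝ) / T (k + 1)) ≤ T 0 * (1 / ((k : ℝ) + 1)) := by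
      rw [one_div_div, mul_one_div]
      push_cast
      gcongr
      exact hanti (Nat.zero_le _)
    linarith
  have hzero : ∑ i ∈ Finset.range n,
      (if ((0 : ℕ) : ℝ) / T 0 < (i : ℝ) + 1 then 1 / ((i : ℝ) + 1) else 0) ≤ 1 + Real.log n := by
    refine le_trans (le_of_eq (Finset.sum_congr rfl fun i _ => ?_)) (sum_one_div_le n)
    rw [if_pos (by rw [CharP.cast_eq_zero, zero_div]; positivity)]
  have h2 := Finset.sum_le_sum hterm
  rw [Finset.sum_add_distrib, Finset.sum_add_distrib, ← Finset.mul_sum] at h2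
  have h3 : ∑ k ∈ Finset.range L, (Real.log (T (k + 1)) - Real.log (T K)) ≤
      ∑ j ∈ Finset.range K, ((j : ℝ) + 1) * logDecrement T j := by
    rw [← sum_log_tail_sub, hL, Finset.sum_range_succ' _ L]
    have := Real.log_le_log (hpos (L + 1)) (hanti (Nat.zero_le (L + 1)))
    linarith
  have h4 : ∑ k ∈ Finset.range L, (Real.log K - Real.log ((k : ℝ) + 1)) ≤ K := by
    refine le_trans ?_ (sum_log_sub_log_le K)
    refine Finset.sum_le_sum_of_subset_of_nonneg (Finset.range_mono (by omega)) ?_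
    intro k hk _
    have hk' : (k : ℝ) + 1 ≤ K := by exact_mod_cast Finset.mem_range.mp hk
    exact sub_nonneg.mpr (Real.log_le_log (by positivity) hk')
  have h5 : T 0 * ∑ k ∈ Finset.range L, 1 / ((k : ℝ) + 1) ≤ T 0 * (1 + Real.log n) := by
    refine mul_le_mul_of_nonneg_left (le_trans ?_ (sum_one_div_le n)) (hpos 0).le
    exact Finset.sum_le_sum_of_subset_of_nonneg (Finset.range_mono (by omega))
      fun k _ _ => by positivity
  rw [hL, Finset.sum_range_succ' _ L, ← hL]
  linarith

theorem eventually_sum_level_div_le (hpos : ∀ k, 0 < T k) (hanti : Antitone T)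
    (hlim : Tendsto T atTop (𝓝 0))
    (hu : Tendsto (fun k : ℕ => ((k : ℝ) + 1) * logDecrement T k) atTop (𝓝 α))
    {ε : ℝ} (hε : 0 < ε) :
    ∀ᶠ n : ℕ in atTop, ∑ i ∈ Finset.range n, (level T (i + 1) : ℝ) / (i + 1) ≤
      (1 + α + ε) * level T n + (1 + T 0) * (1 + Real.log n) := by
  have hK := tendsto_level hanti hpos
  filter_upwards [(hu.cesaro.comp hK).eventually (gt_mem_nhds (show α < α + ε by linarith)),
    hK.eventually_ge_atTop 1, eventually_level_le hanti hlim, eventually_ge_atTop 1]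
    with n h1 h2 h3 h4
  have hK0 : (0 : ℝ) < level T n := by exact_mod_cast h2
  refine (sum_level_div_le hpos hanti h4 h2 h3).trans ?_
  simp only [Function.comp_apply] at h1
  rw [inv_mul_lt_iff₀ hK0] at h1
  linarith

theorem eventually_increment_level_ge (hpos : ∀ k, 0 < T k) (hanti : Antitone T) (hα : 0 < α)
    (hvm : Tendsto (fun k : ℕ => k * ((T k - T (k + 1)) / T k)) atTop (𝓝 α))
    (hu : Tendsto (fun k : ℕ => ((k : ℝ) + 1) * logDecrement T k) atTop (𝓝 α)) :
    ∀ᶠ n : ℕ in atTop, α / 8 ≤ n * (T (level T n) - T (level T n + 1)) := by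
  have hu0 : Tendsto (logDecrement T) atTop (𝓝 0) := by
    have h1 := hu.mul (tendsto_one_div_add_atTop_nhds_zero_nat (𝕜 := ℝ))
    rw [mul_zero] at h1
    refine h1.congr fun k => ?_
    field_simp
  have h1 : ∀ᶠ k in atTop, T k ≤ 2 * T (k + 1) := by
    filter_upwards [hu0.eventually (gt_mem_nhds (Real.log_pos one_lt_two))] with k hk
    unfold logDecrement at hk
    rw [← Real.log_le_log_iff (hpos k) (by have := hpos (k + 1); positivity),
      Real.log_mul two_ne_zero (hpos _).ne']
    linarith
  have h2 := hvm.eventually (lt_mem_nhds (half_lt_self hα))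
  have hK := tendsto_level hanti hpos
  obtain ⟨k₁, hk₁⟩ := eventually_atTop.mp h1
  filter_upwards [hK.eventually h2, hK.eventually_ge_atTop (k₁ + 2)] with n h3 h4
  obtain ⟨k, hk⟩ : ∃ k, level T n = k + 1 := ⟨level T n - 1, by omega⟩
  have h5 := (lt_level_iff hanti k n).mp (by omega)
  have h6 := hk₁ k (by omega)
  rw [hk] at h3 ⊢
  have hk1 : (1 : ℝ) ≤ k := by exact_mod_cast (show 1 ≤ k by omega)
  set d := T (k + 1) - T (k + 1 + 1) with hd
  have hT := hpos (k + 1)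
  push_cast at h3
  rw [mul_div_assoc', lt_div_iff₀ hT] at h3
  have hn : (0 : ℝ) ≤ n := Nat.cast_nonneg n
  have h7 : (k : ℝ) < 2 * (n * T (k + 1)) := by
    have := mul_le_mul_of_nonneg_left h6 hn
    linarith
  have h8 := mul_le_mul_of_nonneg_left h3.le hn
  have h9 : α / 4 * k ≤ ((k : ℝ) + 1) * (n * d) := by nlinarith
  have h10 : ((k : ℝ) + 1) * (α / 8) ≤ α / 4 * k := by nlinarith
  exact le_of_mul_le_mul_left (h10.trans h9) (by positivity)

end Level

/-! ### Asymptotics of the upper bound -/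

theorem redundancyBound_eq (n : ℕ) (K : ℕ → ℕ) (η c C V : ℝ) :
    redundancyBound n K η c C V =
      ((1 + η) / 2 + 2) * ∑ i ∈ Finset.range n, (K (i + 1) : ℝ) / (i + 1) +
      (((1 + 1 / (4 * η)) + 1) / 2 + 1) * ∑ i ∈ Finset.range n, 1 / ((i : ℝ) + 1) +
      ((1 + η) * K n + (1 + 1 / (4 * η))) * (Real.log 2 + Real.log n / 2) +
      ((1 + η) * ∑ i ∈ Finset.range n, (K (i + 1) : ℝ) / (i + 1) +
        (1 + 1 / (4 * η)) * ∑ i ∈ Finset.range n, 1 / ((i : ℝ) + 1)) *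
        (Real.log (K n + 2) + (Real.log 2 + c * Real.log (K n) + C)) + c * V + 3 := by
  unfold redundancyBound
  have h1 : ∀ i : ℕ, (((1 + η) * (K (i + 1) : ℝ) + (1 + 1 / (4 * η))) + 1) / (2 * ((i : ℝ) + 1)) =
      (1 + η) / 2 * ((K (i + 1) : ℝ) / (i + 1)) +
        ((1 + 1 / (4 * η)) + 1) / 2 * (1 / ((i : ℝ) + 1)) := by
    intro i
    generalize 1 + 1 / (4 * η) = c'
    field_simp
    ring
  set b := Real.log (K n + 2) + (Real.log 2 + c * Real.log (K n) + C)
  have h2 : ∀ i : ℕ, (((1 + η) * (K (i + 1) : ℝ) + (1 + 1 / (4 * η))) * b + 1 + 2 * K (i + 1)) /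
      ((i : ℝ) + 1) = ((1 + η) * b + 2) * ((K (i + 1) : ℝ) / (i + 1)) +
        ((1 + 1 / (4 * η)) * b + 1) * (1 / ((i : ℝ) + 1)) := by
    intro i
    generalize 1 + 1 / (4 * η) = c'
    field_simp
    ring
  simp only [h1, h2, Finset.sum_add_distrib, ← Finset.mul_sum]
  ring

/-- The main term and the negligible terms of the redundancy bound. -/
theorem redundancy_terms_le {η A B C c₀ V κ l lk S H b a : ℝ} (hη : 0 ≤ η)
    (hC : 0 ≤ C) (hc₀ : 0 ≤ c₀) (hκ : 0 ≤ κ) (hl : 0 ≤ l) (hlk : 0 ≤ lk)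
    (hS0 : 0 ≤ S) (hH0 : 0 ≤ H) (hS : S ≤ A * κ + B * l) (hH : H ≤ 2 * l)
    (hb : b ≤ C + (2 + η) * lk) (hη1 : η ≤ 1) (hAlk : A * lk ≤ (1 + η) ^ 2 * l) (hB : 0 ≤ B)
    (ha : a ≤ 1) :
    ((1 + η) / 2 + 2) * S + ((c₀ + 1) / 2 + 1) * H + ((1 + η) * κ + c₀) * (a + l / 2) +
      ((1 + η) * S + c₀ * H) * b + (1 + η) * (V * κ) + 3 ≤
    ((1 + η) / 2 + (1 + η) ^ 3 * (2 + η)) * (κ * l) +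
      (((1 + η) / 2 + 2) * A + (1 + η) + (1 + η) * V + (1 + η) * A * C) * κ +
      (((1 + η) / 2 + 2) * B + 2 * ((c₀ + 1) / 2 + 1) + c₀ + ((1 + η) * B + 2 * c₀) * C) * l +
      (c₀ + 3) + ((1 + η) * B + 2 * c₀) * 3 * (l * lk) := by
  have hb0 : 0 ≤ C + (2 + η) * lk := by positivity
  have h1 : ((1 + η) * S + c₀ * H) * b ≤
      ((1 + η) * (A * κ + B * l) + c₀ * (2 * l)) * (C + (2 + η) * lk) :=
    (mul_le_mul_of_nonneg_left hb (by positivity)).trans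
      (mul_le_mul_of_nonneg_right (by gcongr) hb0)
  have h2 : (1 + η) * (2 + η) * κ * (A * lk) ≤ (1 + η) * (2 + η) * κ * ((1 + η) ^ 2 * l) :=
    mul_le_mul_of_nonneg_left hAlk (by positivity)
  have h3 : ((1 + η) * B + 2 * c₀) * (η * (l * lk)) ≤ ((1 + η) * B + 2 * c₀) * (1 * (l * lk)) := by
    gcongr
  have h4 : ((1 + η) / 2 + 2) * S ≤ ((1 + η) / 2 + 2) * (A * κ + B * l) := by gcongr
  have h5 : ((c₀ + 1) / 2 + 1) * H ≤ ((c₀ + 1) / 2 + 1) * (2 * l) := by gcongr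
  have h6 : ((1 + η) * κ + c₀) * (a + l / 2) ≤ ((1 + η) * κ + c₀) * (1 + l / 2) := by gcongr
  have h7 : 0 ≤ c₀ * l := by positivity
  linarith

theorem leading_coefficient_le {η : ℝ} (h0 : 0 ≤ η) (h1 : η ≤ 1) :
    (1 + η) / 2 + (1 + η) ^ 3 * (2 + η) + η ≤ 5 / 2 + 40 * η := by
  have q2 : η ^ 2 ≤ η := by nlinarith
  have q3 : η ^ 3 ≤ η := by nlinarith
  have q4 : η ^ 4 ≤ η := by nlinarith
  linarith

section Level

variable {T : ℕ → ℝ} {α : ℝ}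

/-- The leading constant is `1/2 + 2`: the mixture code loses `(log n) / 2` for each of the `K n`
symbols below the threshold, and each of the `(1 + α) K n` redacted symbols costs
`2 log (K n) ∼ 2 (log n) / (1 + α)`. -/
theorem eventually_redundancyBound_le (hpos : ∀ k, 0 < T k) (hanti : Antitone T)
    (hlim : Tendsto T atTop (𝓝 0)) (hα : 0 < α)
    (hu : Tendsto (fun k : ℕ => ((k : ℝ) + 1) * logDecrement T k) atTop (𝓝 α))
    {η C V : ℝ} (hη : 0 < η) (hη1 : η ≤ 1) (hηα : η < α) (hC : 0 ≤ C) (hV : 0 ≤ V) :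
    ∀ᶠ n : ℕ in atTop, redundancyBound n (level T) η (1 + η) C (V * level T n) ≤
      (5 / 2 + 40 * η) * (level T n * Real.log n) := by
  have hT0 := hpos 0
  have hK := tendsto_level hanti hpos
  have hKr : Tendsto (fun n : ℕ => (level T n : ℝ)) atTop atTop :=
    tendsto_natCast_atTop_atTop.comp hK
  have hlogn : Tendsto (fun n : ℕ => Real.log n) atTop atTop :=
    Real.tendsto_log_atTop.comp tendsto_natCast_atTop_atTop
  -- coefficients of the negligible quantities `K n`, `log n`, `1` and `log n · log (K n)`
  obtain ⟨c₀, hc₀⟩ : ∃ c : ℝ, c = 1 + 1 / (4 * η) := ⟨_, rfl⟩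
  obtain ⟨A, hA⟩ : ∃ c : ℝ, c = 1 + α + (1 + α) * η := ⟨_, rfl⟩
  obtain ⟨B, hB⟩ : ∃ c : ℝ, c = 2 * (1 + T 0) := ⟨_, rfl⟩
  obtain ⟨C', hC'⟩ : ∃ c : ℝ, c = Real.log 3 + Real.log 2 + C := ⟨_, rfl⟩
  have hlog2 : 0 < Real.log 2 := Real.log_pos one_lt_two
  have hlog2' : Real.log 2 ≤ 1 := by
    have := Real.log_le_sub_one_of_pos (zero_lt_two' ℝ); linarith
  have hlog3 : 0 < Real.log 3 := Real.log_pos (by norm_num)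
  have hc₀pos : 0 < c₀ := by rw [hc₀]; positivity
  have hApos : 0 < A := by rw [hA]; positivity
  have hBpos : 0 < B := by rw [hB]; positivity
  have hC'pos : 0 < C' := by rw [hC']; positivity
  obtain ⟨cK, hcK⟩ : ∃ c : ℝ, c = ((1 + η) / 2 + 2) * A + (1 + η) + (1 + η) * V + (1 + η) * A * C' := ⟨_, rfl⟩
  obtain ⟨cl, hcl⟩ : ∃ c : ℝ, c = ((1 + η) / 2 + 2) * B + 2 * ((c₀ + 1) / 2 + 1) + c₀ +
    ((1 + η) * B + 2 * c₀) * C' := ⟨_, rfl⟩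
  obtain ⟨cll, hcll⟩ : ∃ c : ℝ, c = ((1 + η) * B + 2 * c₀) * 3 := ⟨_, rfl⟩
  have hcKpos : 0 ≤ cK := by rw [hcK]; positivity
  have hclpos : 0 ≤ cl := by rw [hcl]; positivity
  have hcllpos : 0 ≤ cll := by rw [hcll]; positivity
  obtain ⟨ct, hct⟩ : ∃ c : ℝ, c = cK + cl + (c₀ + 3) + cll := ⟨_, rfl⟩
  have hctpos : 0 < ct := by rw [hct]; positivity
  obtain ⟨ν, hν⟩ : ∃ c : ℝ, c = η / ct := ⟨_, rfl⟩
  have hνpos : 0 < ν := by rw [hν]; positivity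
  have hlogK : ∀ᶠ n : ℕ in atTop, Real.log (level T n) ≤ ν * level T n := by
    have h1 := (Real.isLittleO_log_id_atTop.bound hνpos)
    filter_upwards [hKr.eventually h1, hKr.eventually_ge_atTop 1] with n h2 h3
    rw [Real.norm_of_nonneg (Real.log_nonneg h3), id,
      Real.norm_of_nonneg (by linarith)] at h2
    exact h2
  filter_upwards [hlogK, hKr.eventually_ge_atTop (1 / ν), hlogn.eventually_ge_atTop (1 / ν),
    hKr.eventually_ge_atTop 1, hlogn.eventually_ge_atTop 1,
    eventually_sum_level_div_le hpos hanti hlim hu (show 0 < (1 + α) * η by positivity),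
    eventually_log_level_le hpos hanti hlim hu hη hηα, eventually_ge_atTop 1]
    with n h1 h2 h3 h4 h5 h6 h7 h8
  rw [redundancyBound_eq, ← hc₀]
  generalize hS : ∑ i ∈ Finset.range n, (level T (i + 1) : ℝ) / (i + 1) = S at h6 ⊢
  generalize hH : ∑ i ∈ Finset.range n, 1 / ((i : ℝ) + 1) = H
  have hS0 : 0 ≤ S := hS ▸ Finset.sum_nonneg fun i _ => by positivity
  have hH0 : 0 ≤ H := hH ▸ Finset.sum_nonneg fun i _ => by positivity
  have hHl : H ≤ 1 + Real.log n := hH ▸ sum_one_div_le n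
  clear hS hH
  generalize (level T n : ℝ) = κ at h1 h2 h4 h6 h7 ⊢
  have hlog : Real.log (κ + 2) ≤ Real.log 3 + Real.log κ := by
    rw [← Real.log_mul (by norm_num) (by linarith)]
    exact Real.log_le_log (by linarith) (by linarith)
  have hlk0 : 0 ≤ Real.log κ := Real.log_nonneg h4
  generalize Real.log (n : ℝ) = l at h3 h5 h6 h7 hHl ⊢
  generalize Real.log κ = lk at h1 h7 hlog hlk0 ⊢
  rw [← hA] at h6
  have hSl : S ≤ A * κ + B * l := by
    have h9 : (1 + T 0) * (1 + l) ≤ B * l := by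
      rw [hB]; nlinarith
    linarith
  have hAlk : A * lk ≤ (1 + η) ^ 2 * l := by
    have : A * lk = (1 + η) * ((1 + α) * lk) := by rw [hA]; ring
    rw [this, sq, mul_assoc]
    exact mul_le_mul_of_nonneg_left h7 (by positivity)
  refine (redundancy_terms_le (C := C') hη.le hC'pos.le hc₀pos.le (by linarith)
    (by linarith) hlk0 hS0 hH0 hSl (by linarith) (by rw [hC']; linarith) hη1 hAlk hBpos.le
    hlog2').trans ?_
  -- the four negligible quantities
  have n1 : κ ≤ ν * (κ * l) := by
    rw [div_le_iff₀ hνpos] at h3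
    have := mul_le_mul_of_nonneg_left h3 (show 0 ≤ κ by linarith)
    linarith
  have n2 : l ≤ ν * (κ * l) := by
    rw [div_le_iff₀ hνpos] at h2
    have := mul_le_mul_of_nonneg_left h2 (show 0 ≤ l by linarith)
    linarith
  have n3 : 1 ≤ ν * (κ * l) := h5.trans n2
  have n4 : l * lk ≤ ν * (κ * l) := by
    have := mul_le_mul_of_nonneg_left h1 (show 0 ≤ l by linarith)
    linarith
  have p1 := mul_le_mul_of_nonneg_left n1 hcKpos
  have p2 := mul_le_mul_of_nonneg_left n2 hclpos
  have p3 := mul_le_mul_of_nonneg_left n3 (show 0 ≤ c₀ + 3 by positivity)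
  have p4 := mul_le_mul_of_nonneg_left n4 hcllpos
  have hctν : ct * (ν * (κ * l)) = η * (κ * l) := by
    rw [hν]; field_simp
  have hsum : cK * κ + cl * l + (c₀ + 3) + cll * (l * lk) ≤ η * (κ * l) := by
    rw [← hctν, hct]
    linarith
  have hκl : 0 ≤ κ * l := mul_nonneg (by linarith) (by linarith)
  have := mul_le_mul_of_nonneg_right (leading_coefficient_le hη.le hη1) hκl
  rw [hcK, hcl, hcll] at hsum
  linarith

end Level

theorem level_tail_facts {f : ℕ+ → ℝ} (hf : IsEnvelope f) (hmono : UltimatelyNonincreasing f)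
    (hfr : IsFrechetEnvelope f) :
    ∃ α : ℝ, 0 < α ∧
      Tendsto (fun k : ℕ => k * ((tailSum f k - tailSum f (k + 1)) / tailSum f k)) atTop (𝓝 α) ∧
      Tendsto (fun k : ℕ => ((k : ℝ) + 1) * logDecrement (tailSum f) k) atTop (𝓝 α) := by
  obtain ⟨α, hα, h⟩ := hfr.exists_tendsto hf hmono
  exact ⟨α, hα, h, tendsto_mul_log_decrement (tailSum_pos hf) (tailSum_antitone hf) h⟩

/-- The redundancy of the ETAC code is at most `(5/2 + o(1)) K log n`, with `K` the discrete
threshold. -/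
theorem eventually_maxRedundancy_le {f : ℕ+ → ℝ} (hf : IsEnvelope f)
    (hmono : UltimatelyNonincreasing f) (hfr : IsFrechetEnvelope f) {ε : ℝ} (hε : 0 < ε) :
    ∀ᶠ n : ℕ in atTop, maxRedundancy (codingDist n) (envelopeClass f n) ≤
      ENNReal.ofReal ((5 / 2 + ε) * (level (tailSum f) n * Real.logb 2 n)) := by
  obtain ⟨α, hα, -, hu⟩ := level_tail_facts hf hmono hfr
  have hpos := tailSum_pos hf
  have hanti := tailSum_antitone hf
  have hlim := tendsto_tailSum hf
  set η : ℝ := min (min 1 (α / 2)) (ε / 40) with hη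
  have hη0 : 0 < η := lt_min (lt_min one_pos (by linarith)) (by linarith)
  have hη1 : η ≤ 1 := (min_le_left _ _).trans (min_le_left _ _)
  have hηα : η < α := lt_of_le_of_lt ((min_le_left _ _).trans (min_le_right _ _)) (by linarith)
  have hηε : 40 * η ≤ ε := by
    have : η ≤ ε / 40 := min_le_right _ _
    linarith
  obtain ⟨C, hC, helias⟩ := exists_eliasLength_le hη0
  obtain ⟨θ, hθ0, hθ1, hθ⟩ := exists_tail_two_mul_le hpos hα hu
  obtain ⟨k₀, hk₀⟩ := eventually_atTop.mp hθ
  have hV : 0 ≤ 1 / (1 - θ) := one_div_nonneg.mpr (by linarith)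
  filter_upwards [eventually_redundancyBound_le hpos hanti hlim hα hu hη0 hη1 hηα hC hV,
    (tendsto_level hanti hpos).eventually_ge_atTop (max k₀ 1), eventually_ge_atTop 1]
    with n h1 h2 h3
  have hl2 : 0 < Real.log 2 := Real.log_pos one_lt_two
  refine (maxRedundancy_codingDist_le hf (level_mono hanti hpos)
    (fun i _ => mul_tail_level_le hanti i) h3 ((le_max_right _ _).trans h2) hη0
    (by linarith : (0 : ℝ) ≤ 1 + η) hC helias (V := 1 / (1 - θ) * level (tailSum f) n) ?_
    (by positivity)).trans ?_
  · refine (mul_le_mul_right (tsum_tail_dyadic_le hpos hθ0 hθ1 hk₀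
      ((le_max_left _ _).trans h2)) _).trans ?_
    rw [← ENNReal.ofReal_natCast, ← ENNReal.ofReal_mul (Nat.cast_nonneg n)]
    apply ENNReal.ofReal_le_ofReal
    rw [mul_div_assoc', one_div_mul_eq_div]
    exact div_le_div_of_nonneg_right (mul_tail_level_le hanti n) (by linarith)
  · apply ENNReal.ofReal_le_ofReal
    rw [div_le_iff₀ hl2]
    refine h1.trans ?_
    have h4 : (5 / 2 + ε) * (level (tailSum f) n * Real.logb 2 n) * Real.log 2 =
        (5 / 2 + ε) * (level (tailSum f) n * Real.log n) := by
      rw [Real.logb]; field_simp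
    rw [h4]
    have h5 : 0 ≤ level (tailSum f) n * Real.log n :=
      mul_nonneg (Nat.cast_nonneg _) (Real.log_natCast_nonneg n)
    exact mul_le_mul_of_nonneg_right (by linarith) h5

/-! ### The lower bound on the minimax redundancy -/

/-- The law of `n` independent symbols with distribution `p`. -/
def wordPMF (p : PMF ℕ+) (n : ℕ) : PMF (Fin n → ℕ+) :=
  ⟨fun x => ∏ i, p (x i), by
    have h := lintegral_wordMeasure (n := n) p fun _ => 1
    rw [lintegral_const, measure_univ, mul_one] at h
    simp only [mul_one] at h
    rw [h]
    exact ENNReal.summable.hasSum⟩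

theorem wordPMF_apply (p : PMF ℕ+) {n : ℕ} (x : Fin n → ℕ+) :
    wordPMF p n x = ∏ i, p (x i) := rfl

section TwoPoint

variable {f : ℕ+ → ℝ} {j₁ : ℕ+} {L n : ℕ} {w : ℝ}

/-- The two symbols of the `t`-th pair beyond `j₁`. -/
def pairSymbol (j₁ : ℕ+) (t : ℕ) (b : Bool) : ℕ+ := ⟨j₁ + 2 * t + 1 + b.toNat, by omega⟩

theorem pairSymbol_coe (j₁ : ℕ+) (t : ℕ) (b : Bool) :
    (pairSymbol j₁ t b : ℕ) = j₁ + 2 * t + 1 + b.toNat := rfl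

theorem pairSymbol_inj {t t' : ℕ} {b b' : Bool} (h : pairSymbol j₁ t b = pairSymbol j₁ t' b') :
    t = t' ∧ b = b' := by
  have h1 : (j₁ : ℕ) + 2 * t + 1 + b.toNat = j₁ + 2 * t' + 1 + b'.toNat := congrArg PNat.val h
  have h2 : b.toNat ≤ 1 := Bool.toNat_le b
  have h3 : b'.toNat ≤ 1 := Bool.toNat_le b'
  have h4 : b.toNat = b'.toNat := by omega
  exact ⟨by omega, by cases b <;> cases b' <;> simp_all⟩

/-- The symbols selected by `v` in the first `L` pairs. -/
def selected (j₁ : ℕ+) (v : Fin L → Bool) : Finset ℕ+ :=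
  Finset.univ.image fun t : Fin L => pairSymbol j₁ t (v t)

theorem mem_selected {v : Fin L → Bool} {t : Fin L} {b : Bool} :
    pairSymbol j₁ t b ∈ selected j₁ v ↔ b = v t := by
  unfold selected
  simp only [Finset.mem_image, Finset.mem_univ, true_and]
  constructor
  · rintro ⟨t', h⟩
    obtain ⟨h1, h2⟩ := pairSymbol_inj h
    rw [← h2, Fin.ext h1]
  · rintro rfl
    exact ⟨t, rfl⟩

theorem disjoint_selected (v : Fin L → Bool) : Disjoint (Finset.Iic j₁) (selected j₁ v) := by
  rw [Finset.disjoint_left]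
  intro j hj hj'
  obtain ⟨t, -, rfl⟩ := Finset.mem_image.mp hj'
  have h1 : (pairSymbol j₁ t (v t) : ℕ) ≤ j₁ := PNat.coe_le_coe _ _ |>.mpr (Finset.mem_Iic.mp hj)
  rw [pairSymbol_coe] at h1
  omega

/-- A source putting mass `w` on each of the symbols selected by `v`, and the rest of its mass on
the symbols up to `j₁`, proportionally to the envelope. -/
def twoPointMass (f : ℕ+ → ℝ) (j₁ : ℕ+) (w : ℝ) (v : Fin L → Bool) (j : ℕ+) : ℝ :=
  if j ≤ j₁ then f j * ((1 - L * w) / ∑ i ∈ Finset.Iic j₁, f i)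
  else if j ∈ selected j₁ v then w else 0

theorem twoPointMass_nonneg (hf : IsEnvelope f) (hw : 0 ≤ w) (hLw : L * w ≤ 1)
    (v : Fin L → Bool) (j : ℕ+) : 0 ≤ twoPointMass f j₁ w v j := by
  unfold twoPointMass
  have h1 : 0 ≤ ∑ i ∈ Finset.Iic j₁, f i := Finset.sum_nonneg fun i _ => (hf.pos i).le
  split_ifs
  · exact mul_nonneg (hf.pos j).le (div_nonneg (by linarith) h1)
  · exact hw
  · exact le_rfl

theorem sum_twoPointMass (hs : 1 ≤ ∑ i ∈ Finset.Iic j₁, f i) (v : Fin L → Bool) :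
    ∑ j ∈ (Finset.Iic j₁).disjUnion (selected j₁ v) (disjoint_selected v),
      twoPointMass f j₁ w v j = 1 := by
  have h0 : ∑ i ∈ Finset.Iic j₁, f i ≠ 0 := by linarith
  have h1 : ∑ j ∈ Finset.Iic j₁, twoPointMass f j₁ w v j = 1 - L * w := by
    rw [Finset.sum_congr rfl (g := fun j => f j * ((1 - L * w) / ∑ i ∈ Finset.Iic j₁, f i))
      (fun j hj => by rw [twoPointMass, if_pos (Finset.mem_Iic.mp hj)]), ← Finset.sum_mul,
      mul_div_cancel₀ _ h0]
  have h2 : ∑ j ∈ selected j₁ v, twoPointMass f j₁ w v j = L * w := by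
    rw [Finset.sum_congr rfl (g := fun _ => w) (fun j hj => by
      rw [twoPointMass, if_neg (fun h => Finset.disjoint_left.mp (disjoint_selected v)
        (Finset.mem_Iic.mpr h) hj), if_pos hj]), Finset.sum_const, nsmul_eq_mul]
    congr 2
    unfold selected
    rw [Finset.card_image_of_injective _ fun t t' h => Fin.ext (pairSymbol_inj h).1]
    simp
  rw [Finset.sum_disjUnion, h1, h2]
  ring

/-- The distribution with mass function `twoPointMass`. -/
def twoPointPMF (hf : IsEnvelope f) (hs : 1 ≤ ∑ i ∈ Finset.Iic j₁, f i) (hw : 0 ≤ w)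
    (hLw : L * w ≤ 1) (v : Fin L → Bool) : PMF ℕ+ :=
  PMF.ofFinset (fun j => ENNReal.ofReal (twoPointMass f j₁ w v j))
    ((Finset.Iic j₁).disjUnion (selected j₁ v) (disjoint_selected v))
    (by rw [← ENNReal.ofReal_sum_of_nonneg fun j _ => twoPointMass_nonneg hf hw hLw v j,
          sum_twoPointMass hs, ENNReal.ofReal_one])
    (fun j hj => by
      rw [Finset.mem_disjUnion, not_or, Finset.mem_Iic] at hj
      rw [twoPointMass, if_neg hj.1, if_neg hj.2, ENNReal.ofReal_zero])

variable (hf : IsEnvelope f) (hs : 1 ≤ ∑ i ∈ Finset.Iic j₁, f i) (hw : 0 ≤ w)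
  (hLw : L * w ≤ 1)

theorem twoPointPMF_le (hwf : ∀ j : ℕ+, j₁ < j → (j : ℕ) ≤ j₁ + 2 * L → w ≤ f j)
    (v : Fin L → Bool) (j : ℕ+) :
    twoPointPMF hf hs hw hLw v j ≤ ENNReal.ofReal (f j) := by
  rw [twoPointPMF, PMF.ofFinset_apply]
  apply ENNReal.ofReal_le_ofReal
  unfold twoPointMass
  have hLw0 : 0 ≤ L * w := by positivity
  split_ifs with h1 h2
  · refine mul_le_of_le_one_right (hf.pos j).le ?_
    rw [div_le_one (by linarith)]
    linarith
  · refine hwf j (not_le.mp h1) ?_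
    obtain ⟨t, -, rfl⟩ := Finset.mem_image.mp h2
    have := t.2
    have := Bool.toNat_le (v t)
    rw [pairSymbol_coe]
    omega
  · exact (hf.pos j).le

theorem twoPointPMF_pairSymbol (v : Fin L → Bool) (t : Fin L) (b : Bool) :
    twoPointPMF hf hs hw hLw v (pairSymbol j₁ t b) =
      if b = v t then ENNReal.ofReal w else 0 := by
  rw [twoPointPMF, PMF.ofFinset_apply]
  have h : ¬ pairSymbol j₁ t b ≤ j₁ := by
    rw [← PNat.coe_le_coe, pairSymbol_coe]
    omega
  rw [twoPointMass, if_neg h]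
  simp only [mem_selected]
  split_ifs <;> simp

/-- The pairs which are hit by the word `x`. -/
def hitPairs (j₁ : ℕ+) (L : ℕ) (x : Fin n → ℕ+) : Finset (Fin L) :=
  Finset.univ.filter fun t => ∃ i b, x i = pairSymbol j₁ t b

theorem le_lintegral_card_hitPairs (hw1 : w ≤ 1) (v : Fin L → Bool) :
    ENNReal.ofReal (L * (1 - (1 - w) ^ n)) ≤
      ∑' x, wordPMF (twoPointPMF hf hs hw hLw v) n x * ((hitPairs j₁ L x).card : ℝ≥0∞) := by
  set p := twoPointPMF hf hs hw hLw v with hp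
  have h1 : ∑' x, wordPMF p n x * ((hitPairs j₁ L x).card : ℝ≥0∞) =
      ∫⁻ x, ((hitPairs j₁ L x).card : ℝ≥0∞) ∂(wordMeasure p n) := by
    rw [lintegral_wordMeasure]; rfl
  have h2 : ∀ t : Fin L, ENNReal.ofReal (1 - (1 - w) ^ n) ≤
      wordMeasure p n {x | ∃ i, x i = pairSymbol j₁ t (v t)} := by
    intro t
    set s : Set ℕ+ := {pairSymbol j₁ t (v t)}ᶜ with hsdef
    have h3 : p.toMeasure s = ENNReal.ofReal (1 - w) := by
      rw [hsdef, prob_compl_eq_one_sub (MeasurableSet.of_discrete),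
        PMF.toMeasure_apply_singleton _ _ (measurableSet_singleton _), hp,
        twoPointPMF_pairSymbol, if_pos rfl, ENNReal.ofReal_sub _ hw, ENNReal.ofReal_one]
    have h4 : wordMeasure p n (Set.univ.pi fun _ => s) = ENNReal.ofReal ((1 - w) ^ n) := by
      rw [wordMeasure, Measure.pi_pi, Finset.prod_const, h3, Finset.card_univ, Fintype.card_fin,
        ENNReal.ofReal_pow (by linarith)]
    have h5 : {x : Fin n → ℕ+ | ∃ i, x i = pairSymbol j₁ t (v t)} =
        (Set.univ.pi fun _ => s)ᶜ := by
      ext x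
      simp [s, Set.mem_pi]
    rw [h5, prob_compl_eq_one_sub MeasurableSet.of_discrete, h4,
      ENNReal.ofReal_sub _ (pow_nonneg (by linarith) n), ENNReal.ofReal_one]
  rw [h1]
  calc ENNReal.ofReal (L * (1 - (1 - w) ^ n))
      = ∑ t : Fin L, ENNReal.ofReal (1 - (1 - w) ^ n) := by
        rw [Finset.sum_const, Finset.card_univ, Fintype.card_fin, nsmul_eq_mul,
          ENNReal.ofReal_mul (Nat.cast_nonneg L), ENNReal.ofReal_natCast]
    _ ≤ ∑ t : Fin L, wordMeasure p n {x | ∃ i, x i = pairSymbol j₁ t (v t)} :=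
        Finset.sum_le_sum fun t _ => h2 t
    _ = ∫⁻ x, ∑ t : Fin L, Set.indicator {x | ∃ i, x i = pairSymbol j₁ t (v t)} 1 x
          ∂(wordMeasure p n) := by
        rw [lintegral_finsetSum _ fun t _ => measurable_of_countable _]
        exact Finset.sum_congr rfl fun t _ =>
          (lintegral_indicator_one MeasurableSet.of_discrete).symm
    _ ≤ _ := by
        refine lintegral_mono fun x => ?_
        rw [hitPairs, Finset.card_filter]
        push_cast
        refine Finset.sum_le_sum fun t _ => ?_
        by_cases h : ∃ i, x i = pairSymbol j₁ t (v t)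
        · obtain ⟨i, hi⟩ := h
          rw [if_pos ⟨i, v t, hi⟩]
          exact Set.indicator_le_self' (fun _ _ => zero_le) _
        · have h' : x ∉ {x : Fin n → ℕ+ | ∃ i, x i = pairSymbol j₁ t (v t)} := h
          rw [Set.indicator_of_notMem h']
          exact zero_le

/-- All the `v` for which the word `x` is possible agree on the pairs hit by `x`. -/
theorem card_possible_mul_le (x : Fin n → ℕ+) :
    (Finset.univ.filter fun v : Fin L → Bool =>
      wordPMF (twoPointPMF hf hs hw hLw v) n x ≠ 0).card * 2 ^ (hitPairs j₁ L x).card ≤ 2 ^ L := by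
  set H := hitPairs j₁ L x with hH
  rcases (Finset.univ.filter fun v : Fin L → Bool =>
      wordPMF (twoPointPMF hf hs hw hLw v) n x ≠ 0).eq_empty_or_nonempty with h | ⟨v₀, hv₀⟩
  · rw [h]; simp
  have hforce : ∀ v : Fin L → Bool, wordPMF (twoPointPMF hf hs hw hLw v) n x ≠ 0 →
      ∀ (t : Fin L) i b, x i = pairSymbol j₁ t b → b = v t := by
    intro v hv t i b hi
    rw [wordPMF_apply, Finset.prod_ne_zero_iff] at hv
    have h1 := hv i (Finset.mem_univ i)
    rw [hi, twoPointPMF_pairSymbol] at h1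
    by_contra hc
    rw [if_neg hc] at h1
    exact h1 rfl
  have hsub : (Finset.univ.filter fun v : Fin L → Bool =>
      wordPMF (twoPointPMF hf hs hw hLw v) n x ≠ 0) ⊆
      Fintype.piFinset fun t => if t ∈ H then {v₀ t} else Finset.univ := by
    intro v hv
    rw [Fintype.mem_piFinset]
    intro t
    split_ifs with ht
    · obtain ⟨i, b, hi⟩ := (Finset.mem_filter.mp ht).2
      rw [Finset.mem_singleton, ← hforce v (Finset.mem_filter.mp hv).2 t i b hi,
        ← hforce v₀ (Finset.mem_filter.mp hv₀).2 t i b hi]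
    · exact Finset.mem_univ _
  have hcard := Finset.card_le_card hsub
  have h1 : (Fintype.piFinset fun t => if t ∈ H then {v₀ t} else Finset.univ).card =
      2 ^ (L - H.card) := by
    rw [Fintype.card_piFinset]
    have : ∀ t, (if t ∈ H then ({v₀ t} : Finset Bool) else Finset.univ).card =
        if t ∈ H then 1 else 2 := by
      intro t; split_ifs <;> simp
    simp only [this]
    rw [Finset.prod_ite, Finset.prod_const_one, one_mul, Finset.prod_const]
    congr 1
    rw [Finset.filter_not, Finset.card_sdiff_of_subset (Finset.filter_subset _ _)]
    simp
  have hHL : H.card ≤ L := by simpa using Finset.card_le_univ H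
  calc _ ≤ 2 ^ (L - H.card) * 2 ^ H.card := Nat.mul_le_mul_right _ (h1 ▸ hcard)
    _ = 2 ^ L := by rw [← pow_add, Nat.sub_add_cancel hHL]

/-- Reduction to a Bayesian problem with a uniform prior over `2 ^ L` sources: each pair hit by the
word reveals one bit of the parameter. -/
theorem le_minimaxRedundancy (hf : IsEnvelope f) (hs : 1 ≤ ∑ i ∈ Finset.Iic j₁, f i)
    (hw : 0 ≤ w) (hLw : L * w ≤ 1) (hw1 : w ≤ 1)
    (hwf : ∀ j : ℕ+, j₁ < j → (j : ℕ) ≤ j₁ + 2 * L → w ≤ f j) :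
    ENNReal.ofReal (L * (1 - (1 - w) ^ n)) ≤ minimaxRedundancy (envelopeClass f n) := by
  refine le_iInf fun Q => ?_
  set R := maxRedundancy Q (envelopeClass f n) with hR
  set B := ENNReal.ofReal (L * (1 - (1 - w) ^ n)) with hB
  set l := ENNReal.ofReal (Real.log 2) with hl
  have hl2 : 0 < Real.log 2 := Real.log_pos one_lt_two
  let P : (Fin L → Bool) → PMF (Fin n → ℕ+) := fun v => wordPMF (twoPointPMF hf hs hw hLw v) n
  have hPR : ∀ v, relEntropy (P v) Q ≤ R := fun v =>
    le_iSup₂_of_le (f := fun P' (_ : P' ∈ envelopeClass f n) => relEntropy P' Q) (P v)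
      ⟨twoPointPMF hf hs hw hLw v, twoPointPMF_le hf hs hw hLw hwf v, fun x => rfl⟩ le_rfl
  have h1 : ∀ v, B * l + 1 ≤ R * l +
      ∑' x, (if P v x = 0 then 0 else 2 ^ (hitPairs j₁ L x).card * Q x) := by
    intro v
    have h2 := tsum_mul_add_one_le_relEntropy (P v) Q fun x => (hitPairs j₁ L x).card
    refine le_trans ?_ (h2.trans ?_)
    · gcongr
      exact le_lintegral_card_hitPairs hf hs hw hLw hw1 v
    · gcongr
      exact hPR v
  have h2 : ∑ v, ∑' x, (if P v x = 0 then 0 else 2 ^ (hitPairs j₁ L x).card * Q x) ≤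
      (2 : ℝ≥0∞) ^ L := by
    rw [← Summable.tsum_finsetSum fun v _ => ENNReal.summable]
    calc _ ≤ ∑' x, (2 : ℝ≥0∞) ^ L * Q x := by
          refine ENNReal.tsum_le_tsum fun x => ?_
          have h3 := card_possible_mul_le (n := n) hf hs hw hLw x
          have h4 : ∑ v, (if P v x = 0 then 0 else 2 ^ (hitPairs j₁ L x).card * Q x) =
              (((Finset.univ.filter fun v => P v x ≠ 0).card *
                2 ^ (hitPairs j₁ L x).card : ℕ) : ℝ≥0∞) * Q x := by
            rw [Finset.sum_ite, Finset.sum_const_zero, zero_add, Finset.sum_const, nsmul_eq_mul]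
            push_cast
            ring
          rw [h4]
          gcongr
          exact_mod_cast h3
      _ = 2 ^ L := by rw [ENNReal.tsum_mul_left, PMF.tsum_coe, mul_one]
  have h3 := Finset.sum_le_sum fun v (_ : v ∈ Finset.univ) => h1 v
  rw [Finset.sum_const, Finset.sum_add_distrib, Finset.sum_const, Finset.card_univ,
    Fintype.card_fun, Fintype.card_bool, Fintype.card_fin, nsmul_eq_mul, nsmul_eq_mul] at h3
  push_cast at h3
  have h4 : (2 : ℝ≥0∞) ^ L * (B * l + 1) ≤ 2 ^ L * (R * l + 1) := by
    rw [mul_add (2 ^ L : ℝ≥0∞) (R * l), mul_one (2 ^ L : ℝ≥0∞)]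
    exact h3.trans (add_le_add_right h2 _)
  have h5 : B * l + 1 ≤ R * l + 1 :=
    (ENNReal.mul_le_mul_iff_right (by positivity) (by finiteness)).mp h4
  have h6 : B * l ≤ R * l := (ENNReal.add_le_add_iff_right ENNReal.one_ne_top).mp h5
  exact (ENNReal.mul_le_mul_iff_left (by simpa [hl] using hl2) ENNReal.ofReal_ne_top).mp h6

end TwoPoint

/-- The minimax redundancy is at least of the order of the discrete threshold. -/
theorem exists_le_minimaxRedundancy {f : ℕ+ → ℝ} (hf : IsEnvelope f)
    (hmono : UltimatelyNonincreasing f) (hfr : IsFrechetEnvelope f) :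
    ∃ κ : ℝ, 0 < κ ∧ ∀ᶠ n : ℕ in atTop,
      ENNReal.ofReal (κ * level (tailSum f) n) ≤ minimaxRedundancy (envelopeClass f n) := by
  obtain ⟨α, hα, hvm, hu⟩ := level_tail_facts hf hmono hfr
  have hpos := tailSum_pos hf
  have hanti := tailSum_antitone hf
  obtain ⟨j₀, hj₀⟩ := hmono
  obtain ⟨j₁, hj₁0, hs⟩ : ∃ j₁ : ℕ+, j₀ ≤ j₁ ∧ 1 ≤ ∑ i ∈ Finset.Iic j₁, f i := by
    obtain ⟨s, hs⟩ := (hf.summable.hasSum.eventually (lt_mem_nhds hf.one_lt_tsum)).exists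
    refine ⟨max j₀ (s.sup id), le_max_left _ _, hs.le.trans ?_⟩
    refine Finset.sum_le_sum_of_subset_of_nonneg (fun j hj => ?_) fun j _ _ => (hf.pos j).le
    exact Finset.mem_Iic.mpr ((Finset.le_sup (f := id) hj).trans (le_max_right _ _))
  set c : ℝ := min 1 (α / 8) with hc
  have hc0 : 0 < c := lt_min one_pos (by linarith)
  have hc1 : c ≤ 1 := min_le_left _ _
  have hexp : Real.exp (-c) < 1 := by rw [Real.exp_lt_one_iff]; linarith
  refine ⟨(1 - Real.exp (-c)) / 4, by linarith, ?_⟩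
  filter_upwards [eventually_increment_level_ge hpos hanti hα hvm hu,
    (tendsto_level hanti hpos).eventually_ge_atTop (2 * j₁ + 4),
    eventually_level_le hanti (tendsto_tailSum hf), eventually_ge_atTop 1] with n h1 h2 h3 h4
  set K := level (tailSum f) n with hK
  set L := (K - j₁) / 2 with hL
  have hn : (0 : ℝ) < n := by exact_mod_cast h4
  have hn1 : (1 : ℝ) ≤ n := by exact_mod_cast h4
  have hw : 0 ≤ c / n := by positivity
  have hw1 : c / n ≤ 1 := by rw [div_le_one hn]; linarith
  have hLw : L * (c / n) ≤ 1 := by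
    have hLn : (L : ℝ) ≤ n := by exact_mod_cast (show L ≤ n by omega)
    rw [mul_div_assoc', div_le_one hn]
    calc (L : ℝ) * c ≤ n * 1 := by gcongr
      _ = n := mul_one _
  have hwf : ∀ j : ℕ+, j₁ < j → (j : ℕ) ≤ j₁ + 2 * L → c / n ≤ f j := by
    intro j hj hjL
    have hjK : j ≤ K.succPNat := by
      rw [← PNat.coe_le_coe, Nat.succPNat_coe]
      omega
    have h5 : f K.succPNat ≤ f j :=
      hj₀ (hj₁0.trans hj.le) (hj₁0.trans (hj.le.trans hjK)) hjK
    rw [tailSum_sub_tailSum hf] at h1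
    rw [div_le_iff₀ hn]
    have h6 : c ≤ α / 8 := min_le_right _ _
    have h7 := mul_le_mul_of_nonneg_left h5 hn.le
    linarith
  refine le_trans (ENNReal.ofReal_le_ofReal ?_)
    (le_minimaxRedundancy (n := n) hf hs hw hLw hw1 hwf)
  have h5 : (1 - c / n) ^ n ≤ Real.exp (-c) := by
    have h6 := Real.one_sub_le_exp_neg (c / n)
    calc (1 - c / n) ^ n ≤ Real.exp (-(c / n)) ^ n := by
          gcongr
      _ = Real.exp (-c) := by
          rw [← Real.exp_nat_mul]
          congr 1
          field_simp
  have h6 : (K : ℝ) / 4 ≤ L := by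
    have : K ≤ 4 * L := by omega
    have : (K : ℝ) ≤ 4 * L := by exact_mod_cast this
    linarith
  calc (1 - Real.exp (-c)) / 4 * K = K / 4 * (1 - Real.exp (-c)) := by ring
    _ ≤ L * (1 - (1 - c / n) ^ n) := by
        refine mul_le_mul h6 (by linarith) (by linarith) (Nat.cast_nonneg L)

/-! ### The exact threshold -/

/-- The exact threshold of any smoothed envelope distribution function lies just below the
discrete one. -/
theorem exactThreshold_bounds {f : ℕ+ → ℝ} (hf : IsEnvelope f) {F : ℝ → ℝ}
    (hF : IsSmoothedEnvelope f F) {n : ℕ} (hn : 1 ≤ n) (hKn : level (tailSum f) n ≤ n)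
    (hK1 : 1 ≤ level (tailSum f) n) :
    (level (tailSum f) n : ℝ) - 1 < exactThreshold F n ∧
      exactThreshold F n ≤ level (tailSum f) n := by
  have hanti := tailSum_antitone hf
  have hn' : (0 : ℝ) < n := by exact_mod_cast hn
  obtain ⟨-, hm⟩ : 0 ≤ exactThreshold F n ∧
      1 - F (exactThreshold F n) = exactThreshold F n / n := by
    have h : exactThreshold F n ∈ {x | 0 ≤ x ∧ 1 - F x = x / n} := by
      rw [exactThreshold_spec hf hF hn']; rfl
    exact h
  set m := exactThreshold F n
  set K := level (tailSum f) n with hK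
  have hcdf : ∀ k : ℕ, 1 - F k = min 1 (tailSum f k) := by
    intro k
    rw [hF.coincide, envelopeCDF]
    split_ifs with h
    · rw [min_eq_right h.le]; ring
    · rw [min_eq_left (not_lt.mp h)]; ring
  constructor
  · obtain ⟨k, hk⟩ : ∃ k, K = k + 1 := ⟨K - 1, by omega⟩
    by_contra hc
    push Not at hc
    have hmk : m ≤ k := by rw [hk] at hc; push_cast at hc; linarith
    have h1 := hF.monotone hmk
    have h2 : (k : ℝ) / n < 1 - F k := by
      rw [hcdf, lt_min_iff, div_lt_one hn', div_lt_iff₀' hn']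
      exact ⟨by exact_mod_cast (show k < n by omega),
        (lt_level_iff hanti k n).mp (by omega)⟩
    have h3 : m / n ≤ k / n := div_le_div_of_nonneg_right hmk hn'.le
    linarith
  · by_contra hc
    push Not at hc
    have h1 := hF.monotone hc.le
    have h2 : 1 - F K ≤ K / n := by
      rw [hcdf, le_div_iff₀' hn']
      exact (mul_le_mul_of_nonneg_left (min_le_right _ _) hn'.le).trans (mul_tail_level_le hanti n)
    have h3 : (K : ℝ) / n < m / n := div_lt_div_of_pos_right hc hn'
    linarith

/-- The excess over `5/2` of the redundancy of the ETAC code, in units of `(K - 1) log n`. -/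
def redundancyExcess (f : ℕ+ → ℝ) (n : ℕ) : ℝ :=
  max 0 ((maxRedundancy (codingDist n) (envelopeClass f n)).toReal /
    ((level (tailSum f) n - 1) * Real.logb 2 n) - 5 / 2)

theorem tendsto_redundancyExcess {f : ℕ+ → ℝ} (hf : IsEnvelope f)
    (hmono : UltimatelyNonincreasing f) (hfr : IsFrechetEnvelope f) :
    Tendsto (redundancyExcess f) atTop (𝓝 0) := by
  refine tendsto_order.mpr ⟨fun b hb => Eventually.of_forall fun n =>
    hb.trans_le (le_max_left _ _), fun b hb => ?_⟩
  have hKr : Tendsto (fun n : ℕ => (level (tailSum f) n : ℝ)) atTop atTop :=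
    tendsto_natCast_atTop_atTop.comp (tendsto_level (tailSum_antitone hf) (tailSum_pos hf))
  filter_upwards [eventually_maxRedundancy_le hf hmono hfr (show 0 < b / 3 by positivity),
    hKr.eventually_gt_atTop (1 + (5 / 2 + b / 3) / (b / 3)), hKr.eventually_gt_atTop 1,
    eventually_ge_atTop 2] with n h1 h2 h3 h4
  have hl : 0 < Real.logb 2 n := Real.logb_pos one_lt_two (by exact_mod_cast h4)
  have h5 := ENNReal.toReal_le_of_le_ofReal (by positivity) h1
  set K : ℝ := (level (tailSum f) n : ℝ)
  refine max_lt hb ?_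
  rw [sub_lt_iff_lt_add, div_lt_iff₀ (mul_pos (by linarith) hl)]
  refine h5.trans_lt ?_
  rw [← mul_assoc, ← mul_assoc]
  refine mul_lt_mul_of_pos_right ?_ hl
  have h6 : 5 / 2 + b / 3 < (K - 1) * (b / 3) := by
    rw [← div_lt_iff₀ (by positivity)]
    linarith
  nlinarith

theorem eventually_maxRedundancy_le_excess {f : ℕ+ → ℝ} (hf : IsEnvelope f)
    (hmono : UltimatelyNonincreasing f) (hfr : IsFrechetEnvelope f) :
    ∀ᶠ n : ℕ in atTop, maxRedundancy (codingDist n) (envelopeClass f n) ≤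
      ENNReal.ofReal ((5 / 2 + redundancyExcess f n) * (level (tailSum f) n - 1) *
        Real.logb 2 n) := by
  have hK := tendsto_level (tailSum_antitone hf) (tailSum_pos hf)
  filter_upwards [eventually_maxRedundancy_le hf hmono hfr one_pos,
    hK.eventually_ge_atTop 2, eventually_ge_atTop 2] with n h1 h2 h3
  have hl : 0 < Real.logb 2 n := Real.logb_pos one_lt_two (by exact_mod_cast h3)
  have hK2 : (2 : ℝ) ≤ level (tailSum f) n := by exact_mod_cast h2
  have hpos : 0 < ((level (tailSum f) n : ℝ) - 1) * Real.logb 2 n := mul_pos (by linarith) hl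
  rw [← ENNReal.ofReal_toReal (ne_top_of_le_ne_top ENNReal.ofReal_ne_top h1)]
  apply ENNReal.ofReal_le_ofReal
  rw [mul_assoc, ← div_le_iff₀ hpos]
  have : _ ≤ redundancyExcess f n := le_max_right _ _
  linarith

end Etac

end

theorem theorem4p1 (f : ℕ+ → ℝ) (hf : Etac.IsEnvelope f) (hmono : Etac.UltimatelyNonincreasing f)
    (hfrechet : Etac.IsFrechetEnvelope f) :
    ∃ κ : ℝ, 0 < κ ∧ ∃ ε δ η : ℕ → ℝ,
      Tendsto ε atTop (𝓝 0) ∧ Tendsto δ atTop (𝓝 0) ∧ Tendsto η atTop (𝓝 0) ∧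
      ∀ᶠ n : ℕ in atTop,
        (∀ F : ℝ → ℝ, Etac.IsSmoothedEnvelope f F →
          ENNReal.ofReal ((κ + ε n) * Etac.exactThreshold F n) ≤
            Etac.minimaxRedundancy (Etac.envelopeClass f n) ∧
          Etac.minimaxRedundancy (Etac.envelopeClass f n) ≤
            Etac.maxRedundancy (Etac.codingDist n) (Etac.envelopeClass f n) ∧
          Etac.maxRedundancy (Etac.codingDist n) (Etac.envelopeClass f n) ≤
            ENNReal.ofReal ((5 / 2 + δ n) * Etac.exactThreshold F n * Real.logb 2 n)) ∧
        Etac.maxRedundancy (Etac.codingDist n) (Etac.envelopeClass f n) ≤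
          ENNReal.ofReal ((5 / (2 * κ) + η n) * Real.logb 2 n) *
            Etac.minimaxRedundancy (Etac.envelopeClass f n) := by
  obtain ⟨κ, hκ, hlow⟩ := Etac.exists_le_minimaxRedundancy hf hmono hfrechet
  have hexc := Etac.tendsto_redundancyExcess hf hmono hfrechet
  refine ⟨κ, hκ, fun _ => 0, Etac.redundancyExcess f, fun n => Etac.redundancyExcess f n / κ,
    tendsto_const_nhds, hexc, by simpa using hexc.div_const κ, ?_⟩
  have hanti := Etac.tailSum_antitone hf
  filter_upwards [hlow, Etac.eventually_maxRedundancy_le_excess hf hmono hfrechet,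
    Etac.eventually_level_le hanti (Etac.tendsto_tailSum hf),
    (Etac.tendsto_level hanti (Etac.tailSum_pos hf)).eventually_ge_atTop 1,
    eventually_ge_atTop 1] with n h1 h2 h3 h4 h5
  have hl : 0 ≤ Real.logb 2 n := Real.logb_nonneg one_lt_two (by exact_mod_cast h5)
  have hd : 0 ≤ Etac.redundancyExcess f n := le_max_left _ _
  have hK1 : (1 : ℝ) ≤ Etac.level (Etac.tailSum f) n := by exact_mod_cast h4
  refine ⟨fun F hF => ?_, ?_⟩
  · obtain ⟨h6, h7⟩ := Etac.exactThreshold_bounds hf hF h5 h3 h4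
    refine ⟨(ENNReal.ofReal_le_ofReal ?_).trans h1, iInf_le _ _,
      h2.trans (ENNReal.ofReal_le_ofReal ?_)⟩
    · rw [add_zero]
      exact mul_le_mul_of_nonneg_left h7 hκ.le
    · gcongr
  · refine h2.trans ?_
    refine le_trans ?_ (mul_le_mul_right h1 _)
    rw [← ENNReal.ofReal_mul (by positivity)]
    apply ENNReal.ofReal_le_ofReal
    have e : (5 / (2 * κ) + Etac.redundancyExcess f n / κ) * Real.logb 2 n *
        (κ * Etac.level (Etac.tailSum f) n) =
        (5 / 2 + Etac.redundancyExcess f n) * Etac.level (Etac.tailSum f) n * Real.logb 2 n := by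
      field_simp
    rw [e]
    gcongr
    linarith
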